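/- Conventions. A differentiable manifold is a $C^\infty$-manifold of locally constant finite dimension (different components may have different dimensions); differentiable means $C^\infty$; $\mathbb K$ is $\mathbb R$ or $\mathbb C$; vector bundles are $\mathbb K$-linear, of locally constant finite rank; $k\in\{0,1,2,\dots,\infty\}$. A differentiable groupoid $\Gamma\rightrightarrows X$ is a groupoid with $\Gamma,X$ differentiable manifolds, source $s$ and target $t$ submersive, and all structure maps differentiable; it is proper if it is Hausdorff and $(s,t):\Gamma\to X\times X$ is a proper map. A left Haar system on $\Gamma$ is a family $\mu=\{\mu_x\}_{x\in X}$ of positive Radon measures $\mu_x$ on the target fibres $\Gamma_x=t^{-1}(x)$, positive on nonempty open sets, left invariant ($\mu_{tg}(gA)=\mu_{sg}(A)$ for Borel $A\subset\Gamma_{sg}$), and arising from a $C^\infty$ positive volume density along the target fibres. A normalized left Haar system is a pair $\nu=(\mu,\kappa)$ where $\kappa:X\to[0,\infty)$ is $C^\infty$, $\operatorname{supp}(\kappa\circ s)\cap t^{-1}(K)$ is compact for every compact $K\subset X$, and $\int\kappa\circ s\,d\mu_x=1$ for all $x$; put $\nu_x=(\kappa\circ s)\mu_x$. An open $U\subset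 X$ is $\nu$-adapted if $\operatorname{supp}\kappa\cap\Gamma U\subset U$, where $\Gamma U=t(s^{-1}(U))$. For a vector bundle $E$ over a manifold and a subset $S$ of the base, $\Gamma^k(S;E)$ is the vector space of cross-sections over $S$ that extend, near each point of $S$, to a $C^k$ cross-section on an open neighbourhood of that point. For $\Omega$ open and relatively compact, the $C^k$-topology on $\Gamma^k(\overline\Omega;E)$ is the locally convex topology generated by the standard $C^r$-norms, $r\in\mathbb N$, $r\le k$; such a norm is the maximum, over a finite family of coordinate charts onto $\mathbb R^n$ whose open unit balls cover $\overline\Omega$, with local trivializations of $E$ and continuous fibre norms over the chart domains, of the suprema over the points of $\Omega$ in the unit balls of the norms of all partial derivatives of order $\le r$ of the local coordinate expression of the section. Proposition. Let $\Gamma\rightrightarrows X$ be a second countable, proper, differentiable groupoid, and let $\nu=(\mu,\kappa)$ be a normalized left Haar system on it. Let $f:P\to X$ be a differentiable mapping whose domain is a second countable Hausdorff manifold, and let $E$ be a differentiable vector bundle over $P$. Let $P\times_{f,t}\Gamma=\{(y,h): f(y)=th\}$, with projection $\mathrm{pr}_P$ onto $P$. The integration functional $$I:\Gamma^k(P\times_{f,t}\Gamma;\mathrm{pr}_P^*E)\to\Gamma^k(P;E),\qquad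 I(\vartheta)(y)=\int_{th=f(y)}\vartheta(y,h)\,d\nu_{f(y)}(h),$$ is a well-defined linear map (the integrands are integrable and $I(\vartheta)$ is of class $C^k$). Let $U$ be a relatively compact, $\nu$-adapted, open subset of $X$, let $V$ be a relatively compact open subset of $P$ with $f(V)\subset U$, and put $\Omega=\Gamma(U,U)=\{g: sg\in U,\ tg\in U\}$. Then there exists a unique linear map $$I_{V,U}:\Gamma^k(\overline{V\times_{f,t}\Omega};\mathrm{pr}_P^*E)\to\Gamma^k(\overline V;E)$$ such that $I_{V,U}(\vartheta|_{\overline{V\times_{f,t}\Omega}})=I(\vartheta)|_{\overline V}$ for every $\vartheta\in\Gamma^k(P\times_{f,t}\Gamma;\mathrm{pr}_P^*E)$ (closures taken in $P\times_{f,t}\Gamma$ and in $P$). This linear map is continuous for the $C^k$-topologies. -/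

import Mathlib

open Set Topology MeasureTheory
open scoped ContDiff ENNReal

noncomputable section

/-! ### Differentiable manifolds

A differentiable manifold is a topological space with a `C^∞` atlas whose charts take values in
real coordinate spaces `ℝⁿ`.  The dimension `n` may depend on the chart, so that different
components may have different dimensions. -/

/-- The coordinate space `ℝⁿ`. -/
abbrev EucR (n : ℕ) : Type := EuclideanSpace ℝ (Fin n)

/-- A set of charts on a topological space (data only). -/
class HasAtlas (X : Type*) [TopologicalSpace X] where
  atlas : Set (Σ n : ℕ, OpenPartialHomeomorph X (EucR n))

/-- The charts cover the space, and all changes of coordinates are `C^∞`. -/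
class IsDiffManifold (X : Type*) [TopologicalSpace X] [HasAtlas X] : Prop where
  cover : ∀ x : X, ∃ c ∈ HasAtlas.atlas (X := X), x ∈ c.2.source
  compat : ∀ c ∈ HasAtlas.atlas (X := X), ∀ d ∈ HasAtlas.atlas (X := X),
    ContDiffOn ℝ ∞ (d.2 ∘ c.2.symm) (c.2.symm.trans d.2).source

section Maps

variable {X Y : Type*} [TopologicalSpace X] [HasAtlas X] [TopologicalSpace Y] [HasAtlas Y]
variable {F : Type*} [NormedAddCommGroup F] [NormedSpace ℝ F]

/-- The vector-valued function `g` is of class `C^k` on the open set `B`. -/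
def CkOn (k : ℕ∞) (g : X → F) (B : Set X) : Prop :=
  ∀ c ∈ HasAtlas.atlas (X := X),
    ContDiffOn ℝ k (g ∘ c.2.symm) (c.2.target ∩ c.2.symm ⁻¹' B)

/-- Differentiable (that is, `C^∞`) mappings between manifolds. -/
def SmoothMap (g : X → Y) : Prop :=
  Continuous g ∧ ∀ c ∈ HasAtlas.atlas (X := X), ∀ d ∈ HasAtlas.atlas (X := Y),
    ContDiffOn ℝ ∞ (d.2 ∘ g ∘ c.2.symm) (c.2.target ∩ c.2.symm ⁻¹' (g ⁻¹' d.2.source))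

/-- A differentiable mapping all of whose tangent maps are surjective. -/
def SubmersiveMap (g : X → Y) : Prop :=
  SmoothMap g ∧ ∀ x : X, ∀ c ∈ HasAtlas.atlas (X := X), ∀ d ∈ HasAtlas.atlas (X := Y),
    x ∈ c.2.source → g x ∈ d.2.source →
      Function.Surjective (fderiv ℝ (d.2 ∘ g ∘ c.2.symm) (c.2 x))

/-- `φ` is a `C^∞` diffeomorphism from an open subset of the manifold onto an open subset of
a normed vector space: an arbitrary local coordinate chart, not necessarily in the given atlas. -/
def IsSmoothChart (φ : OpenPartialHomeomorph X F) : Prop :=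
  ∀ c ∈ HasAtlas.atlas (X := X),
    ContDiffOn ℝ ∞ (φ ∘ c.2.symm) (c.2.symm.trans φ).source ∧
    ContDiffOn ℝ ∞ (c.2 ∘ φ.symm) (φ.symm.trans c.2).source

end Maps

/-! ### Fibre products -/

/-- The fibre product `A ×_{f,g} B = {(a, b) | f a = g b}`. -/
def FiberProduct {A B C : Type*} (f : A → C) (g : B → C) : Type _ :=
  {p : A × B // f p.1 = g p.2}

namespace FiberProduct

variable {A B C : Type*} [TopologicalSpace A] [TopologicalSpace B] {f : A → C} {g : B → C}

instance : TopologicalSpace (FiberProduct f g) :=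
  inferInstanceAs (TopologicalSpace {p : A × B // f p.1 = g p.2})

/-- The fibre product (of transversal maps) is an embedded submanifold of `A × B`.  Its charts are
the homeomorphisms `φ` from open subsets of the fibre product, in the subspace topology, onto open
subsets of `ℝⁿ` such that `φ⁻¹`, viewed as a map into `A × B`, is a `C^∞` immersion. -/
instance [HasAtlas A] [HasAtlas B] : HasAtlas (FiberProduct f g) where
  atlas := {φ | ∀ c ∈ HasAtlas.atlas (X := A), ∀ d ∈ HasAtlas.atlas (X := B),
    ContDiffOn ℝ ∞ (fun v => (c.2 (φ.2.symm v).1.1, d.2 (φ.2.symm v).1.2))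
      (φ.2.target ∩ φ.2.symm ⁻¹' {z | z.1.1 ∈ c.2.source ∧ z.1.2 ∈ d.2.source}) ∧
    ∀ v ∈ φ.2.target ∩ φ.2.symm ⁻¹' {z | z.1.1 ∈ c.2.source ∧ z.1.2 ∈ d.2.source},
      Function.Injective
        (fderiv ℝ (fun w => (c.2 (φ.2.symm w).1.1, d.2 (φ.2.symm w).1.2)) v)}

end FiberProduct

/-! ### Differentiable vector bundles, of locally constant finite rank -/

section Bundles

variable (𝕜 : Type*) [RCLike 𝕜] {X : Type*} [TopologicalSpace X]
variable (E : X → Type*) [∀ x, AddCommGroup (E x)] [∀ x, Module 𝕜 (E x)]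

/-- A local trivialization `E|_U ≃ U × 𝕜^N` over the open set `U = base`, given by the linear
isomorphisms `coord x : E x → 𝕜^N` for `x ∈ U` (the values at `x ∉ U` are irrelevant). -/
structure LocTriv where
  rank : ℕ
  base : Set X
  isOpen_base : IsOpen base
  coord : ∀ x, E x →ₗ[𝕜] (Fin rank → 𝕜)
  symm : ∀ x, (Fin rank → 𝕜) →ₗ[𝕜] E x
  left_inv : ∀ x ∈ base, ∀ e, symm x (coord x e) = e
  right_inv : ∀ x ∈ base, ∀ v, coord x (symm x v) = v

/-- A set of local trivializations (data only). -/
class HasTrivs where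
  trivs : Set (LocTriv 𝕜 E)

variable {𝕜 E}

/-- The transition function from `σ` to `τ` is of class `C^∞`. -/
def SmoothTransition [HasAtlas X] (σ τ : LocTriv 𝕜 E) : Prop :=
  ∀ v, CkOn ⊤ (fun x => τ.coord x (σ.symm x v)) (σ.base ∩ τ.base)

variable (𝕜 E)

/-- A differentiable vector bundle over `X`: the trivializations cover `X`, and the transition
functions between them are `C^∞`. -/
class IsDiffVectorBundle [HasAtlas X] [HasTrivs 𝕜 E] : Prop where
  cover : ∀ x : X, ∃ τ ∈ HasTrivs.trivs (𝕜 := 𝕜) (E := E), x ∈ τ.base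
  compat : ∀ σ ∈ HasTrivs.trivs (𝕜 := 𝕜) (E := E), ∀ τ ∈ HasTrivs.trivs (𝕜 := 𝕜) (E := E),
    SmoothTransition σ τ

theorem IsDiffVectorBundle.finite [HasAtlas X] [HasTrivs 𝕜 E] [IsDiffVectorBundle 𝕜 E] (x : X) :
    Module.Finite 𝕜 (E x) := by
  obtain ⟨τ, -, hx⟩ := IsDiffVectorBundle.cover (𝕜 := 𝕜) (E := E) x
  exact Module.Finite.of_surjective (τ.symm x) fun e => ⟨τ.coord x e, τ.left_inv x hx e⟩

variable {𝕜 E}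

/-- An arbitrary `C^∞` local trivialization of the bundle. -/
def IsSmoothTriv [HasAtlas X] [HasTrivs 𝕜 E] (σ : LocTriv 𝕜 E) : Prop :=
  ∀ τ ∈ HasTrivs.trivs (𝕜 := 𝕜) (E := E), SmoothTransition σ τ ∧ SmoothTransition τ σ

variable (𝕜)

/-- The cross-section `ξ` is of class `C^k` on the open set `B`. -/
def CkSectionOn [HasAtlas X] [HasTrivs 𝕜 E] (k : ℕ∞) (ξ : ∀ x, E x) (B : Set X) : Prop :=
  ∀ τ ∈ HasTrivs.trivs (𝕜 := 𝕜) (E := E), CkOn k (fun x => τ.coord x (ξ x)) (B ∩ τ.base)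

variable (E)

/-- `Γ^k(S; E)` for an arbitrary subset `S`: the cross-sections over `S` which extend, near each
point of `S`, to a cross-section of class `C^k` on an open neighbourhood of the point. -/
def Sections [HasAtlas X] [HasTrivs 𝕜 E] (k : ℕ∞) (S : Set X) :
    Submodule 𝕜 (∀ x : S, E x) where
  carrier := {ξ | ∀ x ∈ S, ∃ B : Set X, IsOpen B ∧ x ∈ B ∧ ∃ η : ∀ z, E z,
    CkSectionOn 𝕜 k η B ∧ ∀ z : S, (z : X) ∈ B → η z = ξ z}
  zero_mem' := fun x _ => ⟨univ, isOpen_univ, mem_univ x, fun _ => 0, by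
    intro τ _ c _
    simpa [Function.comp_def] using contDiffOn_const, fun _ _ => rfl⟩
  add_mem' := by
    intro ξ ξ' h h' x hx
    obtain ⟨B, hB, hxB, η, hη, e⟩ := h x hx
    obtain ⟨B', hB', hxB', η', hη', e'⟩ := h' x hx
    refine ⟨B ∩ B', hB.inter hB', ⟨hxB, hxB'⟩, fun z => η z + η' z, ?_, ?_⟩
    · intro τ hτ c hc
      have h1 := (hη τ hτ c hc).mono (t := c.2.target ∩ c.2.symm ⁻¹' ((B ∩ B') ∩ τ.base))
        (fun v hv => ⟨hv.1, hv.2.1.1, hv.2.2⟩)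
      have h2 := (hη' τ hτ c hc).mono (t := c.2.target ∩ c.2.symm ⁻¹' ((B ∩ B') ∩ τ.base))
        (fun v hv => ⟨hv.1, hv.2.1.2, hv.2.2⟩)
      simpa [Function.comp_def] using h1.add h2
    · intro z hz
      simp [e z hz.1, e' z hz.2]
  smul_mem' := by
    intro a ξ h x hx
    obtain ⟨B, hB, hxB, η, hη, e⟩ := h x hx
    refine ⟨B, hB, hxB, fun z => a • η z, ?_, ?_⟩
    · intro τ hτ c hc
      have h1 := (hη τ hτ c hc).const_smul a
      simpa [Function.comp_def] using h1
    · intro z hz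
      simp [e z hz]

variable {E}

/-- The restriction map `Γ^k(S; E) → Γ^k(T; E)` for `T ⊆ S`. -/
def Sections.res [HasAtlas X] [HasTrivs 𝕜 E] (k : ℕ∞) {S T : Set X} (h : T ⊆ S) :
    Sections 𝕜 E k S →ₗ[𝕜] Sections 𝕜 E k T where
  toFun ξ := ⟨fun x => ξ.1 ⟨x, h x.2⟩, fun x hx => by
    obtain ⟨B, hB, hxB, η, hη, e⟩ := ξ.2 x (h hx)
    exact ⟨B, hB, hxB, η, hη, fun z hz => e ⟨z, h z.2⟩ hz⟩⟩
  map_add' _ _ := rfl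
  map_smul' _ _ := rfl

/-! ### The `C^k`-topology on sections over the closure of a relatively compact open set -/

variable (E)

/-- A standard normed chart: a coordinate chart `φ : U ≃ ℝⁿ` onto the whole of `ℝⁿ`, a local
trivialization `τ` of `E` over the same domain `U`, and a continuous norm `p` on `E|_U`. -/
structure StdNormedChart [HasAtlas X] [HasTrivs 𝕜 E] where
  dim : ℕ
  φ : OpenPartialHomeomorph X (EucR dim)
  smooth_φ : IsSmoothChart φ
  target_φ : φ.target = univ
  τ : LocTriv 𝕜 E
  smooth_τ : IsSmoothTriv τ
  base_τ : τ.base = φ.source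
  p : ∀ x, Seminorm 𝕜 (E x)
  p_pos : ∀ x ∈ φ.source, ∀ e : E x, e ≠ 0 → 0 < p x e
  p_cont : ContinuousOn (fun q : X × (Fin τ.rank → 𝕜) => p q.1 (τ.symm q.1 q.2)) (φ.source ×ˢ univ)

variable {𝕜 E}

/-- The inverse image under the chart of the open unit ball of `ℝⁿ`. -/
def StdNormedChart.unitBall [HasAtlas X] [HasTrivs 𝕜 E] (c : StdNormedChart 𝕜 E) : Set X :=
  c.φ.source ∩ c.φ ⁻¹' Metric.ball 0 1

open scoped Classical in
/-- The coordinate expression of a section over `S`: the function `τ ∘ ξ ∘ φ⁻¹` on `φ (U ∩ S)`,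
extended by zero. -/
def StdNormedChart.localRep [HasAtlas X] [HasTrivs 𝕜 E] (c : StdNormedChart 𝕜 E) {S : Set X}
    (ξ : ∀ x : S, E x) : EucR c.dim → (Fin c.τ.rank → 𝕜) := fun v =>
  if h : c.φ.symm v ∈ S then c.τ.coord (c.φ.symm v) (ξ ⟨c.φ.symm v, h⟩) else 0

/-- `∂_{i 1} ⋯ ∂_{i m} g`, an iterated partial derivative of order `m`. -/
def partialDeriv {n m : ℕ} {F : Type*} [NormedAddCommGroup F] [NormedSpace ℝ F]
    (i : Fin m → Fin n) (g : EucR n → F) (v : EucR n) : F :=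
  iteratedFDeriv ℝ m g v fun j => EuclideanSpace.single (i j) (1 : ℝ)

/-- A standard normed atlas for `E` over `closure Ω`: finitely many standard normed charts whose
unit balls cover `closure Ω`. -/
def IsStdNormedAtlas [HasAtlas X] [HasTrivs 𝕜 E] (Ω : Set X) (A : Finset (StdNormedChart 𝕜 E)) :
    Prop :=
  closure Ω ⊆ ⋃ c ∈ A, c.unitBall

/-- The standard `C^r`-norm on sections over `closure Ω` attached to the atlas `A`: the supremum
of the norms of all partial derivatives of order at most `r` of the coordinate expressions at the
points of `Ω` in the unit balls of the charts. -/
def stdNorm [HasAtlas X] [HasTrivs 𝕜 E] (Ω : Set X) (A : Finset (StdNormedChart 𝕜 E)) (r : ℕ)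
    (ξ : ∀ x : closure Ω, E x) : ℝ≥0∞ :=
  ⨆ c ∈ A, ⨆ m ≤ r, ⨆ i : Fin m → Fin c.dim, ⨆ u ∈ c.unitBall ∩ Ω,
    ENNReal.ofReal (c.p u (c.τ.symm u (partialDeriv i (c.localRep ξ) (c.φ u))))

variable (𝕜 E)

/-- The `C^k`-topology on `Γ^k(closure Ω; E)`: the topology generated by the balls of all standard
`C^r`-norms, for all natural numbers `r ≤ k`. -/
@[reducible] def ckTopology [HasAtlas X] [HasTrivs 𝕜 E] (k : ℕ∞) (Ω : Set X) :
    TopologicalSpace (Sections 𝕜 E k (closure Ω)) :=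
  TopologicalSpace.generateFrom {N | ∃ A : Finset (StdNormedChart 𝕜 E), IsStdNormedAtlas Ω A ∧
    ∃ r : ℕ, (r : ℕ∞) ≤ k ∧ ∃ ξ₀ : Sections 𝕜 E k (closure Ω), ∃ ε : ℝ, 0 < ε ∧
      N = {ξ | stdNorm Ω A r (ξ - ξ₀).1 < ENNReal.ofReal ε}}

end Bundles

/-! ### Pullback of a bundle along the first projection of a fibre product -/

section Pullback

variable {A B C : Type*} (f : A → C) (g : B → C)

/-- The fibres of `pr_A^* E`, a bundle over `A ×_{f,g} B`. -/
def PullFst (E : A → Type*) (z : FiberProduct f g) : Type _ := E z.1.1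

variable {E : A → Type*}

instance [∀ x, AddCommGroup (E x)] (z : FiberProduct f g) : AddCommGroup (PullFst f g E z) :=
  inferInstanceAs (AddCommGroup (E z.1.1))

instance {𝕜 : Type*} [RCLike 𝕜] [∀ x, AddCommGroup (E x)] [∀ x, Module 𝕜 (E x)]
    (z : FiberProduct f g) : Module 𝕜 (PullFst f g E z) :=
  inferInstanceAs (Module 𝕜 (E z.1.1))

variable {𝕜 : Type*} [RCLike 𝕜] [∀ x, AddCommGroup (E x)] [∀ x, Module 𝕜 (E x)]
variable [TopologicalSpace A] [TopologicalSpace B]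

/-- The pullback of a local trivialization. -/
def LocTriv.pullFst (τ : LocTriv 𝕜 E) : LocTriv 𝕜 (PullFst f g E) where
  rank := τ.rank
  base := {z | z.1.1 ∈ τ.base}
  isOpen_base := τ.isOpen_base.preimage (continuous_fst.comp continuous_subtype_val)
  coord z := τ.coord z.1.1
  symm z := τ.symm z.1.1
  left_inv z hz := τ.left_inv z.1.1 hz
  right_inv z hz := τ.right_inv z.1.1 hz

instance [HasTrivs 𝕜 E] : HasTrivs 𝕜 (PullFst f g E) where
  trivs := (LocTriv.pullFst f g) '' HasTrivs.trivs (𝕜 := 𝕜) (E := E)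

end Pullback

/-! ### Differentiable groupoids -/

/-- A differentiable groupoid `G ⇉ X`.  The product `g h` is defined when `src g = tgt h`. -/
structure DiffGroupoid (G X : Type*) [TopologicalSpace G] [HasAtlas G]
    [TopologicalSpace X] [HasAtlas X] where
  src : G → X
  tgt : G → X
  one : X → G
  inv : G → G
  mul : FiberProduct src tgt → G
  src_one : ∀ x, src (one x) = x
  tgt_one : ∀ x, tgt (one x) = x
  src_inv : ∀ g, src (inv g) = tgt g
  tgt_inv : ∀ g, tgt (inv g) = src g
  src_mul : ∀ p, src (mul p) = src p.1.2
  tgt_mul : ∀ p, tgt (mul p) = tgt p.1.1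
  mul_assoc : ∀ (g h k : G) (hgh : src g = tgt h) (hhk : src h = tgt k),
    mul ⟨(mul ⟨(g, h), hgh⟩, k), (src_mul ⟨(g, h), hgh⟩).trans hhk⟩ =
      mul ⟨(g, mul ⟨(h, k), hhk⟩), hgh.trans (tgt_mul ⟨(h, k), hhk⟩).symm⟩
  one_mul : ∀ g, mul ⟨(one (tgt g), g), src_one _⟩ = g
  mul_one : ∀ g, mul ⟨(g, one (src g)), (tgt_one _).symm⟩ = g
  inv_mul : ∀ g, mul ⟨(inv g, g), src_inv g⟩ = one (src g)
  mul_inv : ∀ g, mul ⟨(g, inv g), (tgt_inv g).symm⟩ = one (tgt g)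
  submersive_src : SubmersiveMap src
  submersive_tgt : SubmersiveMap tgt
  smooth_one : SmoothMap one
  smooth_inv : SmoothMap inv
  smooth_mul : SmoothMap mul

namespace DiffGroupoid

variable {G X : Type*} [TopologicalSpace G] [HasAtlas G] [TopologicalSpace X] [HasAtlas X]
variable (Γ : DiffGroupoid G X)

/-- A proper groupoid is Hausdorff, and its anchor `g ↦ (src g, tgt g)` is a proper map. -/
def IsProper : Prop :=
  T2Space G ∧ T2Space X ∧
    ∀ K : Set (X × X), IsCompact K → IsCompact ((fun g => (Γ.src g, Γ.tgt g)) ⁻¹' K)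

/-- The arrows `Γ(S, T)` with source in `S` and target in `T`. -/
def arrows (S T : Set X) : Set G := {g | Γ.src g ∈ S ∧ Γ.tgt g ∈ T}

/-- The saturation `ΓS`. -/
def saturation (S : Set X) : Set X := Γ.tgt '' (Γ.src ⁻¹' S)

/-- The open set `U` is adapted to the function `κ`. -/
def IsAdapted (κ : X → ℝ) (U : Set X) : Prop := tsupport κ ∩ Γ.saturation U ⊆ U

/-- The target fibre over `x`. -/
abbrev TFiber (x : X) : Type _ := {h : G // Γ.tgt h = x}

/-- Left translation by `g`, from the target fibre over `src g` to the one over `tgt g`. -/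
def leftMul (g : G) (h : Γ.TFiber (Γ.src g)) : Γ.TFiber (Γ.tgt g) :=
  ⟨Γ.mul ⟨(g, h.1), h.2.symm⟩, Γ.tgt_mul _⟩

end DiffGroupoid

/-! ### Volume densities along the fibres of a submersion, in fibre coordinates -/

section Densities

variable {Z Y : Type*} [TopologicalSpace Z] [HasAtlas Z] [TopologicalSpace Y] [HasAtlas Y]

/-- A coordinate chart `e = (u, y)` of `Z` with values in `ℝᵐ × ℝⁿ` in which `φ` becomes the
projection `(u, y) ↦ y`, relative to the coordinate chart `d` of `Y`.  The functions `u` restrict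
to coordinates on the fibres of `φ`. -/
structure SubmersionChart (φ : Z → Y) (m n : ℕ) where
  e : OpenPartialHomeomorph Z (EucR m × EucR n)
  smooth_e : IsSmoothChart e
  d : OpenPartialHomeomorph Y (EucR n)
  smooth_d : IsSmoothChart d
  mem_source : ∀ z ∈ e.source, φ z ∈ d.source
  proj : ∀ z ∈ e.source, d (φ z) = (e z).2

/-- A (`C^∞`, positive) volume density `δ` on the vertical tangent bundle of `φ`, given by its
components `δ(∂/∂u₁ ∧ ⋯ ∧ ∂/∂uₘ)` with respect to all systems of fibre coordinates.  The components
transform with the absolute value of the Jacobian determinant of the change of fibre coordinates. -/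
structure VerticalVolumeDensity (φ : Z → Y) where
  comp : ∀ {m n : ℕ}, SubmersionChart φ m n → Z → ℝ
  smooth : ∀ {m n : ℕ} (e : SubmersionChart φ m n), CkOn ⊤ (comp e) e.e.source
  pos : ∀ {m n : ℕ} (e : SubmersionChart φ m n), ∀ z ∈ e.e.source, 0 < comp e z
  transform : ∀ {m n : ℕ} (e e' : SubmersionChart φ m n), ∀ z ∈ e.e.source ∩ e'.e.source,
    comp e z =
      |(fderiv ℝ (fun u => (e'.e (e.e.symm (u, (e.e z).2))).1) (e.e z).1).det| * comp e' z

/-- The measures `μ y` on the fibres of `φ` are the ones attached to the density `δ`: in fibre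
coordinates, `μ y` has density `δ(∂/∂u₁ ∧ ⋯ ∧ ∂/∂uₘ)` with respect to Lebesgue measure. -/
def VerticalVolumeDensity.IsMeasure [MeasurableSpace Z] {φ : Z → Y} (δ : VerticalVolumeDensity φ)
    (μ : ∀ y, Measure {z : Z // φ z = y}) : Prop :=
  ∀ (m n : ℕ) (e : SubmersionChart φ m n) (y : Y) (S : Set {z : Z // φ z = y}),
    MeasurableSet S → (∀ z ∈ S, z.1 ∈ e.e.source) →
      μ y S = ∫⁻ u in (fun z : {z : Z // φ z = y} => (e.e z.1).1) '' S,
        ENNReal.ofReal (δ.comp e (e.e.symm (u, e.d y)))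

end Densities

/-! ### Haar systems -/

section Haar

variable {G X : Type*} [TopologicalSpace G] [HasAtlas G] [TopologicalSpace X] [HasAtlas X]
variable [MeasurableSpace G]

/-- A left Haar system: positive Radon measures on the target fibres which are differentiable,
left invariant and definite. -/
structure HaarSystem (Γ : DiffGroupoid G X) where
  μ : ∀ x, Measure (Γ.TFiber x)
  radon : ∀ x, (μ x).Regular
  smooth : ∃ δ : VerticalVolumeDensity Γ.tgt, δ.IsMeasure μ
  left_invariant : ∀ (g : G) (S : Set (Γ.TFiber (Γ.src g))), MeasurableSet S →
    μ (Γ.tgt g) (Γ.leftMul g '' S) = μ (Γ.src g) S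
  definite : ∀ x (O : Set (Γ.TFiber x)), IsOpen O → O.Nonempty → 0 < μ x O

/-- A normalized left Haar system `(μ, κ)`, where `κ` is a normalizing function for `μ`: a
nonnegative `C^∞` function such that `κ ∘ src` is supported properly along `tgt` and has integral
one on each target fibre. -/
structure NormalizedHaarSystem (Γ : DiffGroupoid G X) extends HaarSystem Γ where
  κ : X → ℝ
  κ_smooth : CkOn ⊤ κ univ
  κ_nonneg : ∀ x, 0 ≤ κ x
  κ_proper : ∀ K : Set X, IsCompact K → IsCompact (tsupport (κ ∘ Γ.src) ∩ Γ.tgt ⁻¹' K)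
  κ_integral : ∀ x, ∫ h : Γ.TFiber x, κ (Γ.src h.1) ∂(μ x) = 1

/-- The finite measure `ν_x = (κ ∘ src) μ_x` on the target fibre over `x`. -/
def NormalizedHaarSystem.measure {Γ : DiffGroupoid G X} (ν : NormalizedHaarSystem Γ) (x : X) :
    Measure (Γ.TFiber x) :=
  (ν.μ x).withDensity fun h => ENNReal.ofReal (ν.κ (Γ.src h.1))

end Haar

/-! ### The integration functional -/

/-- The integral of a function with values in a finite-dimensional vector space, computed in the
coordinates of a basis (it does not depend on the basis). -/
def vecIntegral (𝕜 : Type*) [RCLike 𝕜] {M : Type*} [AddCommGroup M] [Module 𝕜 M]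
    [Module.Finite 𝕜 M] {α : Type*} [MeasurableSpace α] (μ : Measure α) (g : α → M) : M :=
  ∑ i, (∫ a, (Module.finBasis 𝕜 M).repr (g a) i ∂μ) • Module.finBasis 𝕜 M i

section Functional

variable {G X P : Type*} [TopologicalSpace G] [HasAtlas G] [MeasurableSpace G]
variable [TopologicalSpace X] [HasAtlas X] [TopologicalSpace P] [HasAtlas P]
variable (𝕜 : Type*) [RCLike 𝕜] {E : P → Type*} [∀ y, AddCommGroup (E y)] [∀ y, Module 𝕜 (E y)]
variable [HasTrivs 𝕜 E] [IsDiffVectorBundle 𝕜 E]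

/-- `h ↦ θ(y, h)`, a function on the target fibre over `f y` with values in `E y`. -/
def alongFiber (Γ : DiffGroupoid G X) (f : P → X)
    (θ : ∀ z : FiberProduct f Γ.tgt, PullFst f Γ.tgt E z) (y : P) (h : Γ.TFiber (f y)) : E y :=
  θ ⟨(y, h.1), h.2.symm⟩

/-- The value `∫ θ(y, h) dν_{f y}(h)` of the integral of `θ` at the parameter `y`. -/
def fiberIntegral {Γ : DiffGroupoid G X} (ν : NormalizedHaarSystem Γ) (f : P → X)
    (θ : ∀ z : FiberProduct f Γ.tgt, PullFst f Γ.tgt E z) (y : P) : E y :=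
  haveI : Module.Finite 𝕜 (E y) := IsDiffVectorBundle.finite 𝕜 E y
  vecIntegral 𝕜 (ν.measure (f y)) (alongFiber Γ f θ y)

/-- The subset `V ×_{f,tgt} Ω` of the fibre product, where `Ω = Γ(U, U)`. -/
def localDomain (Γ : DiffGroupoid G X) (f : P → X) (V : Set P) (U : Set X) :
    Set (FiberProduct f Γ.tgt) :=
  {z | z.1.1 ∈ V ∧ z.1.2 ∈ Γ.arrows U U}

end Functional

end

/-! Everything reduces to integrals over `ℝᵐ` depending on parameters. Since the target map is a
submersion, `P ×_{f,t} Γ` has charts `(y, h) ↦ (φ y, u h)` (`adaptedChart`), where `φ` is a chart of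
`P` and `u` are fibre coordinates. In such a chart `pr_P` is a linear projection, and the Haar
measures on the fibres have a smooth density with respect to Lebesgue measure. Over a compact set of
parameters `y`, the pairs `(y, h)` with `h` in the support of `κ ∘ s` form a compact set, because
`κ` is supported properly along `t`. A finite partition of unity on this set turns `I(ϑ)` into a
finite sum of integrals `∫ w(v, u) θ(v, u) du`, with smooth compactly supported weights `w`
independent of `ϑ` (`exists_localFormula`). Differentiation under the integral
(`contDiff_integral_slice`) shows that `I(ϑ)` is of class `C^k`; integrability comes from continuity
and the same compactness.

For the local version, let `h` be in the support of `κ ∘ s` with `th ∈ U`. Then `sh = t(h⁻¹)` lies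
in `ΓU ∩ supp κ`, hence in the adapted set `U`. So `I(ϑ)` on `V` sees `ϑ` only over `V ×_{f,t} Ω`,
and by continuity `I(ϑ)` on the closure of `V` is determined by `ϑ` on the closure of that set
(`ker_res_le`). Properness of the groupoid makes the latter closure compact, so every section over
it extends globally (`res_localDomain_surjective`). These two facts give existence and uniqueness of
`I_{V,U}`.

For continuity, fix a chart of `P`. At a point over `V`, the derivatives of each integrand are
nonzero only at points which lie both in the unit ball of an adapted chart and in the open set `V
×_{f,t} Ω`, exactly where the standard norm measures derivatives. The chain rule and Leibniz's rule
then bound the derivatives of `I(ϑ)` by a constant times the standard norm of the restriction of `ϑ`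
(`exists_bound_integrand`, `exists_bound_value`), once the adapted charts are included in the atlas
of the source. Bounded linear maps are continuous by `continuous_ckTopology`. -/

set_option linter.unusedSectionVars false

/-! ### Functions of class `C^k` at a point of a manifold -/

section Pointwise

variable {X Y : Type*} [TopologicalSpace X] [HasAtlas X] [TopologicalSpace Y] [HasAtlas Y]
variable {F F' H : Type*} [NormedAddCommGroup F] [NormedSpace ℝ F]
variable [NormedAddCommGroup F'] [NormedSpace ℝ F'] [NormedAddCommGroup H] [NormedSpace ℝ H]

/-- The vector-valued function `g` is of class `C^k` at the point `x`. -/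
def CkAt (k : ℕ∞) (g : X → F) (x : X) : Prop :=
  ∀ c ∈ HasAtlas.atlas (X := X), x ∈ c.2.source → ContDiffAt ℝ k (g ∘ c.2.symm) (c.2 x)

/-- Every point lies in the domain of a chart of the atlas. -/
def HasAtlas.Covers (X : Type*) [TopologicalSpace X] [HasAtlas X] : Prop :=
  ∀ x : X, ∃ c ∈ HasAtlas.atlas (X := X), x ∈ c.2.source

theorem contDiffOn_iff_contDiffAt {n : WithTop ℕ∞} {s : Set F} (hs : IsOpen s) {g : F → H} :
    ContDiffOn ℝ n g s ↔ ∀ v ∈ s, ContDiffAt ℝ n g v :=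
  ⟨fun h _ hv => h.contDiffAt (hs.mem_nhds hv), fun h v hv => (h v hv).contDiffWithinAt⟩

theorem ckOn_iff_ckAt {k : ℕ∞} {g : X → F} {B : Set X} (hB : IsOpen B) :
    CkOn k g B ↔ ∀ x ∈ B, CkAt k g x := by
  constructor
  · intro h x hx c hc hxc
    refine (h c hc).contDiffAt ((c.2.symm.isOpen_inter_preimage hB).mem_nhds ⟨c.2.map_source hxc, ?_⟩)
    simpa [c.2.left_inv hxc] using hx
  · intro h c hc
    refine (contDiffOn_iff_contDiffAt (c.2.symm.isOpen_inter_preimage hB)).2 fun v hv => ?_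
    have := h _ hv.2 c hc (c.2.map_target hv.1)
    rwa [c.2.right_inv hv.1] at this

theorem CkAt.congr {k : ℕ∞} {g g' : X → F} {x : X} (h : CkAt k g x) (e : g' =ᶠ[𝓝 x] g) :
    CkAt k g' x := by
  intro c hc hx
  refine (h c hc hx).congr_of_eventuallyEq ?_
  have : Filter.Tendsto c.2.symm (𝓝 (c.2 x)) (𝓝 x) := by
    have := c.2.continuousAt_symm (c.2.map_source hx)
    rwa [ContinuousAt, c.2.left_inv hx] at this
  exact this.eventually e

theorem CkAt.of_le {k l : ℕ∞} {g : X → F} {x : X} (h : CkAt k g x) (e : l ≤ k) :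
    CkAt l g x :=
  fun c hc hx => (h c hc hx).of_le (by exact_mod_cast e)

theorem isSmoothChart_iff {φ : OpenPartialHomeomorph X F} :
    IsSmoothChart φ ↔ ∀ x ∈ φ.source, ∀ c ∈ HasAtlas.atlas (X := X), x ∈ c.2.source →
      ContDiffAt ℝ ∞ (φ ∘ c.2.symm) (c.2 x) ∧ ContDiffAt ℝ ∞ (c.2 ∘ φ.symm) (φ x) := by
  constructor
  · intro h x hx c hc hxc
    refine ⟨(h c hc).1.contDiffAt ((c.2.symm.trans φ).open_source.mem_nhds ?_),
      (h c hc).2.contDiffAt ((φ.symm.trans c.2).open_source.mem_nhds ?_)⟩ <;>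
    simp [hx, hxc]
  · intro h c hc
    refine ⟨(contDiffOn_iff_contDiffAt (c.2.symm.trans φ).open_source).2 fun v hv => ?_,
      (contDiffOn_iff_contDiffAt (φ.symm.trans c.2).open_source).2 fun v hv => ?_⟩
    · simp at hv
      have := (h _ hv.2 c hc (c.2.map_target hv.1)).1
      rwa [c.2.right_inv hv.1] at this
    · simp at hv
      have := (h _ (φ.map_target hv.1) c hc hv.2).2
      rwa [φ.right_inv hv.1] at this

theorem IsSmoothChart.of_mem_atlas [IsDiffManifold X] {c : Σ n : ℕ, OpenPartialHomeomorph X (EucR n)}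
    (hc : c ∈ HasAtlas.atlas (X := X)) : IsSmoothChart c.2 :=
  fun d hd => ⟨IsDiffManifold.compat d hd c hc, IsDiffManifold.compat c hc d hd⟩

/-- The transition from an atlas chart to `φ` is smooth by definition of a smooth chart, so a single
one decides the class, without compatibility of the atlas. With `CkAt.contDiffAt`, which adds only
covering, this is enough for fibre products, where just the covering property is established. -/
theorem CkAt.of_chart {k : ℕ∞} {g : X → H} {x : X} {φ : OpenPartialHomeomorph X F}
    (hφ : IsSmoothChart φ) (hx : x ∈ φ.source) (h : ContDiffAt ℝ k (g ∘ φ.symm) (φ x)) :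
    CkAt k g x := by
  intro c hc hxc
  have h1 : ContDiffAt ℝ k (φ ∘ c.2.symm) (c.2 x) :=
    ((isSmoothChart_iff.1 hφ x hx c hc hxc).1).of_le (by exact_mod_cast le_top)
  have h2 : ContDiffAt ℝ k ((g ∘ φ.symm) ∘ (φ ∘ c.2.symm)) (c.2 x) :=
    ContDiffAt.comp _ (by simpa [c.2.left_inv hxc] using h) h1
  refine h2.congr_of_eventuallyEq ?_
  filter_upwards [(c.2.symm.isOpen_inter_preimage φ.open_source).mem_nhds
    ⟨c.2.map_source hxc, by simpa [c.2.left_inv hxc] using hx⟩] with v hv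
  simp [φ.left_inv hv.2]

theorem CkAt.contDiffAt {k : ℕ∞} {g : X → H} {x : X} (h : CkAt k g x)
    (hX : HasAtlas.Covers X) {φ : OpenPartialHomeomorph X F}
    (hφ : IsSmoothChart φ) (hx : x ∈ φ.source) : ContDiffAt ℝ k (g ∘ φ.symm) (φ x) := by
  obtain ⟨c, hc, hxc⟩ := hX x
  have h1 : ContDiffAt ℝ k (c.2 ∘ φ.symm) (φ x) :=
    ((isSmoothChart_iff.1 hφ x hx c hc hxc).2).of_le (by exact_mod_cast le_top)
  have h2 : ContDiffAt ℝ k ((g ∘ c.2.symm) ∘ (c.2 ∘ φ.symm)) (φ x) :=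
    ContDiffAt.comp _ (by simpa [φ.left_inv hx] using h c hc hxc) h1
  refine h2.congr_of_eventuallyEq ?_
  filter_upwards [(φ.symm.isOpen_inter_preimage c.2.open_source).mem_nhds
    ⟨φ.map_source hx, by simpa [φ.left_inv hx] using hxc⟩] with v hv
  simp [c.2.left_inv hv.2]

theorem CkAt.continuousAt {k : ℕ∞} {g : X → F} {x : X} (h : CkAt k g x)
    (hX : HasAtlas.Covers X) : ContinuousAt g x := by
  obtain ⟨c, hc, hxc⟩ := hX x
  have h1 := (h c hc hxc).continuousAt
  have h2 : ContinuousAt ((g ∘ c.2.symm) ∘ c.2) x := ContinuousAt.comp h1 (c.2.continuousAt hxc)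
  refine h2.congr ?_
  filter_upwards [c.2.open_source.mem_nhds hxc] with z hz
  simp [c.2.left_inv hz]

theorem CkAt.comp_contDiffAt {k : ℕ∞} {g : X → F} {x : X} {p : F → H}
    (hp : ContDiffAt ℝ k p (g x)) (h : CkAt k g x) : CkAt k (fun z => p (g z)) x := by
  intro c hc hx
  exact ContDiffAt.comp (c.2 x) (g := p) (by simpa [c.2.left_inv hx] using hp) (h c hc hx)

theorem ckAt_const {k : ℕ∞} {x : X} (v : F) : CkAt k (fun _ : X => v) x :=
  fun _ _ _ => contDiffAt_const

theorem CkAt.mul {k : ℕ∞} {g g' : X → ℝ} {x : X} (h : CkAt k g x) (h' : CkAt k g' x) :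
    CkAt k (fun z => g z * g' z) x :=
  fun c hc hx => (h c hc hx).mul (h' c hc hx)

theorem CkAt.sum {k : ℕ∞} {ι : Type*} {s : Finset ι} {g : ι → X → F} {x : X}
    (h : ∀ i ∈ s, CkAt k (g i) x) : CkAt k (fun z => ∑ i ∈ s, g i z) x := fun c hc hx => by
  have := ContDiffAt.sum (n := (k : WithTop ℕ∞)) (fun i hi => h i hi c hc hx)
  simpa [Function.comp_def] using this

theorem CkAt.smul {A : Type*} [NormedRing A] [NormedAlgebra ℝ A] [Module A F] [IsBoundedSMul A F]
    [IsScalarTower ℝ A F] {k : ℕ∞} {g : X → A} {g' : X → F} {x : X}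
    (h : CkAt k g x) (h' : CkAt k g' x) : CkAt k (fun z => g z • g' z) x :=
  fun c hc hx => (h c hc hx).smul (h' c hc hx)

theorem CkAt.comp_smoothMap {k : ℕ∞} {g : Y → F} {q : X → Y} {x : X} (h : CkAt k g (q x))
    (hY : HasAtlas.Covers Y) (hq : SmoothMap q) : CkAt k (fun z => g (q z)) x := by
  intro c hc hx
  obtain ⟨d, hd, hxd⟩ := hY (q x)
  have hx' : q (c.2.symm (c.2 x)) = q x := by rw [c.2.left_inv hx]
  have hmem : c.2.target ∩ c.2.symm ⁻¹' (q ⁻¹' d.2.source) ∈ 𝓝 (c.2 x) :=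
    (c.2.symm.isOpen_inter_preimage (d.2.open_source.preimage hq.1)).mem_nhds
      ⟨c.2.map_source hx, by simpa [hx'] using hxd⟩
  have h1 : ContDiffAt ℝ k (d.2 ∘ q ∘ c.2.symm) (c.2 x) :=
    ((hq.2 c hc d hd).contDiffAt hmem).of_le (by exact_mod_cast le_top)
  have h2 : ContDiffAt ℝ k ((g ∘ d.2.symm) ∘ (d.2 ∘ q ∘ c.2.symm)) (c.2 x) :=
    ContDiffAt.comp _ (by simpa [hx'] using h d hd hxd) h1
  refine h2.congr_of_eventuallyEq ?_
  filter_upwards [hmem] with v hv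
  simp [d.2.left_inv hv.2]

theorem IsSmoothChart.ckAt {φ : OpenPartialHomeomorph X F} (hφ : IsSmoothChart φ) {k : ℕ∞} {x : X}
    (hx : x ∈ φ.source) : CkAt k φ x := fun c hc hxc =>
  ((isSmoothChart_iff.1 hφ x hx c hc hxc).1).of_le (by exact_mod_cast le_top)

theorem IsSmoothChart.trans {φ : OpenPartialHomeomorph X F} (hφ : IsSmoothChart φ)
    {ψ : OpenPartialHomeomorph F H} (h1 : ContDiffOn ℝ ∞ ψ ψ.source)
    (h2 : ContDiffOn ℝ ∞ ψ.symm ψ.target) : IsSmoothChart (φ.trans ψ) := by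
  rw [isSmoothChart_iff] at hφ ⊢
  intro x hx c hc hxc
  simp at hx
  obtain ⟨a, b⟩ := hφ x hx.1 c hc hxc
  constructor
  · have : ContDiffAt ℝ ∞ (ψ ∘ (φ ∘ c.2.symm)) (c.2 x) := by
      refine ContDiffAt.comp _ (h1.contDiffAt (ψ.open_source.mem_nhds ?_)) a
      simpa [c.2.left_inv hxc] using hx.2
    exact this
  · have : ContDiffAt ℝ ∞ ((c.2 ∘ φ.symm) ∘ ψ.symm) (ψ (φ x)) := by
      refine ContDiffAt.comp _ ?_ (h2.contDiffAt (ψ.open_target.mem_nhds (ψ.map_source hx.2)))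
      simpa [ψ.left_inv hx.2] using b
    exact this

theorem IsSmoothChart.restrOpen {φ : OpenPartialHomeomorph X F} (hφ : IsSmoothChart φ)
    {s : Set X} (hs : IsOpen s) : IsSmoothChart (φ.restrOpen s hs) := by
  rw [isSmoothChart_iff] at hφ ⊢
  intro x hx c hc hxc
  exact hφ x hx.1 c hc hxc

/-- A smooth bump function: equal to one near `x`, with compact support in a given open set. -/
theorem exists_smooth_bump [FiniteDimensional ℝ F] [T2Space X] {φ : OpenPartialHomeomorph X F}
    (hφ : IsSmoothChart φ) {x : X} (hx : x ∈ φ.source) {B : Set X} (hB : IsOpen B) (hxB : x ∈ B) :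
    ∃ χ : X → ℝ, (∀ z, CkAt ⊤ χ z) ∧ HasCompactSupport χ ∧ tsupport χ ⊆ B ∩ φ.source ∧
      ∀ᶠ z in 𝓝 x, χ z = 1 := by
  have hopen : IsOpen (φ.target ∩ φ.symm ⁻¹' B) := φ.symm.isOpen_inter_preimage hB
  have hmem : φ.target ∩ φ.symm ⁻¹' B ∈ 𝓝 (φ x) :=
    hopen.mem_nhds ⟨φ.map_source hx, by simpa [φ.left_inv hx] using hxB⟩
  let E := toEuclidean (E := F)
  obtain ⟨ε, hε, hball⟩ := Metric.nhds_basis_closedBall.mem_iff.1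
    (E.symm.continuous.continuousAt.preimage_mem_nhds (x := E (φ x))
      (t := φ.target ∩ φ.symm ⁻¹' B) (by simpa only [E.symm_apply_apply] using hmem))
  let b : ContDiffBump (E (φ x)) := ⟨ε / 2, ε, by positivity, by linarith⟩
  let ρ : F → ℝ := fun v => b (E v)
  have hρ : ContDiff ℝ ∞ ρ := b.contDiff.comp E.contDiff
  have hsub : ∀ v, E v ∈ Metric.closedBall (E (φ x)) ε → v ∈ φ.target ∧ φ.symm v ∈ B := by
    intro v hv
    have := hball hv
    simpa using this
  let K : Set F := E.symm '' Metric.closedBall (E (φ x)) ε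
  have hK : IsCompact K := (isCompact_closedBall _ _).image E.symm.continuous
  have hKt : K ⊆ φ.target := by
    rintro _ ⟨w, hw, rfl⟩; exact (hsub _ (by simpa using hw)).1
  have hK' : IsCompact (φ.symm '' K) := hK.image_of_continuousOn (φ.continuousOn_symm.mono hKt)
  classical
  let χ : X → ℝ := fun z => if z ∈ φ.source then ρ (φ z) else 0
  have hχ0 : ∀ z, z ∉ φ.symm '' K → χ z = 0 := by
    intro z hz
    by_cases hzs : z ∈ φ.source
    · simp only [χ, hzs, if_true, ρ]
      refine b.zero_of_le_dist ?_
      by_contra hlt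
      push Not at hlt
      exact hz ⟨φ z, ⟨E (φ z), Metric.mem_closedBall.2 hlt.le, by simp⟩, φ.left_inv hzs⟩
    · simp [χ, hzs]
  -- Since `X` is Hausdorff, the compact image of the ball is closed in all of `X`, not only in the
  -- chart domain. This makes the extension by zero smooth at points outside the chart.
  have hts : tsupport χ ⊆ φ.symm '' K :=
    closure_minimal (fun z hz => by by_contra h; exact hz (hχ0 z h)) hK'.isClosed
  have hKB : φ.symm '' K ⊆ B ∩ φ.source := by
    rintro _ ⟨v, hv, rfl⟩
    refine ⟨?_, φ.map_target (hKt hv)⟩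
    obtain ⟨w, hw, rfl⟩ := hv
    exact (hsub _ (by simpa using hw)).2
  refine ⟨χ, ?_, hK'.of_isClosed_subset (isClosed_tsupport _) hts, hts.trans hKB, ?_⟩
  · intro z
    by_cases hz : z ∈ φ.source
    · refine CkAt.of_chart hφ hz ?_
      refine (hρ.contDiffAt (x := φ z)).congr_of_eventuallyEq ?_
      filter_upwards [φ.open_target.mem_nhds (φ.map_source hz)] with v hv
      simp [χ, φ.map_target hv, φ.right_inv hv]
    · refine (ckAt_const (0 : ℝ)).congr ?_
      filter_upwards [(isClosed_tsupport χ).isOpen_compl.mem_nhds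
        (fun h => hz ((hts.trans hKB) h).2)] with w hw
      exact image_eq_zero_of_notMem_tsupport hw
  · have h1 : ∀ᶠ v in 𝓝 (φ x), ρ v = 1 :=
      E.continuous.continuousAt.eventually b.eventuallyEq_one
    filter_upwards [(φ.continuousAt hx).eventually h1, φ.open_source.mem_nhds hx] with z hz hzs
    simp [χ, hzs, hz]

theorem IsDiffManifold.covers (X : Type*) [TopologicalSpace X] [HasAtlas X] [IsDiffManifold X] :
    HasAtlas.Covers X := IsDiffManifold.cover

end Pointwise

/-! ### Finite partitions of unity on compact sets -/

section Finite

variable {X : Type*} [TopologicalSpace X] [HasAtlas X]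

/-- A finite smooth partition of unity on a compact set. -/
theorem exists_finite_partition {α : Type*} {K : Set X} (hK : IsCompact K) (W : α → Set X)
    (hbump : ∀ x ∈ K, ∃ a, ∃ χ : X → ℝ, (∀ z, CkAt ⊤ χ z) ∧ HasCompactSupport χ ∧
      tsupport χ ⊆ W a ∧ ∀ᶠ z in 𝓝 x, χ z = 1) :
    ∃ (N : ℕ) (a : Fin N → α) (χ : Fin N → X → ℝ), (∀ i z, CkAt ⊤ (χ i) z) ∧
      (∀ i, HasCompactSupport (χ i)) ∧ (∀ i, tsupport (χ i) ⊆ W (a i)) ∧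
      ∀ z ∈ K, ∑ i, χ i z = 1 := by
  -- For empty `K` the index type may be empty, and no choice of indices is possible; the empty
  -- family works.
  rcases K.eq_empty_or_nonempty with rfl | ⟨x₀, hx₀⟩
  · exact ⟨0, Fin.elim0, Fin.elim0, fun i => i.elim0, fun i => i.elim0, fun i => i.elim0, by simp⟩
  have : Nonempty α := ⟨(hbump x₀ hx₀).choose⟩
  choose! a χ h1 h2 h3 h4 using hbump
  obtain ⟨t, htK, ht⟩ := hK.elim_nhds_subcover (fun x => {z | χ x z = 1}) h4
  let e := t.equivFin.symm
  let ψ : Fin t.card → X → ℝ := fun i => χ (e i)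
  have hmem : ∀ i, (e i : X) ∈ K := fun i => htK _ (e i).2
  -- The products telescope: the sum of `ψᵢ ∏_{j<i} (1 - ψⱼ)` is `1 - ∏ᵢ (1 - ψᵢ)`, and on `K` some
  -- factor `1 - ψᵢ` vanishes.
  refine ⟨t.card, fun i => a (e i),
    fun i z => ψ i z * ∏ j with j < i, (1 - ψ j z), ?_, ?_, ?_, ?_⟩
  · intro i z
    have hprod : ∀ s : Finset (Fin t.card), CkAt ⊤ (fun z => ∏ j ∈ s, (1 - ψ j z)) z := by
      intro s
      induction s using Finset.cons_induction with
      | empty => simpa using ckAt_const (1 : ℝ)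
      | cons j s hj ih =>
        simp only [Finset.prod_cons]
        refine CkAt.mul ?_ ih
        exact CkAt.comp_contDiffAt (p := fun v : ℝ => 1 - v)
          (contDiffAt_const.sub contDiffAt_id) (h1 _ (hmem j) z)
    exact (h1 _ (hmem i) z).mul (hprod _)
  · intro i
    exact (h2 _ (hmem i)).mul_right
  · intro i
    refine (closure_mono ?_).trans (h3 _ (hmem i))
    intro z hz
    exact left_ne_zero_of_mul hz
  · intro z hz
    have h := Finset.prod_one_sub_ordered Finset.univ (fun i => ψ i z)
    have h0 : ∏ i, (1 - ψ i z) = 0 := by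
      obtain ⟨x, hx, hzx⟩ := mem_iUnion₂.1 (ht hz)
      refine Finset.prod_eq_zero (Finset.mem_univ (t.equivFin ⟨x, hx⟩)) ?_
      have : χ x z = 1 := hzx
      simp [ψ, e, this]
    rw [h0] at h
    linarith

end Finite

/-! ### Cross-sections of class `C^k` at a point -/

section PointwiseSections

variable {𝕜 : Type*} [RCLike 𝕜] {X : Type*} [TopologicalSpace X] [HasAtlas X]
variable {E : X → Type*} [∀ x, AddCommGroup (E x)] [∀ x, Module 𝕜 (E x)] [HasTrivs 𝕜 E]

variable (𝕜) in
/-- The cross-section `ξ` is of class `C^k` at the point `x`. -/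
def CkSectionAt (k : ℕ∞) (ξ : ∀ x, E x) (x : X) : Prop :=
  ∀ τ ∈ HasTrivs.trivs (𝕜 := 𝕜) (E := E), x ∈ τ.base → CkAt k (fun z => τ.coord z (ξ z)) x

theorem ckSectionOn_iff {k : ℕ∞} {ξ : ∀ x, E x} {B : Set X} (hB : IsOpen B) :
    CkSectionOn 𝕜 k ξ B ↔ ∀ x ∈ B, CkSectionAt 𝕜 k ξ x := by
  constructor
  · intro h x hx τ hτ hxτ
    exact (ckOn_iff_ckAt (hB.inter τ.isOpen_base)).1 (h τ hτ) x ⟨hx, hxτ⟩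
  · intro h τ hτ
    exact (ckOn_iff_ckAt (hB.inter τ.isOpen_base)).2 fun x hx => h x hx.1 τ hτ hx.2

theorem CkSectionAt.congr {k : ℕ∞} {ξ η : ∀ x, E x} {x : X} (h : CkSectionAt 𝕜 k ξ x)
    (e : ∀ᶠ z in 𝓝 x, η z = ξ z) : CkSectionAt 𝕜 k η x := fun τ hτ hx =>
  (h τ hτ hx).congr (by filter_upwards [e] with z hz; rw [hz])

theorem ckSectionAt_zero {k : ℕ∞} {x : X} : CkSectionAt 𝕜 k (fun z => (0 : E z)) x :=
  fun τ _ _ => by simpa using ckAt_const (0 : Fin τ.rank → 𝕜)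

theorem ckAt_ofReal {k : ℕ∞} {χ : X → ℝ} {x : X} (hχ : CkAt k χ x) :
    CkAt k (fun z => (χ z : 𝕜)) x :=
  CkAt.comp_contDiffAt (p := fun t : ℝ => (t : 𝕜))
    (RCLike.ofRealCLM (K := 𝕜)).contDiff.contDiffAt hχ

theorem CkSectionAt.smul {k : ℕ∞} {χ : X → ℝ} {ξ : ∀ x, E x} {x : X} (hχ : CkAt k χ x)
    (h : CkSectionAt 𝕜 k ξ x) : CkSectionAt 𝕜 k (fun z => (χ z : 𝕜) • ξ z) x :=
  fun τ hτ hx => by simpa using (ckAt_ofReal (𝕜 := 𝕜) hχ).smul (h τ hτ hx)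

theorem CkSectionAt.sum {k : ℕ∞} {ι : Type*} {s : Finset ι} {ξ : ι → ∀ x, E x} {x : X}
    (h : ∀ i ∈ s, CkSectionAt 𝕜 k (ξ i) x) : CkSectionAt 𝕜 k (fun z => ∑ i ∈ s, ξ i z) x :=
  fun τ hτ hx => by simpa using CkAt.sum fun i hi => h i hi τ hτ hx

/-- Smooth transition functions transform coordinate expressions of class `C^k`. -/
theorem SmoothTransition.ckAt {k : ℕ∞} {σ τ : LocTriv 𝕜 E} (h : SmoothTransition σ τ)
    {ξ : ∀ x, E x} {x : X} (hσ : x ∈ σ.base) (hτ : x ∈ τ.base)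
    (hξ : CkAt k (fun z => σ.coord z (ξ z)) x) : CkAt k (fun z => τ.coord z (ξ z)) x := by
  -- Smoothness of a transition function is given only on fixed vectors of `𝕜^N`, so the coordinates
  -- of `ξ` are expanded in the standard basis.
  have h1 : CkAt k (fun z => ∑ i, (σ.coord z (ξ z) i) • τ.coord z (σ.symm z (Pi.single i 1))) x := by
    refine CkAt.sum fun i _ => CkAt.smul ?_ ?_
    · exact CkAt.comp_contDiffAt (p := fun w : Fin σ.rank → 𝕜 => w i)
        (contDiff_apply ℝ 𝕜 i).contDiffAt hξ
    · exact ((ckOn_iff_ckAt (σ.isOpen_base.inter τ.isOpen_base)).1 (h (Pi.single i 1)) x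
        ⟨hσ, hτ⟩).of_le le_top
  refine h1.congr ?_
  filter_upwards [σ.isOpen_base.mem_nhds hσ] with z hz
  conv_lhs => rw [← σ.left_inv z hz (ξ z), pi_eq_sum_univ' (σ.coord z (ξ z))]
  simp only [map_sum, map_smul]

theorem IsSmoothTriv.of_mem_trivs [IsDiffVectorBundle 𝕜 E] {τ : LocTriv 𝕜 E}
    (hτ : τ ∈ HasTrivs.trivs (𝕜 := 𝕜) (E := E)) : IsSmoothTriv τ := fun σ hσ =>
  ⟨IsDiffVectorBundle.compat τ hτ σ hσ, IsDiffVectorBundle.compat σ hσ τ hτ⟩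

theorem CkSectionAt.of_triv {k : ℕ∞} {σ : LocTriv 𝕜 E} (hσ : IsSmoothTriv σ) {ξ : ∀ x, E x}
    {x : X} (hx : x ∈ σ.base) (h : CkAt k (fun z => σ.coord z (ξ z)) x) :
    CkSectionAt 𝕜 k ξ x :=
  fun τ hτ hxτ => (hσ τ hτ).1.ckAt hx hxτ h

theorem CkSectionAt.ckAt_coord {k : ℕ∞} {ξ : ∀ x, E x} {x : X} (h : CkSectionAt 𝕜 k ξ x)
    (hcov : ∃ τ ∈ HasTrivs.trivs (𝕜 := 𝕜) (E := E), x ∈ τ.base)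
    {σ : LocTriv 𝕜 E} (hσ : IsSmoothTriv σ) (hx : x ∈ σ.base) :
    CkAt k (fun z => σ.coord z (ξ z)) x := by
  obtain ⟨τ, hτ, hxτ⟩ := hcov
  exact (hσ τ hτ).2.ckAt hxτ hx (h τ hτ hxτ)

theorem mem_sections_univ {k : ℕ∞} {ξ : ∀ x : (univ : Set X), E x} :
    ξ ∈ Sections 𝕜 E k univ ↔ ∀ x, CkSectionAt 𝕜 k (fun z => ξ ⟨z, mem_univ z⟩) x := by
  constructor
  · intro h x
    obtain ⟨B, hB, hxB, η, hη, e⟩ := h x (mem_univ x)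
    refine ((ckSectionOn_iff hB).1 hη x hxB).congr ?_
    filter_upwards [hB.mem_nhds hxB] with z hz
    exact (e ⟨z, mem_univ z⟩ hz).symm
  · intro h x _
    exact ⟨univ, isOpen_univ, mem_univ x, fun z => ξ ⟨z, mem_univ z⟩,
      (ckSectionOn_iff isOpen_univ).2 fun z _ => h z, fun z _ => rfl⟩

/-- Sections over a compact set extend, if there are bump functions. -/
theorem Sections.res_surjective {k : ℕ∞} {S : Set X} (hS : IsCompact S)
    (hbump : ∀ x ∈ S, ∀ B : Set X, IsOpen B → x ∈ B → ∃ χ : X → ℝ, (∀ z, CkAt ⊤ χ z) ∧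
      HasCompactSupport χ ∧ tsupport χ ⊆ B ∧ ∀ᶠ z in 𝓝 x, χ z = 1) :
    Function.Surjective (Sections.res 𝕜 (E := E) k (subset_univ S)) := by
  intro ξ
  -- The partition of unity is indexed by all local extensions of `ξ`. The weighted sum of
  -- extensions agrees with `ξ` on `S`, because each extension does so wherever its weight is
  -- nonzero.
  let α := {p : Set X × (∀ z, E z) // IsOpen p.1 ∧ CkSectionOn 𝕜 k p.2 p.1 ∧
    ∀ z : S, (z : X) ∈ p.1 → p.2 z = ξ.1 z}
  obtain ⟨N, a, χ, h1, h2, h3, h4⟩ := exists_finite_partition hS (fun p : α => p.1.1) fun x hx => by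
    obtain ⟨B, hB, hxB, η, hη, e⟩ := ξ.2 x hx
    exact ⟨⟨(B, η), hB, hη, e⟩, hbump x hx B hB hxB⟩
  let ζ : ∀ z, E z := fun z => ∑ i, (χ i z : 𝕜) • (a i).1.2 z
  refine ⟨⟨fun z => ζ z, mem_sections_univ.2 fun x => CkSectionAt.sum fun i _ => ?_⟩, ?_⟩
  · by_cases hx : x ∈ (a i).1.1
    · exact CkSectionAt.smul ((h1 i x).of_le le_top)
        ((ckSectionOn_iff (a i).2.1).1 (a i).2.2.1 x hx)
    · refine ckSectionAt_zero.congr ?_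
      filter_upwards [(isClosed_tsupport (χ i)).isOpen_compl.mem_nhds fun h => hx (h3 i h)] with z hz
      simp [image_eq_zero_of_notMem_tsupport hz]
  · refine Subtype.ext (funext fun z => ?_)
    change ∑ i, (χ i z : 𝕜) • (a i).1.2 z = ξ.1 z
    have : ∀ i, (χ i z : 𝕜) • (a i).1.2 z = (χ i z : 𝕜) • ξ.1 z := by
      intro i
      by_cases hz : (z : X) ∈ (a i).1.1
      · rw [(a i).2.2.2 z hz]
      · simp [image_eq_zero_of_notMem_tsupport fun h => hz (h3 i h)]
    rw [Finset.sum_congr rfl fun i _ => this i, ← Finset.sum_smul]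
    have := h4 z z.2
    rw [← RCLike.ofReal_sum, this]
    simp

end PointwiseSections

/-! ### Immersions and submersions -/

/-- A continuous map is smooth if its composition with an immersion is smooth. -/
theorem contDiffAt_of_comp_immersion {V W F : Type*} [NormedAddCommGroup V] [NormedSpace ℝ V]
    [FiniteDimensional ℝ V] [NormedAddCommGroup W] [NormedSpace ℝ W] [FiniteDimensional ℝ W]
    [NormedAddCommGroup F] [NormedSpace ℝ F] {i : V → W} {q : F → V} {w : F}
    (hq : ContinuousAt q w) (hi : ContDiffAt ℝ ∞ i (q w))
    (hinj : Function.Injective (fderiv ℝ i (q w))) (hiq : ContDiffAt ℝ ∞ (i ∘ q) w) :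
    ContDiffAt ℝ ∞ q w := by
  -- With a linear left inverse `L` of the derivative of `i`, the map `L ∘ i` has derivative the
  -- identity and is locally invertible. Near `w`, the map `q` is then this local inverse applied to
  -- `L ∘ (i ∘ q)`.
  obtain ⟨L₀, hL₀⟩ := LinearMap.exists_leftInverse_of_injective
    (fderiv ℝ i (q w) : V →ₗ[ℝ] W) (LinearMap.ker_eq_bot.2 hinj)
  let L : W →L[ℝ] V := LinearMap.toContinuousLinearMap L₀
  have := FiniteDimensional.complete ℝ V
  have hj : ContDiffAt ℝ ∞ (L ∘ i) (q w) := L.contDiff.contDiffAt.comp _ hi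
  have hd : HasFDerivAt (L ∘ i) (ContinuousLinearEquiv.refl ℝ V : V →L[ℝ] V) (q w) := by
    have h1 := L.hasFDerivAt.comp (q w) (hi.differentiableAt (by simp)).hasFDerivAt
    convert h1 using 1
    ext v
    exact (LinearMap.congr_fun hL₀ v).symm
  have hn : (∞ : WithTop ℕ∞) ≠ 0 := by simp
  have hinv := hj.to_localInverse hd hn
  have hcomp : ContDiffAt ℝ ∞ ((hj.localInverse hd hn) ∘ (L ∘ (i ∘ q))) w :=
    ContDiffAt.comp w (by exact hinv) (L.contDiff.contDiffAt.comp _ hiq)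
  refine hcomp.congr_of_eventuallyEq ?_
  let H := hj.toOpenPartialHomeomorph (L ∘ i) hd hn
  -- Continuity of `q` keeps its values in the neighbourhood on which the local inverse undoes `L ∘
  -- i`.
  have hs := hq (H.open_source.mem_nhds (hj.mem_toOpenPartialHomeomorph_source hd hn))
  filter_upwards [hs] with v hv
  exact (H.left_inv hv).symm

/-- The inverse function theorem, as a diffeomorphism between open sets. -/
theorem exists_local_diffeo {V W : Type*} [NormedAddCommGroup V] [NormedSpace ℝ V]
    [CompleteSpace V] [NormedAddCommGroup W] [NormedSpace ℝ W] {Ψ : V → W} {D : Set V}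
    (hD : IsOpen D) (hΨ : ContDiffOn ℝ ∞ Ψ D) {v₀ : V} (hv₀ : v₀ ∈ D) {T : V ≃L[ℝ] W}
    (hT : HasFDerivAt Ψ (T : V →L[ℝ] W) v₀) :
    ∃ H : OpenPartialHomeomorph V W, (∀ v, H v = Ψ v) ∧ v₀ ∈ H.source ∧ H.source ⊆ D ∧
      ContDiffOn ℝ ∞ H H.source ∧ ContDiffOn ℝ ∞ H.symm H.target := by
  have hΨa : ∀ v ∈ D, ContDiffAt ℝ ∞ Ψ v := fun v hv => hΨ.contDiffAt (hD.mem_nhds hv)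
  have hcont : ContinuousOn (fderiv ℝ Ψ) D := hΨ.continuousOn_fderiv_of_isOpen hD (by simp)
  -- The inverse is needed to be smooth on its whole domain, so the source is cut down to the points
  -- where the derivative is invertible. These form an open set because invertible operators do.
  let O : Set V := D ∩ fderiv ℝ Ψ ⁻¹' range ((↑) : (V ≃L[ℝ] W) → V →L[ℝ] W)
  have hO : IsOpen O := hcont.isOpen_inter_preimage hD ContinuousLinearEquiv.isOpen
  let H := (hΨa _ hv₀).toOpenPartialHomeomorph Ψ hT (by simp)
  let H' := H.restrOpen O hO
  refine ⟨H', fun v => rfl,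
    ⟨(hΨa _ hv₀).mem_toOpenPartialHomeomorph_source hT (by simp), hv₀, T, hT.fderiv.symm⟩,
    fun v hv => hv.2.1, hΨ.mono fun v hv => hv.2.1, fun w hw => ?_⟩
  have hs := H'.map_target hw
  obtain ⟨R, hR⟩ := hs.2.2
  refine (H'.contDiffAt_symm hw (f₀' := R) ?_ (hΨa _ hs.2.1)).contDiffWithinAt
  rw [hR]
  exact ((hΨa _ hs.2.1).differentiableAt (by simp)).hasFDerivAt

/-- A surjective linear map is the second component of a linear isomorphism. -/
theorem exists_complementary_coordinates {N n : ℕ} {T : EucR N →L[ℝ] EucR n}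
    (hT : Function.Surjective T) : ∃ (m : ℕ) (π : EucR N →L[ℝ] EucR m)
      (Te : EucR N ≃L[ℝ] EucR m × EucR n), ∀ v, Te v = (π v, T v) := by
  let K := LinearMap.ker (T : EucR N →ₗ[ℝ] EucR n)
  let m := Module.finrank ℝ K
  let κ : K ≃L[ℝ] EucR m := ContinuousLinearEquiv.ofFinrankEq (by simp [m])
  -- A vector killed by `T` equals its projection to `ker T`, so it vanishes if `π` kills it too.
  -- Rank-nullity gives the equality of dimensions.
  let π : EucR N →L[ℝ] EucR m := (κ : K →L[ℝ] EucR m) ∘L K.orthogonalProjectionOnto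
  have hinj : Function.Injective ((π.prod T : EucR N →L[ℝ] EucR m × EucR n) :
      EucR N →ₗ[ℝ] EucR m × EucR n) := by
    rw [← LinearMap.ker_eq_bot, LinearMap.ker_eq_bot']
    intro v hv
    have h1 : π v = 0 := congrArg Prod.fst hv
    have h2 : T v = 0 := congrArg Prod.snd hv
    have h3 : K.orthogonalProjectionOnto v = 0 := κ.injective (by simpa [π] using h1)
    have h4 : K.orthogonalProjectionOnto v = (⟨v, h2⟩ : K) :=
      K.orthogonalProjectionOnto_mem_subspace_eq_self ⟨v, h2⟩
    rw [h4] at h3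
    exact congrArg Subtype.val h3
  have hdim : Module.finrank ℝ (EucR N) = Module.finrank ℝ (EucR m × EucR n) := by
    have h1 := LinearMap.finrank_range_add_finrank_ker (T : EucR N →ₗ[ℝ] EucR n)
    rw [LinearMap.range_eq_top.2 hT, finrank_top] at h1
    rw [Module.finrank_prod, ← h1]
    simp [m, K, add_comm]
  exact ⟨m, π, (LinearMap.linearEquivOfInjective _ hinj hdim).toContinuousLinearEquiv,
    fun _ => rfl⟩

/-- Every point has a neighbourhood on which a submersion is a coordinate projection. -/
theorem SubmersiveMap.exists_submersionChart {Z Y : Type*} [TopologicalSpace Z] [HasAtlas Z]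
    [IsDiffManifold Z] [TopologicalSpace Y] [HasAtlas Y] [IsDiffManifold Y] {φ : Z → Y}
    (hφ : SubmersiveMap φ) (z : Z) :
    ∃ (m n : ℕ) (e : SubmersionChart φ m n), z ∈ e.e.source := by
  obtain ⟨⟨N, c⟩, hc, hzc⟩ := IsDiffManifold.cover z
  obtain ⟨⟨n, d⟩, hd, hzd⟩ := IsDiffManifold.cover (φ z)
  dsimp only at hzc hzd
  let F : EucR N → EucR n := d ∘ φ ∘ c.symm
  let D : Set (EucR N) := c.target ∩ c.symm ⁻¹' (φ ⁻¹' d.source)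
  have hD : IsOpen D := c.symm.isOpen_inter_preimage (d.open_source.preimage hφ.1.1)
  have hF : ContDiffOn ℝ ∞ F D := hφ.1.2 _ hc _ hd
  have hzD : c z ∈ D := ⟨c.map_source hzc, by simpa [c.left_inv hzc] using hzd⟩
  let T : EucR N →L[ℝ] EucR n := fderiv ℝ F (c z)
  have hT : Function.Surjective T := hφ.2 z _ hc _ hd hzc hzd
  obtain ⟨m, π, Te, hTe⟩ := exists_complementary_coordinates hT
  -- Adjoining the linear coordinates `π` to the local expression of `φ` gives a map whose
  -- derivative at the point is the isomorphism `Te`.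
  let Ψ : EucR N → EucR m × EucR n := fun v => (π v, F v)
  have hΨ : ContDiffOn ℝ ∞ Ψ D := π.contDiff.contDiffOn.prodMk hF
  have hΨ' : HasFDerivAt Ψ (Te : EucR N →L[ℝ] EucR m × EucR n) (c z) := by
    have h1 : HasFDerivAt F T (c z) :=
      ((hF.contDiffAt (hD.mem_nhds hzD)).differentiableAt (by simp)).hasFDerivAt
    have h2 : (Te : EucR N →L[ℝ] EucR m × EucR n) = π.prod T :=
      ContinuousLinearMap.ext fun v => hTe v
    rw [h2]
    exact π.hasFDerivAt.prodMk h1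
  obtain ⟨H', hH', hzH, hHD, hsm1, hsm2⟩ := exists_local_diffeo hD hΨ hzD hΨ'
  refine ⟨m, n, ⟨c.trans H', (IsSmoothChart.of_mem_atlas hc).trans hsm1 hsm2, d,
    IsSmoothChart.of_mem_atlas hd, ?_, ?_⟩, ?_⟩
  · intro w hw
    have h1 := (hHD hw.2).2
    simpa [c.left_inv hw.1] using h1
  · intro w hw
    have h1 : (c.trans H') w = Ψ (c w) := hH' _
    rw [h1]
    simp [Ψ, F, c.left_inv hw.1]
  · exact ⟨hzc, hzH⟩

/-! ### Charts of fibre products -/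

namespace FiberProduct

variable {A B C : Type*} [TopologicalSpace A] [HasAtlas A] [TopologicalSpace B] [HasAtlas B]
variable [TopologicalSpace C] [HasAtlas C] {f : A → C} {g : B → C}
variable {F : Type*} [NormedAddCommGroup F] [NormedSpace ℝ F]

theorem isInducing_val : IsInducing (fun z : FiberProduct f g => z.1) := IsInducing.subtypeVal

theorem continuous_fst : Continuous (fun z : FiberProduct f g => z.1.1) :=
  _root_.continuous_fst.comp isInducing_val.continuous

theorem continuous_snd : Continuous (fun z : FiberProduct f g => z.1.2) :=
  _root_.continuous_snd.comp isInducing_val.continuous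

instance [T2Space A] [T2Space B] : T2Space (FiberProduct f g) :=
  inferInstanceAs (T2Space {p : A × B // f p.1 = g p.2})

theorem contDiffAt_of_mem_atlas {ψ : Σ n : ℕ, OpenPartialHomeomorph (FiberProduct f g) (EucR n)}
    (hψ : ψ ∈ HasAtlas.atlas (X := FiberProduct f g)) {z : FiberProduct f g} (hz : z ∈ ψ.2.source)
    {c : Σ n : ℕ, OpenPartialHomeomorph A (EucR n)} (hc : c ∈ HasAtlas.atlas (X := A))
    {d : Σ n : ℕ, OpenPartialHomeomorph B (EucR n)} (hd : d ∈ HasAtlas.atlas (X := B))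
    (hzc : z.1.1 ∈ c.2.source) (hzd : z.1.2 ∈ d.2.source) :
    ContDiffAt ℝ ∞ (fun v => (c.2 (ψ.2.symm v).1.1, d.2 (ψ.2.symm v).1.2)) (ψ.2 z) ∧
    Function.Injective
      (fderiv ℝ (fun v => (c.2 (ψ.2.symm v).1.1, d.2 (ψ.2.symm v).1.2)) (ψ.2 z)) := by
  obtain ⟨h1, h2⟩ := hψ c hc d hd
  have hmem : ψ.2 z ∈ ψ.2.target ∩ ψ.2.symm ⁻¹' {z | z.1.1 ∈ c.2.source ∧ z.1.2 ∈ d.2.source} :=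
    ⟨ψ.2.map_source hz, by simp [ψ.2.left_inv hz, hzc, hzd]⟩
  refine ⟨h1.contDiffAt ((ψ.2.symm.isOpen_inter_preimage ?_).mem_nhds hmem), h2 _ hmem⟩
  exact (c.2.open_source.preimage continuous_fst).inter (d.2.open_source.preimage continuous_snd)

theorem smoothMap_fst (hB : HasAtlas.Covers B) :
    SmoothMap (fun z : FiberProduct f g => z.1.1) := by
  refine ⟨continuous_fst, fun ψ hψ c hc v hv => ContDiffAt.contDiffWithinAt ?_⟩
  obtain ⟨d, hd, hzd⟩ := hB (ψ.2.symm v).1.2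
  have h := (contDiffAt_of_mem_atlas hψ (ψ.2.map_target hv.1) hc hd hv.2 hzd).1
  rw [ψ.2.right_inv hv.1] at h
  exact h.fst

theorem smoothMap_snd (hA : HasAtlas.Covers A) :
    SmoothMap (fun z : FiberProduct f g => z.1.2) := by
  refine ⟨continuous_snd, fun ψ hψ d hd v hv => ContDiffAt.contDiffWithinAt ?_⟩
  obtain ⟨c, hc, hzc⟩ := hA (ψ.2.symm v).1.1
  have h := (contDiffAt_of_mem_atlas hψ (ψ.2.map_target hv.1) hc hd hzc hv.2).1
  rw [ψ.2.right_inv hv.1] at h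
  exact h.snd

/-- The map `φ⁻¹` is smooth as a map into `A × B`. -/
def SmoothSymm (φ : OpenPartialHomeomorph (FiberProduct f g) F) : Prop :=
  ∀ z ∈ φ.source, ∀ c ∈ HasAtlas.atlas (X := A), ∀ d ∈ HasAtlas.atlas (X := B),
    z.1.1 ∈ c.2.source → z.1.2 ∈ d.2.source →
      ContDiffAt ℝ ∞ (fun w => (c.2 (φ.symm w).1.1, d.2 (φ.symm w).1.2)) (φ z)

/-- The only difficulty is smoothness of `ψ ∘ φ⁻¹` for an atlas chart `ψ`. It is continuous, and its
composition with the immersion `ψ⁻¹` into `A × B` is `φ⁻¹`, so `contDiffAt_of_comp_immersion`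
applies. -/
theorem isSmoothChart_of_smoothSymm (hA : HasAtlas.Covers A) (hB : HasAtlas.Covers B)
    {φ : OpenPartialHomeomorph (FiberProduct f g) F} (h1 : ∀ z ∈ φ.source, CkAt ⊤ φ z)
    (h2 : SmoothSymm φ) : IsSmoothChart φ := by
  refine isSmoothChart_iff.2 fun z hz ψ hψ hzψ => ⟨h1 z hz ψ hψ hzψ, ?_⟩
  obtain ⟨c, hc, hzc⟩ := hA z.1.1
  obtain ⟨d, hd, hzd⟩ := hB z.1.2
  obtain ⟨h3, h4⟩ := contDiffAt_of_mem_atlas hψ hzψ hc hd hzc hzd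
  have e : (ψ.2 ∘ φ.symm) (φ z) = ψ.2 z := by simp [φ.left_inv hz]
  have hcs : ContinuousAt φ.symm (φ z) := φ.continuousAt_symm (φ.map_source hz)
  refine contDiffAt_of_comp_immersion (i := fun v => (c.2 (ψ.2.symm v).1.1, d.2 (ψ.2.symm v).1.2))
    ?_ (by rw [e]; exact h3) (by rw [e]; exact h4) ?_
  · exact ContinuousAt.comp (by rw [φ.left_inv hz]; exact ψ.2.continuousAt hzψ) hcs
  · refine (h2 z hz c hc d hd hzc hzd).congr_of_eventuallyEq ?_
    have : ψ.2.source ∈ 𝓝 (φ.symm (φ z)) := by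
      rw [φ.left_inv hz]; exact ψ.2.open_source.mem_nhds hzψ
    filter_upwards [hcs this] with v hv
    have hv' : φ.symm v ∈ ψ.2.source := hv
    simp [ψ.2.left_inv hv']

/-! ### Charts of a fibre product built from fibre coordinates of a submersion -/

section Adapted

variable {m n : ℕ} (hf : Continuous f) (φ : OpenPartialHomeomorph A F) (e : SubmersionChart g m n)
variable (z₀ : FiberProduct f g)

/-- Both points lie in the domain of `e.d` and have the same coordinates there. This is what makes
the inverse of the adapted chart land in the fibre product. -/
theorem adapted_eq {y : A} {u : EucR m} (h1 : f y ∈ e.d.source)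
    (h2 : (u, e.d (f y)) ∈ e.e.target) : f y = g (e.e.symm (u, e.d (f y))) := by
  have h3 := e.e.map_target h2
  refine e.d.injOn h1 (e.mem_source _ h3) ?_
  rw [e.proj _ h3, e.e.right_inv h2]

/-- The point `(a, b)` of the fibre product. -/
def mk' {A B C : Type*} {f : A → C} {g : B → C} (a : A) (b : B) (h : f a = g b) :
    FiberProduct f g := ⟨(a, b), h⟩

open scoped Classical in
/-- The inverse of the chart `(a, b) ↦ (φ a, u b)`, with the value `z₀` where it is undefined. -/
noncomputable def adaptedInv (v : F × EucR m) : FiberProduct f g :=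
  if h : f (φ.symm v.1) = g (e.e.symm (v.2, e.d (f (φ.symm v.1)))) then
    mk' _ _ h else z₀

theorem adaptedInv_val {v : F × EucR m}
    (h : f (φ.symm v.1) = g (e.e.symm (v.2, e.d (f (φ.symm v.1))))) :
    (adaptedInv φ e z₀ v).1 = (φ.symm v.1, e.e.symm (v.2, e.d (f (φ.symm v.1)))) := by
  rw [adaptedInv, dif_pos h]
  rfl

/-- The chart `(a, b) ↦ (φ a, u b)` of a fibre product with a submersion, where `u` are the fibre
coordinates of the submersion chart.  The point `z₀` is an arbitrary value of the inverse outside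
its domain. -/
noncomputable def adaptedChart : OpenPartialHomeomorph (FiberProduct f g) (F × EucR m) where
  toFun z := (φ z.1.1, (e.e z.1.2).1)
  invFun := adaptedInv φ e z₀
  source := {z | z.1.1 ∈ φ.source ∧ z.1.2 ∈ e.e.source}
  target := {v | v.1 ∈ φ.target ∧ f (φ.symm v.1) ∈ e.d.source ∧
    (v.2, e.d (f (φ.symm v.1))) ∈ e.e.target}
  map_source' := by
    rintro ⟨⟨y, h⟩, hz⟩ ⟨h1, h2⟩
    dsimp only at *
    refine ⟨φ.map_source h1, ?_, ?_⟩
    · rw [φ.left_inv h1, hz]; exact e.mem_source _ h2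
    · rw [φ.left_inv h1, hz, e.proj _ h2]; exact e.e.map_source h2
  map_target' := by
    rintro v ⟨h1, h2, h3⟩
    have h := adaptedInv_val φ e z₀ (adapted_eq e h2 h3)
    exact ⟨by rw [h]; exact φ.map_target h1, by rw [h]; exact e.e.map_target h3⟩
  left_inv' := by
    rintro ⟨⟨y, h⟩, hz⟩ ⟨h1, h2⟩
    dsimp only at *
    have e1 : e.e.symm ((e.e h).1, e.d (f (φ.symm (φ y)))) = h := by
      rw [φ.left_inv h1, hz, e.proj _ h2]; exact e.e.left_inv h2
    refine Subtype.ext ((adaptedInv_val φ e z₀ ?_).trans (Prod.ext (φ.left_inv h1) e1))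
    change f (φ.symm (φ y)) = g (e.e.symm ((e.e h).1, e.d (f (φ.symm (φ y)))))
    rw [e1, φ.left_inv h1, hz]
  right_inv' := by
    rintro v ⟨h1, h2, h3⟩
    rw [adaptedInv_val φ e z₀ (adapted_eq e h2 h3)]
    dsimp only
    rw [φ.right_inv h1, e.e.right_inv h3]
  open_source := (φ.open_source.preimage continuous_fst).inter
    (e.e.open_source.preimage continuous_snd)
  open_target := by
    have h1 : ContinuousOn (fun v : F × EucR m => f (φ.symm v.1)) (Prod.fst ⁻¹' φ.target) :=
      hf.comp_continuousOn (φ.continuousOn_symm.comp _root_.continuous_fst.continuousOn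
        fun _ h => h)
    have h2 := h1.isOpen_inter_preimage (φ.open_target.preimage _root_.continuous_fst)
      e.d.open_source
    have h3 : ContinuousOn (fun v : F × EucR m => (v.2, e.d (f (φ.symm v.1))))
        (Prod.fst ⁻¹' φ.target ∩ (fun v : F × EucR m => f (φ.symm v.1)) ⁻¹' e.d.source) :=
      _root_.continuous_snd.continuousOn.prodMk
        (e.d.continuousOn.comp (h1.mono inter_subset_left) fun _ h => h.2)
    convert h3.isOpen_inter_preimage h2 e.e.open_target using 1
    ext v
    simp [and_assoc]
  continuousOn_toFun := by
    refine ContinuousOn.prodMk (φ.continuousOn.comp continuous_fst.continuousOn fun _ h => h.1) ?_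
    exact _root_.continuous_fst.comp_continuousOn
      (e.e.continuousOn.comp continuous_snd.continuousOn fun _ h => h.2)
  continuousOn_invFun := by
    rw [isInducing_val.continuousOn_iff]
    have h0 : ContinuousOn (fun v : F × EucR m => φ.symm v.1) {v | v.1 ∈ φ.target ∧
        f (φ.symm v.1) ∈ e.d.source ∧ (v.2, e.d (f (φ.symm v.1))) ∈ e.e.target} :=
      φ.continuousOn_symm.comp _root_.continuous_fst.continuousOn fun _ h => h.1
    have h1 := h0.prodMk (e.e.continuousOn_symm.comp
      (_root_.continuous_snd.continuousOn.prodMk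
        (e.d.continuousOn.comp (hf.comp_continuousOn h0) fun _ h => h.2.1)) fun _ h => h.2.2)
    exact h1.congr fun v hv => adaptedInv_val φ e z₀ (adapted_eq e hv.2.1 hv.2.2)

theorem adaptedChart_apply (z : FiberProduct f g) :
    adaptedChart hf φ e z₀ z = (φ z.1.1, (e.e z.1.2).1) := rfl

theorem mem_adaptedChart_target {v : F × EucR m} :
    v ∈ (adaptedChart hf φ e z₀).target ↔ v.1 ∈ φ.target ∧ f (φ.symm v.1) ∈ e.d.source ∧
      (v.2, e.d (f (φ.symm v.1))) ∈ e.e.target := Iff.rfl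

theorem adaptedChart_symm_apply {v : F × EucR m} (hv : v ∈ (adaptedChart hf φ e z₀).target) :
    ((adaptedChart hf φ e z₀).symm v).1 =
      (φ.symm v.1, e.e.symm (v.2, e.d (f (φ.symm v.1)))) :=
  adaptedInv_val φ e z₀ (adapted_eq e hv.2.1 hv.2.2)

variable {φ}

theorem ckAt_adaptedChart (hA : HasAtlas.Covers A) (hB : HasAtlas.Covers B) (hφ : IsSmoothChart φ)
    {z : FiberProduct f g} (hz : z ∈ (adaptedChart hf φ e z₀).source) :
    CkAt ⊤ (adaptedChart hf φ e z₀) z := by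
  have h1 : CkAt ⊤ (fun z : FiberProduct f g => φ z.1.1) z :=
    CkAt.comp_smoothMap (g := φ) (hφ.ckAt hz.1) hA (smoothMap_fst hB)
  have h2 : CkAt ⊤ (fun z : FiberProduct f g => e.e z.1.2) z :=
    CkAt.comp_smoothMap (g := e.e) (e.smooth_e.ckAt hz.2) hB (smoothMap_snd hA)
  intro ψ hψ hzψ
  exact (h1 ψ hψ hzψ).prodMk (h2 ψ hψ hzψ).fst

/-- Smoothness of `f` enters here: the second component of the inverse is `e⁻¹(u, d(f(φ⁻¹ v)))`. -/
theorem smoothSymm_adaptedChart (hA : HasAtlas.Covers A)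
    (hC : HasAtlas.Covers C) (hfs : SmoothMap f) (hφ : IsSmoothChart φ) :
    SmoothSymm (adaptedChart hf φ e z₀) := by
  intro z hz c hc d hd hzc hzd
  have h1 : ContDiffAt ℝ ∞ (c.2 ∘ φ.symm) (φ z.1.1) := (isSmoothChart_iff.1 hφ _ hz.1 c hc hzc).2
  have h2 : ContDiffAt ℝ ∞ (d.2 ∘ e.e.symm) (e.e z.1.2) :=
    (isSmoothChart_iff.1 e.smooth_e _ hz.2 d hd hzd).2
  have h3 : CkAt ⊤ (fun y => e.d (f y)) z.1.1 := by
    refine CkAt.comp_smoothMap (e.smooth_d.ckAt ?_) hC hfs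
    rw [z.2]; exact e.mem_source _ hz.2
  have h4 : ContDiffAt ℝ ∞ ((fun y => e.d (f y)) ∘ φ.symm) (φ z.1.1) := h3.contDiffAt hA hφ hz.1
  have h5 : ContDiffAt ℝ ∞ (fun v : F × EucR m => (v.2, e.d (f (φ.symm v.1))))
      (adaptedChart hf φ e z₀ z) :=
    contDiffAt_snd.prodMk (ContDiffAt.comp (𝕜 := ℝ) (f := Prod.fst)
      (g := (fun y => e.d (f y)) ∘ φ.symm) (adaptedChart hf φ e z₀ z) h4 contDiffAt_fst)
  have h6 : (fun v : F × EucR m => (v.2, e.d (f (φ.symm v.1)))) (adaptedChart hf φ e z₀ z) =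
      e.e z.1.2 := by
    simp only [adaptedChart_apply]
    rw [φ.left_inv hz.1, z.2, e.proj _ hz.2]
  have h2' : ContDiffAt ℝ ∞ (d.2 ∘ e.e.symm)
      ((fun v : F × EucR m => (v.2, e.d (f (φ.symm v.1)))) (adaptedChart hf φ e z₀ z)) := by
    rw [h6]; exact h2
  have h7 : ContDiffAt ℝ ∞ (fun v : F × EucR m => ((c.2 ∘ φ.symm) v.1,
      (d.2 ∘ e.e.symm) (v.2, e.d (f (φ.symm v.1))))) (adaptedChart hf φ e z₀ z) :=
    (ContDiffAt.comp (adaptedChart hf φ e z₀ z) h1 contDiffAt_fst).prodMk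
      (ContDiffAt.comp (𝕜 := ℝ) (f := fun v : F × EucR m => (v.2, e.d (f (φ.symm v.1))))
        (g := d.2 ∘ e.e.symm) (adaptedChart hf φ e z₀ z) h2' h5)
  refine h7.congr_of_eventuallyEq ?_
  filter_upwards [(adaptedChart hf φ e z₀).open_target.mem_nhds
    ((adaptedChart hf φ e z₀).map_source hz)] with v hv
  rw [adaptedChart_symm_apply hf φ e z₀ hv]
  rfl

theorem isSmoothChart_adaptedChart (hA : HasAtlas.Covers A) (hB : HasAtlas.Covers B)
    (hC : HasAtlas.Covers C) (hfs : SmoothMap f) (hφ : IsSmoothChart φ) :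
    IsSmoothChart (adaptedChart hf φ e z₀) :=
  isSmoothChart_of_smoothSymm hA hB (fun _ hz => ckAt_adaptedChart hf e z₀ hA hB hφ hz)
    (smoothSymm_adaptedChart hf e z₀ hA hC hfs hφ)

end Adapted

/-- The linear identification `ℝⁿ × ℝᵐ ≃ ℝⁿ⁺ᵐ`. -/
noncomputable def prodEquiv (n m : ℕ) : (EucR n × EucR m) ≃L[ℝ] EucR (n + m) :=
  ContinuousLinearEquiv.ofFinrankEq (by simp)

/-- Adapted charts, with their target identified with `ℝⁿ⁺ᵐ`, belong to the atlas. The immersion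
condition is checked by exhibiting a smooth left inverse. -/
theorem covers [IsDiffManifold A] [IsDiffManifold B] [IsDiffManifold C] (hf : SmoothMap f)
    (hg : SubmersiveMap g) : HasAtlas.Covers (FiberProduct f g) := by
  intro z
  have hA := IsDiffManifold.covers A
  have hB := IsDiffManifold.covers B
  have hC := IsDiffManifold.covers C
  obtain ⟨φ, hφ, hzφ⟩ := hA z.1.1
  obtain ⟨m, n, e, hze⟩ := hg.exists_submersionChart z.1.2
  have hφs := IsSmoothChart.of_mem_atlas hφ
  let Φ := adaptedChart hf.1 φ.2 e z
  let Q := prodEquiv φ.1 m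
  let Φ' := Φ.trans Q.toHomeomorph.toOpenPartialHomeomorph
  refine ⟨⟨φ.1 + m, Φ'⟩, ?_, ?_⟩
  · intro c hc d hd
    have key : ∀ v ∈ Φ'.target ∩ Φ'.symm ⁻¹' {z | z.1.1 ∈ c.2.source ∧ z.1.2 ∈ d.2.source},
        ContDiffAt ℝ ∞ (fun v => (c.2 (Φ'.symm v).1.1, d.2 (Φ'.symm v).1.2)) v := by
      intro v hv
      have hvt : Q.symm v ∈ Φ.target := by simpa [Φ'] using hv.1
      have h1 := smoothSymm_adaptedChart hf.1 e z hA hC hf hφs _ (Φ.map_target hvt) c hc d hd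
        hv.2.1 hv.2.2
      have h2 : Φ (Φ.symm (Q.symm v)) = Q.symm v := Φ.right_inv hvt
      exact ContDiffAt.comp (𝕜 := ℝ) (f := Q.symm) v (by rw [← h2]; exact h1)
        Q.symm.contDiff.contDiffAt
    refine ⟨fun v hv => (key v hv).contDiffWithinAt, fun v hv => ?_⟩
    have hvt : Q.symm v ∈ Φ.target := by simpa [Φ'] using hv.1
    set z' := Φ.symm (Q.symm v) with hz'
    have hzs : z' ∈ Φ.source := Φ.map_target hvt
    have hz'e : Φ'.symm v = z' := rfl
    -- The formula of the adapted chart makes sense on all of `A × B` near the point, not only on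
    -- the fibre product. This extension is a left inverse of the parametrization, so the derivative
    -- of the parametrization is injective.
    let R : EucR c.1 × EucR d.1 → EucR (φ.1 + m) :=
      fun p => Q ((φ.2 ∘ c.2.symm) p.1, ((e.e ∘ d.2.symm) p.2).1)
    have hR : ContDiffAt ℝ ∞ R (c.2 (Φ'.symm v).1.1, d.2 (Φ'.symm v).1.2) := by
      have h1 := (isSmoothChart_iff.1 hφs z'.1.1 hzs.1 c hc hv.2.1).1
      have h2 := (isSmoothChart_iff.1 e.smooth_e z'.1.2 hzs.2 d hd hv.2.2).1
      refine Q.contDiff.contDiffAt.comp _ (ContDiffAt.prodMk ?_ (ContDiffAt.fst ?_))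
      · exact ContDiffAt.comp (𝕜 := ℝ) (f := Prod.fst) (c.2 (Φ'.symm v).1.1, d.2 (Φ'.symm v).1.2)
          h1 contDiffAt_fst
      · exact ContDiffAt.comp (𝕜 := ℝ) (f := Prod.snd) (c.2 (Φ'.symm v).1.1, d.2 (Φ'.symm v).1.2)
          h2 contDiffAt_snd
    have hid : R ∘ (fun v => (c.2 (Φ'.symm v).1.1, d.2 (Φ'.symm v).1.2)) =ᶠ[𝓝 v] id := by
      have hopen : IsOpen {z : FiberProduct f g | z.1.1 ∈ c.2.source ∧ z.1.2 ∈ d.2.source} :=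
        (c.2.open_source.preimage continuous_fst).inter (d.2.open_source.preimage continuous_snd)
      filter_upwards [(Φ'.symm.isOpen_inter_preimage hopen).mem_nhds hv] with w hw
      have h3 : R (c.2 (Φ'.symm w).1.1, d.2 (Φ'.symm w).1.2) = Φ' (Φ'.symm w) := by
        simp only [R, Function.comp_apply]
        rw [c.2.left_inv hw.2.1, d.2.left_inv hw.2.2]
        rfl
      simp only [Function.comp_apply, id]
      rw [h3, Φ'.right_inv hw.1]
    have h4 := (hR.differentiableAt (by simp)).hasFDerivAt.comp v
      ((key v hv).differentiableAt (by simp)).hasFDerivAt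
    have h5 := h4.unique ((hasFDerivAt_id v).congr_of_eventuallyEq hid)
    refine Function.LeftInverse.injective
      (g := fderiv ℝ R (c.2 (Φ'.symm v).1.1, d.2 (Φ'.symm v).1.2)) fun w => ?_
    exact DFunLike.congr_fun h5 w
  · simp only [Φ', OpenPartialHomeomorph.trans_source]
    exact ⟨⟨hzφ, hze⟩, by simp⟩

end FiberProduct

/-! ### Pullback bundles -/

section PullbackBundle

variable {A B C : Type*} [TopologicalSpace A] [HasAtlas A] [TopologicalSpace B] [HasAtlas B]
variable {f : A → C} {g : B → C} {𝕜 : Type*} [RCLike 𝕜]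
variable {E : A → Type*} [∀ x, AddCommGroup (E x)] [∀ x, Module 𝕜 (E x)] [HasTrivs 𝕜 E]

theorem exists_mem_trivs_pullFst [IsDiffVectorBundle 𝕜 E] (z : FiberProduct f g) :
    ∃ τ ∈ HasTrivs.trivs (𝕜 := 𝕜) (E := PullFst f g E), z ∈ τ.base := by
  obtain ⟨τ, hτ, hz⟩ := IsDiffVectorBundle.cover (𝕜 := 𝕜) (E := E) z.1.1
  exact ⟨_, ⟨τ, hτ, rfl⟩, hz⟩

theorem IsSmoothTriv.pullFst [TopologicalSpace C] [HasAtlas C] (hA : HasAtlas.Covers A)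
    (hB : HasAtlas.Covers B) {σ : LocTriv 𝕜 E}
    (hσ : IsSmoothTriv σ) : IsSmoothTriv (σ.pullFst f g) := by
  have key : ∀ σ τ : LocTriv 𝕜 E, SmoothTransition σ τ →
      SmoothTransition (σ.pullFst f g) (τ.pullFst f g) := by
    intro σ τ h v
    rw [ckOn_iff_ckAt ((σ.pullFst f g).isOpen_base.inter (τ.pullFst f g).isOpen_base)]
    intro z hz
    exact CkAt.comp_smoothMap (q := fun z : FiberProduct f g => z.1.1)
      ((ckOn_iff_ckAt (σ.isOpen_base.inter τ.isOpen_base)).1 (h v) z.1.1 hz) hA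
      (FiberProduct.smoothMap_fst hB)
  rintro _ ⟨τ, hτ, rfl⟩
  exact ⟨key _ _ (hσ τ hτ).1, key _ _ (hσ τ hτ).2⟩

/-- The restriction of a local trivialization to a smaller open set. -/
def LocTriv.restrict {X : Type*} [TopologicalSpace X] {E : X → Type*} [∀ x, AddCommGroup (E x)]
    [∀ x, Module 𝕜 (E x)] (τ : LocTriv 𝕜 E) (O : Set X) (hO : IsOpen O) (hOτ : O ⊆ τ.base) :
    LocTriv 𝕜 E :=
  { τ with
    base := O
    isOpen_base := hO
    left_inv := fun x hx => τ.left_inv x (hOτ hx)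
    right_inv := fun x hx => τ.right_inv x (hOτ hx) }

theorem IsSmoothTriv.restrict {X : Type*} [TopologicalSpace X] [HasAtlas X] {E : X → Type*}
    [∀ x, AddCommGroup (E x)] [∀ x, Module 𝕜 (E x)] [HasTrivs 𝕜 E] {τ : LocTriv 𝕜 E}
    (hτ : IsSmoothTriv τ) (O : Set X) (hO : IsOpen O) (hOτ : O ⊆ τ.base) :
    IsSmoothTriv (τ.restrict O hO hOτ) := by
  intro σ hσ
  refine ⟨fun v => ?_, fun v => ?_⟩
  · refine (ckOn_iff_ckAt (hO.inter σ.isOpen_base)).2 fun x hx => ?_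
    exact (ckOn_iff_ckAt (τ.isOpen_base.inter σ.isOpen_base)).1 ((hτ σ hσ).1 v) x
      ⟨hOτ hx.1, hx.2⟩
  · refine (ckOn_iff_ckAt (σ.isOpen_base.inter hO)).2 fun x hx => ?_
    exact (ckOn_iff_ckAt (σ.isOpen_base.inter τ.isOpen_base)).1 ((hτ σ hσ).2 v) x
      ⟨hx.1, hOτ hx.2⟩

end PullbackBundle

/-! ### Standard normed charts -/

section StdCharts

variable {X : Type*} [TopologicalSpace X] [HasAtlas X]

/-- The chart `φ`, restricted to the inverse image of a ball and rescaled to have target `ℝᴺ`. -/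
noncomputable def rescale {N : ℕ} (φ : OpenPartialHomeomorph X (EucR N)) (v : EucR N) (r : ℝ) :
    OpenPartialHomeomorph X (EucR N) :=
  φ.trans (OpenPartialHomeomorph.univBall v r).symm

theorem rescale_source_subset {N : ℕ} (φ : OpenPartialHomeomorph X (EucR N)) (v : EucR N)
    (r : ℝ) : (rescale φ v r).source ⊆ φ.source := fun _ h => h.1

theorem mem_rescale_source {N : ℕ} (φ : OpenPartialHomeomorph X (EucR N)) {v : EucR N}
    {r : ℝ} (hr : 0 < r) {x : X} (hx : x ∈ φ.source) (hv : φ x = v) :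
    x ∈ (rescale φ v r).source ∧ rescale φ v r x = 0 := by
  refine ⟨⟨hx, ?_⟩, ?_⟩
  · simp [OpenPartialHomeomorph.univBall_target v hr, hv, hr]
  · simp [rescale, hv]

theorem rescale_target {N : ℕ} (φ : OpenPartialHomeomorph X (EucR N)) {v : EucR N} {r : ℝ}
    (hr : 0 < r) (h : Metric.ball v r ⊆ φ.target) : (rescale φ v r).target = univ := by
  refine eq_univ_of_forall fun w => ⟨by simp, ?_⟩
  have h1 := (OpenPartialHomeomorph.univBall v r).map_source (x := w) (by simp)
  rw [OpenPartialHomeomorph.univBall_target v hr] at h1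
  exact h h1

theorem IsSmoothChart.rescale {N : ℕ} {φ : OpenPartialHomeomorph X (EucR N)}
    (hφ : IsSmoothChart φ) (v : EucR N) {r : ℝ} (hr : 0 < r) :
    IsSmoothChart (rescale φ v r) := by
  refine hφ.trans ?_ OpenPartialHomeomorph.contDiff_univBall.contDiffOn
  have := OpenPartialHomeomorph.contDiffOn_univBall_symm (c := v) (r := r) (n := ⊤)
  rw [← OpenPartialHomeomorph.univBall_target v hr] at this
  exact this

variable {𝕜 : Type*} [RCLike 𝕜] {E : X → Type*} [∀ x, AddCommGroup (E x)] [∀ x, Module 𝕜 (E x)]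
variable [HasTrivs 𝕜 E]

/-- The standard normed chart with the fibre norm given by the maximum norm in the coordinates
of a local trivialization. -/
noncomputable def StdNormedChart.ofTriv {N : ℕ} (φ : OpenPartialHomeomorph X (EucR N))
    (hφ : IsSmoothChart φ) (hφt : φ.target = univ) (τ : LocTriv 𝕜 E) (hτ : IsSmoothTriv τ)
    (h : φ.source ⊆ τ.base) : StdNormedChart 𝕜 E where
  dim := N
  φ := φ
  smooth_φ := hφ
  target_φ := hφt
  τ := τ.restrict φ.source φ.open_source h
  smooth_τ := hτ.restrict _ _ _
  base_τ := rfl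
  p x := (normSeminorm 𝕜 (Fin τ.rank → 𝕜)).comp (τ.coord x)
  p_pos x hx e he := by
    have h1 : 0 < ‖τ.coord x e‖ := norm_pos_iff.2 fun h0 => he <| by
      rw [← τ.left_inv x (h hx) e, h0, map_zero]
    exact h1
  p_cont := by
    have h1 : Continuous (fun q : X × (Fin τ.rank → 𝕜) => ‖q.2‖) := _root_.continuous_snd.norm
    refine h1.continuousOn.congr ?_
    rintro ⟨x, w⟩ ⟨hx, -⟩
    exact congrArg norm (τ.right_inv x (h hx) w)

/-- An atlas chart is restricted to the domain of a trivialization, and a small ball around the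
image of `x` is then stretched to all of `ℝⁿ`, with `x` at the origin. -/
theorem exists_stdNormedChart [IsDiffManifold X] [IsDiffVectorBundle 𝕜 E] (x : X) :
    ∃ c : StdNormedChart 𝕜 E, x ∈ c.unitBall := by
  obtain ⟨⟨N, φ₀⟩, hφ₀, hx⟩ := IsDiffManifold.cover x
  obtain ⟨τ, hτ, hxτ⟩ := IsDiffVectorBundle.cover (𝕜 := 𝕜) (E := E) x
  dsimp only at hx
  let φ := φ₀.restrOpen τ.base τ.isOpen_base
  have hφ : IsSmoothChart φ := (IsSmoothChart.of_mem_atlas hφ₀).restrOpen τ.isOpen_base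
  have hxφ : x ∈ φ.source := ⟨hx, hxτ⟩
  obtain ⟨r, hr, hball⟩ := Metric.isOpen_iff.1 φ.open_target _ (φ.map_source hxφ)
  have hmem := mem_rescale_source φ hr hxφ rfl
  refine ⟨StdNormedChart.ofTriv (rescale φ (φ x) r) (hφ.rescale _ hr) (rescale_target φ hr hball) τ
    (IsSmoothTriv.of_mem_trivs hτ) fun z hz => (rescale_source_subset _ _ _ hz).2, hmem.1, ?_⟩
  change (rescale φ (φ x) r) x ∈ Metric.ball 0 1
  rw [hmem.2]
  exact Metric.mem_ball_self one_pos

theorem StdNormedChart.isOpen_unitBall (c : StdNormedChart 𝕜 E) : IsOpen c.unitBall :=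
  c.φ.isOpen_inter_preimage Metric.isOpen_ball

/-- The inverse image of the closed unit ball of `ℝⁿ` under a standard normed chart. -/
def StdNormedChart.closedUnitBall (c : StdNormedChart 𝕜 E) : Set X :=
  c.φ.symm '' Metric.closedBall 0 1

theorem StdNormedChart.isCompact_closedUnitBall (c : StdNormedChart 𝕜 E) :
    IsCompact c.closedUnitBall :=
  (isCompact_closedBall _ _).image_of_continuousOn
    (c.φ.continuousOn_symm.mono (by simp [c.target_φ]))

theorem StdNormedChart.closedUnitBall_subset (c : StdNormedChart 𝕜 E) :
    c.closedUnitBall ⊆ c.φ.source := by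
  rintro _ ⟨v, -, rfl⟩
  exact c.φ.map_target (by simp [c.target_φ])

theorem StdNormedChart.unitBall_subset (c : StdNormedChart 𝕜 E) :
    c.unitBall ⊆ c.closedUnitBall := fun x hx =>
  ⟨c.φ x, Metric.ball_subset_closedBall hx.2, c.φ.left_inv hx.1⟩

/-- The fibre norm of a standard normed chart is bounded by the norm of the coordinates,
uniformly on the unit ball. -/
theorem StdNormedChart.exists_norm_bound (c : StdNormedChart 𝕜 E) :
    ∃ M : ℝ, 0 ≤ M ∧ ∀ x ∈ c.closedUnitBall, ∀ w, c.p x (c.τ.symm x w) ≤ M * ‖w‖ := by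
  -- Compactness bounds the fibre norm on vectors of norm at most one over the closed unit ball;
  -- homogeneity gives the rest.
  have hK : IsCompact (c.closedUnitBall ×ˢ Metric.closedBall (0 : Fin c.τ.rank → 𝕜) 1) :=
    c.isCompact_closedUnitBall.prod (isCompact_closedBall _ _)
  obtain ⟨M, hM⟩ := hK.bddAbove_image (c.p_cont.mono
    (prod_mono c.closedUnitBall_subset (subset_univ _)))
  refine ⟨max M 0, le_max_right _ _, fun x hx w => ?_⟩
  by_cases hw : w = 0
  · simp [hw]
  have hw' : ‖w‖ ≠ 0 := norm_ne_zero_iff.2 hw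
  have h1 : c.p x (c.τ.symm x ((‖w‖⁻¹ : 𝕜) • w)) ≤ M := by
    refine hM ⟨(x, (‖w‖⁻¹ : 𝕜) • w), ⟨hx, ?_⟩, rfl⟩
    simp [norm_smul, hw']
  have h2 : c.p x (c.τ.symm x w) = ‖w‖ * c.p x (c.τ.symm x ((‖w‖⁻¹ : 𝕜) • w)) := by
    rw [map_smul, map_smul_eq_mul]
    simp [hw']
  rw [h2, mul_comm]
  exact mul_le_mul_of_nonneg_right (h1.trans (le_max_left _ _)) (norm_nonneg _)

open scoped Classical in
theorem StdNormedChart.localRep_of_mem (c : StdNormedChart 𝕜 E) {S : Set X} (ξ : ∀ x : S, E x)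
    {v : EucR c.dim} (h : c.φ.symm v ∈ S) :
    c.localRep ξ v = c.τ.coord (c.φ.symm v) (ξ ⟨c.φ.symm v, h⟩) := dif_pos h

/-- The coordinate expressions of sections of class `C^k` are of class `C^k` in the interior. -/
theorem StdNormedChart.contDiffAt_localRep (c : StdNormedChart 𝕜 E) (hX : HasAtlas.Covers X)
    (hE : ∀ x, ∃ τ ∈ HasTrivs.trivs (𝕜 := 𝕜) (E := E), x ∈ τ.base) {k : ℕ∞} {S : Set X}
    (ξ : Sections 𝕜 E k S) {x : X} (hx : x ∈ c.φ.source) (hS : S ∈ 𝓝 x) :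
    ContDiffAt ℝ k (c.localRep ξ.1) (c.φ x) := by
  obtain ⟨B, hB, hxB, η, hη, e⟩ := ξ.2 x (mem_of_mem_nhds hS)
  have h1 : CkAt k (fun z => c.τ.coord z (η z)) x :=
    ((ckSectionOn_iff hB).1 hη x hxB).ckAt_coord (hE x) c.smooth_τ (by rw [c.base_τ]; exact hx)
  refine (h1.contDiffAt hX c.smooth_φ hx).congr_of_eventuallyEq ?_
  have hc : ContinuousAt c.φ.symm (c.φ x) := c.φ.continuousAt_symm (c.φ.map_source hx)
  have hn : B ∩ S ∈ 𝓝 (c.φ.symm (c.φ x)) := by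
    rw [c.φ.left_inv hx]; exact Filter.inter_mem (hB.mem_nhds hxB) hS
  filter_upwards [hc hn] with v hv
  rw [c.localRep_of_mem ξ.1 hv.2, Function.comp_apply, e ⟨_, hv.2⟩ hv.1]

end StdCharts

/-! ### Standard normed charts of a fibre product, adapted to the first projection -/

section AdaptedStdCharts

variable {A B C : Type*} [TopologicalSpace A] [HasAtlas A] [TopologicalSpace B] [HasAtlas B]
variable [TopologicalSpace C] [HasAtlas C] {f : A → C} {g : B → C} {𝕜 : Type*} [RCLike 𝕜]
variable {E : A → Type*} [∀ x, AddCommGroup (E x)] [∀ x, Module 𝕜 (E x)] [HasTrivs 𝕜 E]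

/-- The data of a standard normed chart of a fibre product `A ×_{f,g} B`, in which `pr_A` is given
by a standard normed chart of `A` and the fibres by fibre coordinates of the submersion `g`. -/
structure AdaptedData (c : StdNormedChart 𝕜 E) (f : A → C) (g : B → C) (hf : Continuous f) where
  m : ℕ
  n : ℕ
  e : SubmersionChart g m n
  z₀ : FiberProduct f g
  center : EucR (c.dim + m)
  radius : ℝ
  radius_pos : 0 < radius
  ball_subset : Metric.ball center radius ⊆ ((FiberProduct.adaptedChart hf c.φ e z₀).trans
    (FiberProduct.prodEquiv c.dim m).toHomeomorph.toOpenPartialHomeomorph).target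

namespace AdaptedData

variable {c : StdNormedChart 𝕜 E} {hf : Continuous f} (D : AdaptedData c f g hf)

/-- The underlying product chart `(a, b) ↦ (φ a, u b)`. -/
noncomputable abbrev chart : OpenPartialHomeomorph (FiberProduct f g) (EucR c.dim × EucR D.m) :=
  FiberProduct.adaptedChart hf c.φ D.e D.z₀

/-- The change of coordinates from the product chart to the standard chart. -/
noncomputable def change (v : EucR c.dim × EucR D.m) : EucR (c.dim + D.m) :=
  (OpenPartialHomeomorph.univBall D.center D.radius).symm (FiberProduct.prodEquiv c.dim D.m v)

/-- The standard chart. -/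
noncomputable def stdChart : OpenPartialHomeomorph (FiberProduct f g) (EucR (c.dim + D.m)) :=
  rescale (D.chart.trans (FiberProduct.prodEquiv c.dim D.m).toHomeomorph.toOpenPartialHomeomorph)
    D.center D.radius

theorem stdChart_source_subset : D.stdChart.source ⊆ D.chart.source := fun _ h => h.1.1

theorem mem_ball_of_mem_source {z : FiberProduct f g} (hz : z ∈ D.stdChart.source) :
    FiberProduct.prodEquiv c.dim D.m (D.chart z) ∈ Metric.ball D.center D.radius := by
  have h := hz.2
  have h2 : (OpenPartialHomeomorph.univBall D.center D.radius).symm.source =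
    Metric.ball D.center D.radius := OpenPartialHomeomorph.univBall_target _ D.radius_pos
  rw [h2] at h
  exact h

/-- The inverse of `univBall` is smooth only inside the ball, so the statement is confined to the
image of the domain of the standard chart, which lands there. -/
theorem contDiffOn_change : ContDiffOn ℝ ∞ D.change (D.chart '' D.stdChart.source) := by
  refine OpenPartialHomeomorph.contDiffOn_univBall_symm.comp
    (FiberProduct.prodEquiv c.dim D.m).contDiff.contDiffOn ?_
  rintro _ ⟨z, hz, rfl⟩
  exact D.mem_ball_of_mem_source hz

theorem isSmoothChart [IsDiffManifold A] [IsDiffManifold B] [IsDiffManifold C]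
    (hfs : SmoothMap f) : IsSmoothChart D.stdChart := by
  refine IsSmoothChart.rescale (IsSmoothChart.trans ?_ ?_ ?_) _ D.radius_pos
  · exact FiberProduct.isSmoothChart_adaptedChart hf D.e D.z₀ (IsDiffManifold.covers A)
      (IsDiffManifold.covers B) (IsDiffManifold.covers C) hfs c.smooth_φ
  · exact (FiberProduct.prodEquiv c.dim D.m).contDiff.contDiffOn
  · exact (FiberProduct.prodEquiv c.dim D.m).symm.contDiff.contDiffOn

/-- The standard normed chart. -/
noncomputable def toStd [IsDiffManifold A] [IsDiffManifold B] [IsDiffManifold C]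
    (hfs : SmoothMap f) : StdNormedChart 𝕜 (PullFst f g E) :=
  StdNormedChart.ofTriv D.stdChart (D.isSmoothChart hfs) (rescale_target _ D.radius_pos D.ball_subset)
    (c.τ.pullFst f g) (c.smooth_τ.pullFst (IsDiffManifold.covers A) (IsDiffManifold.covers B))
    fun z hz => by
      change z.1.1 ∈ c.τ.base
      rw [c.base_τ]
      exact (D.stdChart_source_subset hz).1

theorem exists_mem_unitBall [IsDiffManifold A] [IsDiffManifold B] [IsDiffManifold C]
    (hfs : SmoothMap f) (hg : SubmersiveMap g) (c : StdNormedChart 𝕜 E) {z : FiberProduct f g}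
    (hz : z.1.1 ∈ c.φ.source) :
    ∃ D : AdaptedData c f g hfs.1, z ∈ (D.toStd hfs).unitBall := by
  obtain ⟨m, n, e, hze⟩ := hg.exists_submersionChart z.1.2
  let Φ := (FiberProduct.adaptedChart hfs.1 c.φ e z).trans
    (FiberProduct.prodEquiv c.dim m).toHomeomorph.toOpenPartialHomeomorph
  have hzΦ : z ∈ Φ.source := ⟨⟨hz, hze⟩, by simp⟩
  obtain ⟨r, hr, hball⟩ := Metric.isOpen_iff.1 Φ.open_target _ (Φ.map_source hzΦ)
  have hmem := mem_rescale_source Φ hr hzΦ rfl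
  refine ⟨⟨m, n, e, z, Φ z, r, hr, hball⟩, hmem.1, ?_⟩
  change (rescale Φ (Φ z) r) z ∈ Metric.ball 0 1
  rw [hmem.2]
  exact Metric.mem_ball_self one_pos

end AdaptedData

end AdaptedStdCharts

/-! ### Integrals of compactly supported functions depending on parameters -/

section ParametricIntegral

universe w
variable {V W : Type} [NormedAddCommGroup V] [NormedSpace ℝ V] [FiniteDimensional ℝ V]
variable [NormedAddCommGroup W] [NormedSpace ℝ W] [FiniteDimensional ℝ W] [MeasurableSpace W]
variable [BorelSpace W] {μ : Measure W} [IsLocallyFiniteMeasure μ]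

theorem integrable_slice {H : Type*} [NormedAddCommGroup H] {g : V × W → H} (hg : Continuous g)
    (hc : HasCompactSupport g) (v : V) : Integrable (fun u => g (v, u)) μ := by
  refine Continuous.integrable_of_hasCompactSupport (by fun_prop) ?_
  refine HasCompactSupport.of_support_subset_isCompact (hc.isCompact.image continuous_snd) ?_
  intro u hu
  exact ⟨(v, u), subset_tsupport _ hu, rfl⟩

/-- Differentiation under the integral is justified by a single dominating function: a bound for the
derivative, times the indicator of the projection to `W` of the compact support. -/
theorem hasFDerivAt_integral_slice {H : Type*} [NormedAddCommGroup H] [NormedSpace ℝ H]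
    {g : V × W → H} (hg : ContDiff ℝ 1 g) (hc : HasCompactSupport g) (v : V) :
    HasFDerivAt (fun v => ∫ u, g (v, u) ∂μ)
      (∫ u, (fderiv ℝ g (v, u)).comp (ContinuousLinearMap.inl ℝ V W) ∂μ) v := by
  have hcont : Continuous fun p : V × W => (fderiv ℝ g p).comp (ContinuousLinearMap.inl ℝ V W) :=
    (hg.continuous_fderiv one_ne_zero).clm_comp continuous_const
  have hcs : HasCompactSupport fun p : V × W =>
      (fderiv ℝ g p).comp (ContinuousLinearMap.inl ℝ V W) :=
    (hc.fderiv ℝ).comp_left (g := fun T : V × W →L[ℝ] H => T.comp (ContinuousLinearMap.inl ℝ V W))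
      (by simp)
  obtain ⟨C, hC⟩ := hcont.bounded_above_of_compact_support hcs
  let K : Set W := Prod.snd '' tsupport g
  have hK : IsCompact K := hc.isCompact.image continuous_snd
  refine hasFDerivAt_integral_of_dominated_of_fderiv_le (s := univ)
    (F' := fun v u => (fderiv ℝ g (v, u)).comp (ContinuousLinearMap.inl ℝ V W))
    (bound := K.indicator fun _ => C) Filter.univ_mem
    (Filter.Eventually.of_forall fun x => (integrable_slice hg.continuous hc x).aestronglyMeasurable)
    (integrable_slice hg.continuous hc v) (integrable_slice hcont hcs v).aestronglyMeasurable
    ?_ ?_ ?_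
  · refine Filter.Eventually.of_forall fun u x _ => ?_
    by_cases hu : u ∈ K
    · simpa [hu] using hC (x, u)
    · have : fderiv ℝ g (x, u) = 0 := by
        refine image_eq_zero_of_notMem_tsupport fun h => hu ⟨(x, u), ?_, rfl⟩
        exact tsupport_fderiv_subset ℝ h
      simp [hu, this]
  · exact (integrable_indicator_iff hK.measurableSet).2 (integrableOn_const hK.measure_lt_top.ne)
  · refine Filter.Eventually.of_forall fun u x _ => ?_
    exact ((hg.differentiable one_ne_zero (x, u)).hasFDerivAt).comp x
      (hasFDerivAt_prodMk_left x u)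

theorem continuous_integral_slice {H : Type*} [NormedAddCommGroup H] [NormedSpace ℝ H]
    {g : V × W → H} (hg : Continuous g) (hc : HasCompactSupport g) :
    Continuous fun v => ∫ u, g (v, u) ∂μ := by
  have hK : IsCompact (Prod.snd '' tsupport g) := hc.isCompact.image continuous_snd
  have h := continuous_parametric_integral_of_continuous (μ := μ)
    (f := fun (v : V) (u : W) => g (v, u)) (by exact hg) hK
  refine h.congr fun v => setIntegral_eq_integral_of_forall_compl_eq_zero fun u hu => ?_
  exact image_eq_zero_of_notMem_tsupport fun h => hu ⟨(v, u), h, rfl⟩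

/-- The derivative of the integral is the integral of the partial derivative along `V`, and the
induction is applied to the latter. It takes values in `V →L[ℝ] H`, so the induction runs over all
`H`; as `V` lies in `Type`, the universe of `H` is preserved. -/
theorem contDiff_integral_slice_nat (r : ℕ) : ∀ {H : Type w} [NormedAddCommGroup H]
    [NormedSpace ℝ H] {g : V × W → H}, ContDiff ℝ r g → HasCompactSupport g →
    ContDiff ℝ r (fun v => ∫ u, g (v, u) ∂μ) ∧
      ∀ v, ‖iteratedFDeriv ℝ r (fun v => ∫ u, g (v, u) ∂μ) v‖ ≤
        ∫ u, ‖iteratedFDeriv ℝ r g (v, u)‖ ∂μ := by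
  induction r with
  | zero =>
    intro H _ _ g hg hc
    refine ⟨contDiff_zero.2 (continuous_integral_slice (contDiff_zero.1 hg) hc), fun v => ?_⟩
    simpa using norm_integral_le_integral_norm (μ := μ) (fun u => g (v, u))
  | succ r ih =>
    intro H _ _ g hg hc
    have hg1 : ContDiff ℝ 1 g := hg.of_le (by exact_mod_cast Nat.le_add_left 1 r)
    -- Restriction of a derivative to the directions in `V` is a linear contraction, so the norm
    -- estimate passes through the induction without a constant.
    let J : (V × W →L[ℝ] H) →L[ℝ] (V →L[ℝ] H) :=
      (ContinuousLinearMap.compL ℝ V (V × W) H).flip (ContinuousLinearMap.inl ℝ V W)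
    have hJ : ‖J‖ ≤ 1 := by
      refine ContinuousLinearMap.opNorm_le_bound _ zero_le_one fun T => ?_
      refine (ContinuousLinearMap.opNorm_comp_le T _).trans ?_
      rw [one_mul]
      exact mul_le_of_le_one_right (norm_nonneg _) (ContinuousLinearMap.norm_inl_le_one ℝ V W)
    let g1 : V × W → (V →L[ℝ] H) := fun p => J (fderiv ℝ g p)
    have hf : ContDiff ℝ r (fderiv ℝ g) := hg.fderiv_right (by norm_cast)
    have hcg1 : ContDiff ℝ r g1 := J.contDiff.comp hf
    have hcs : HasCompactSupport g1 := (hc.fderiv ℝ).comp_left (map_zero J)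
    obtain ⟨h1, h2⟩ := ih hcg1 hcs
    have hd : ∀ v, HasFDerivAt (fun v => ∫ u, g (v, u) ∂μ) (∫ u, g1 (v, u) ∂μ) v :=
      fun v => hasFDerivAt_integral_slice hg1 hc v
    have hfd : fderiv ℝ (fun v => ∫ u, g (v, u) ∂μ) = fun v => ∫ u, g1 (v, u) ∂μ :=
      funext fun v => (hd v).fderiv
    constructor
    · have := (contDiff_succ_iff_fderiv (𝕜 := ℝ) (n := r)
        (f := fun v => ∫ u, g (v, u) ∂μ)).2 ⟨fun v => (hd v).differentiableAt, by simp,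
          by rw [hfd]; exact h1⟩
      exact_mod_cast this
    · intro v
      rw [← norm_iteratedFDeriv_fderiv, hfd]
      refine (h2 v).trans (integral_mono ?_ ?_ fun u => ?_)
      · refine (integrable_slice (g := iteratedFDeriv ℝ r g1)
          (hcg1.continuous_iteratedFDeriv le_rfl) ?_ v).norm
        exact hcs.mono' (support_iteratedFDeriv_subset r)
      · refine (integrable_slice (g := iteratedFDeriv ℝ (r + 1) g)
          (hg.continuous_iteratedFDeriv le_rfl) ?_ v).norm
        exact hc.mono' (support_iteratedFDeriv_subset (r + 1))
      · dsimp only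
        rw [← norm_iteratedFDeriv_fderiv]
        refine (J.norm_iteratedFDeriv_comp_left hf.contDiffAt le_rfl).trans ?_
        exact mul_le_of_le_one_left (norm_nonneg _) hJ

theorem contDiff_integral_slice {H : Type*} [NormedAddCommGroup H] [NormedSpace ℝ H] {k : ℕ∞}
    {g : V × W → H} (hg : ContDiff ℝ k g) (hc : HasCompactSupport g) :
    ContDiff ℝ k (fun v => ∫ u, g (v, u) ∂μ) :=
  contDiff_iff_forall_nat_le.2 fun r hr =>
    (contDiff_integral_slice_nat r (hg.of_le (by exact_mod_cast hr)) hc).1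

/-- The derivatives of an integral are bounded by the derivatives of the integrand. -/
theorem norm_iteratedFDeriv_integral_slice_le {H : Type*} [NormedAddCommGroup H] [NormedSpace ℝ H]
    {r : ℕ} {g : V × W → H} (hg : ContDiff ℝ r g) {K : Set (V × W)} (hK : IsCompact K)
    (hgK : tsupport g ⊆ K) {C : ℝ} (hC : 0 ≤ C) {v : V}
    (h : ∀ u, (v, u) ∈ K → ‖iteratedFDeriv ℝ r g (v, u)‖ ≤ C) :
    ‖iteratedFDeriv ℝ r (fun v => ∫ u, g (v, u) ∂μ) v‖ ≤ μ.real (Prod.snd '' K) * C := by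
  have hc : HasCompactSupport g := hK.of_isClosed_subset (isClosed_tsupport g) hgK
  have hK' : IsCompact (Prod.snd '' K) := hK.image continuous_snd
  refine ((contDiff_integral_slice_nat r hg hc).2 v).trans ?_
  have h1 : ∫ u, ‖iteratedFDeriv ℝ r g (v, u)‖ ∂μ ≤
      ∫ u, (Prod.snd '' K).indicator (fun _ => C) u ∂μ := by
    refine integral_mono ?_ ?_ fun u => ?_
    · refine (integrable_slice (g := iteratedFDeriv ℝ r g)
        (hg.continuous_iteratedFDeriv le_rfl) ?_ v).norm
      exact hc.mono' (support_iteratedFDeriv_subset r)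
    · exact (integrable_indicator_iff hK'.measurableSet).2 (integrableOn_const hK'.measure_lt_top.ne)
    · dsimp only
      -- Only points of `K` over the given `v` matter, since the derivative vanishes off `K`. Later
      -- `v` is a parameter from `V`, and the bound is available only over `V`.
      by_cases hu : (v, u) ∈ K
      · rw [indicator_of_mem (show u ∈ Prod.snd '' K from ⟨(v, u), hu, rfl⟩)]
        exact h u hu
      · have h0 : iteratedFDeriv ℝ r g (v, u) = 0 := by
          by_contra h0
          exact hu (hgK (support_iteratedFDeriv_subset r h0))
        rw [h0, norm_zero]
        exact indicator_nonneg (fun _ _ => hC) _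
  refine h1.trans_eq ?_
  rw [integral_indicator hK'.measurableSet, setIntegral_const, smul_eq_mul]

end ParametricIntegral

/-! ### Bounds for derivatives -/

section Bounds

/-- The norm of a multilinear map is bounded by its values on basis vectors. -/
theorem norm_multilinear_le_of_basis {N j : ℕ} {F : Type*} [NormedAddCommGroup F]
    [NormedSpace ℝ F] (T : ContinuousMultilinearMap ℝ (fun _ : Fin j => EucR N) F) {t : ℝ}
    (h : ∀ i : Fin j → Fin N, ‖T fun l => EuclideanSpace.single (i l) (1 : ℝ)‖ ≤ t) :
    ‖T‖ ≤ Fintype.card (Fin j → Fin N) * t := by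
  -- If `N = 0 < j` there are no index tuples and `t` may be negative, but then the cardinality
  -- factor is zero.
  have h0 : 0 ≤ Fintype.card (Fin j → Fin N) * t := by
    rcases isEmpty_or_nonempty (Fin j → Fin N) with hE | ⟨⟨i⟩⟩
    · simp
    · exact mul_nonneg (by positivity) ((norm_nonneg _).trans (h i))
  refine ContinuousMultilinearMap.opNorm_le_bound h0 fun x => ?_
  have hx : x = fun l => ∑ a : Fin N, x l a • EuclideanSpace.single a (1 : ℝ) := by
    funext l
    ext b
    simp [Finset.sum_apply, Pi.single_apply]
  have h1 : T x = ∑ i : Fin j → Fin N, (∏ l, x l (i l)) •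
      T fun l => EuclideanSpace.single (i l) (1 : ℝ) := by
    conv_lhs => rw [hx]
    rw [T.map_sum]
    exact Finset.sum_congr rfl fun i _ => T.map_smul_univ _ _
  rw [h1]
  refine (norm_sum_le _ _).trans ?_
  refine (Finset.sum_le_card_nsmul _ _ (t * ∏ l, ‖x l‖) fun i _ => ?_).trans_eq ?_
  · rw [norm_smul, mul_comm, Real.norm_eq_abs, Finset.abs_prod]
    refine mul_le_mul (h i) ?_ (by positivity) ((norm_nonneg _).trans (h i))
    exact Finset.prod_le_prod (fun _ _ => abs_nonneg _) fun l _ => by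
      simpa using PiLp.norm_apply_le (x l) (i l)
  · rw [nsmul_eq_mul, Finset.card_univ, mul_assoc]

/-- Multiplication by a compactly supported smooth function, after a smooth substitution, is
bounded with respect to `C^r`-norms. -/
theorem exists_bound_smul_comp {V W : Type*} [NormedAddCommGroup V] [NormedSpace ℝ V]
    [NormedAddCommGroup W] [NormedSpace ℝ W] (H : Type*) [NormedAddCommGroup H] [NormedSpace ℝ H]
    {a : V → ℝ} (ha : ContDiff ℝ ∞ a) (hac : HasCompactSupport a) {O : Set V} (hO : IsOpen O)
    (haO : tsupport a ⊆ O) {ψ : V → W} (hψ : ContDiffOn ℝ ∞ ψ O) (r : ℕ) :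
    ∃ C : ℝ, 0 ≤ C ∧ ∀ (θ : W → H) (v : V) (t : ℝ), v ∈ tsupport a → ContDiffAt ℝ r θ (ψ v) →
      (∀ j ≤ r, ‖iteratedFDeriv ℝ j θ (ψ v)‖ ≤ t) → ∀ j ≤ r,
      ‖iteratedFDeriv ℝ j (fun v => a v • θ (ψ v)) v‖ ≤ C * t := by
  have hA : ∀ i : ℕ, ∃ M : ℝ, 0 ≤ M ∧ ∀ v ∈ tsupport a, ‖iteratedFDeriv ℝ i a v‖ ≤ M := by
    intro i
    obtain ⟨M, hM⟩ := hac.isCompact.exists_bound_of_continuousOn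
      (ha.continuous_iteratedFDeriv (m := i) (by exact_mod_cast le_top)).continuousOn
    exact ⟨max M 0, le_max_right _ _, fun v hv => (hM v hv).trans (le_max_left _ _)⟩
  have hΨ : ∀ i : ℕ, ∃ M : ℝ, 0 ≤ M ∧ ∀ v ∈ tsupport a, ‖iteratedFDeriv ℝ i ψ v‖ ≤ M := by
    intro i
    have h1 : ContinuousOn (iteratedFDeriv ℝ i ψ) O :=
      (hψ.continuousOn_iteratedFDerivWithin (m := i) (by exact_mod_cast le_top)
        hO.uniqueDiffOn).congr fun v hv => (iteratedFDerivWithin_of_isOpen i hO hv).symm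
    obtain ⟨M, hM⟩ := hac.isCompact.exists_bound_of_continuousOn (h1.mono haO)
    exact ⟨max M 0, le_max_right _ _, fun v hv => (hM v hv).trans (le_max_left _ _)⟩
  choose MA hMA0 hMA using hA
  choose MΨ hMΨ0 hMΨ using hΨ
  -- The estimate for derivatives of compositions wants the `i`-th derivative of `ψ` bounded by `D ^
  -- i` for `i ≥ 1`. Any `D ≥ 1` above all the bounds `MΨ i` will do.
  let D : ℝ := 1 + ∑ i ∈ Finset.range (r + 1), MΨ i
  have hD1 : 1 ≤ D := le_add_of_nonneg_right (Finset.sum_nonneg fun i _ => hMΨ0 i)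
  have hD : ∀ i ≤ r, 1 ≤ i → MΨ i ≤ D ^ i := by
    intro i hi h1
    have h2 : MΨ i ≤ D := by
      have := Finset.single_le_sum (f := MΨ) (fun i _ => hMΨ0 i)
        (Finset.mem_range.2 (Nat.lt_succ_of_le hi))
      simp only [D]; linarith
    exact h2.trans (le_self_pow₀ hD1 (by omega))
  let A : ℝ := ∑ i ∈ Finset.range (r + 1), MA i
  have hA0 : 0 ≤ A := Finset.sum_nonneg fun i _ => hMA0 i
  have hAi : ∀ i ≤ r, MA i ≤ A := fun i hi =>
    Finset.single_le_sum (f := MA) (fun i _ => hMA0 i) (Finset.mem_range.2 (Nat.lt_succ_of_le hi))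
  let B : ℝ := r.factorial * D ^ r
  have hB0 : 0 ≤ B := by positivity
  -- `B = r! D ^ r` comes from the composition estimate and `2 ^ r` from summing the binomial
  -- coefficients in Leibniz's rule. None of the constants involves `θ`.
  refine ⟨2 ^ r * (A * B), by positivity, fun θ v t hv hθ ht => ?_⟩
  have ht0 : 0 ≤ t := (norm_nonneg _).trans (ht 0 (Nat.zero_le _))
  -- The function `θ` is smooth only at one point, whereas the estimates are for derivatives within
  -- sets; so open neighbourhoods `T'` of `ψ v` and `S` of `v` are chosen, in which the two kinds of
  -- derivatives agree.
  obtain ⟨T, hTn, hT⟩ := (contDiffWithinAt_univ.2 hθ).contDiffOn le_rfl (by simp)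
  rw [insert_eq_of_mem (mem_univ _), nhdsWithin_univ] at hTn
  obtain ⟨T', hT'T, hT'o, hvT'⟩ := mem_nhds_iff.1 hTn
  have hθT : ContDiffOn ℝ r θ T' := (hT.2).mono (by simpa using hT'T)
  let S : Set V := O ∩ ψ ⁻¹' T'
  have hS : IsOpen S := hψ.continuousOn.isOpen_inter_preimage hO hT'o
  have hvS : v ∈ S := ⟨haO hv, hvT'⟩
  have hψS : ContDiffOn ℝ r ψ S := (hψ.mono inter_subset_left).of_le (by exact_mod_cast le_top)
  have hcomp : ContDiffOn ℝ r (θ ∘ ψ) S := hθT.comp hψS fun x hx => hx.2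
  have hcb : ∀ j ≤ r, ‖iteratedFDerivWithin ℝ j (θ ∘ ψ) S v‖ ≤ B * t := by
    intro j hj
    have h1 := norm_iteratedFDerivWithin_comp_le (C := t) (D := D) hθT hψS
      (n := j) (by exact_mod_cast hj) hT'o.uniqueDiffOn hS.uniqueDiffOn (fun x hx => hx.2) hvS
      (fun i hi => by
        rw [iteratedFDerivWithin_of_isOpen i hT'o hvT']; exact ht i (hi.trans hj))
      (fun i h1 hi => by
        rw [iteratedFDerivWithin_of_isOpen i hS hvS]
        exact (hMΨ i v hv).trans (hD i (hi.trans hj) h1))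
    refine h1.trans ?_
    have h2 : (j.factorial : ℝ) ≤ r.factorial := by exact_mod_cast Nat.factorial_le hj
    have h3 : D ^ j ≤ D ^ r := pow_le_pow_right₀ hD1 hj
    calc (j.factorial : ℝ) * t * D ^ j ≤ r.factorial * t * D ^ r := by gcongr
      _ = B * t := by simp only [B]; ring
  intro j hj
  rw [← iteratedFDerivWithin_of_isOpen j hS hvS]
  refine (norm_iteratedFDerivWithin_smul_le (g := θ ∘ ψ) (ha.contDiffOn.of_le
    (by exact_mod_cast le_top)) hcomp hS.uniqueDiffOn hvS (n := j) (by exact_mod_cast hj)).trans ?_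
  calc ∑ i ∈ Finset.range (j + 1), (j.choose i : ℝ) * ‖iteratedFDerivWithin ℝ i a S v‖ *
        ‖iteratedFDerivWithin ℝ (j - i) (θ ∘ ψ) S v‖
      ≤ ∑ i ∈ Finset.range (j + 1), (j.choose i : ℝ) * A * (B * t) := by
        refine Finset.sum_le_sum fun i hi => ?_
        have hi' : i ≤ r := (Nat.lt_succ_iff.1 (Finset.mem_range.1 hi)).trans hj
        gcongr
        · rw [iteratedFDerivWithin_of_isOpen i hS hvS]
          exact (hMA i v hv).trans (hAi i hi')
        · exact hcb _ ((Nat.sub_le _ _).trans hj)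
    _ = 2 ^ j * (A * B) * t := by
        rw [← Finset.sum_mul, ← Finset.sum_mul]
        have := Nat.sum_range_choose j
        have h2 : ∑ i ∈ Finset.range (j + 1), (j.choose i : ℝ) = 2 ^ j := by exact_mod_cast this
        rw [h2]; ring
    _ ≤ 2 ^ r * (A * B) * t := by
        gcongr
        norm_num

end Bounds

/-! ### Integration along the fibres of a submersion -/

section FibreIntegration

variable {Z Y : Type*} [TopologicalSpace Z] [HasAtlas Z] [TopologicalSpace Y] [HasAtlas Y]
variable {φ : Z → Y} {m n : ℕ}

theorem SubmersionChart.apply_symm (e : SubmersionChart φ m n) {y : Y} (hy : y ∈ e.d.source)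
    {u : EucR m} (hu : (u, e.d y) ∈ e.e.target) : φ (e.e.symm (u, e.d y)) = y := by
  have h3 := e.e.map_target hu
  refine e.d.injOn (e.mem_source _ h3) hy ?_
  rw [e.proj _ h3, e.e.right_inv hu]

theorem SubmersionChart.prod_eq (e : SubmersionChart φ m n) {y : Y} {z : Z} (hz : z ∈ e.e.source)
    (hzy : φ z = y) : ((e.e z).1, e.d y) = e.e z := by
  rw [← hzy, e.proj z hz]

/-- Fibre coordinates, as a homeomorphism. -/
noncomputable def SubmersionChart.fibreHomeomorph (e : SubmersionChart φ m n) {y : Y}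
    (hy : y ∈ e.d.source) :
    {u : EucR m | (u, e.d y) ∈ e.e.target} ≃ₜ {z : {z : Z // φ z = y} | z.1 ∈ e.e.source} where
  toFun u := ⟨⟨e.e.symm (u.1, e.d y), e.apply_symm hy u.2⟩, e.e.map_target u.2⟩
  invFun z := ⟨(e.e z.1.1).1, by
    change ((e.e z.1.1).1, e.d y) ∈ e.e.target
    rw [e.prod_eq z.2 z.1.2]; exact e.e.map_source z.2⟩
  left_inv u := Subtype.ext (by
    change (e.e (e.e.symm (u.1, e.d y))).1 = u.1
    rw [e.e.right_inv u.2])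
  right_inv z := Subtype.ext (Subtype.ext (by
    change e.e.symm ((e.e z.1.1).1, e.d y) = z.1.1
    rw [e.prod_eq z.2 z.1.2, e.e.left_inv z.2]))
  continuous_toFun := by
    refine Continuous.subtype_mk (Continuous.subtype_mk ?_ _) _
    exact e.e.continuousOn_symm.comp_continuous (by fun_prop) fun u => u.2
  continuous_invFun := by
    refine Continuous.subtype_mk (continuous_fst.comp ?_) _
    exact e.e.continuousOn.comp_continuous (by fun_prop) fun z => z.2

variable [IsDiffManifold Z] [MeasurableSpace Z] [BorelSpace Z]

theorem VerticalVolumeDensity.continuousOn_comp (δ : VerticalVolumeDensity φ)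
    (e : SubmersionChart φ m n) : ContinuousOn (δ.comp e) e.e.source := fun _ hz =>
  (((ckOn_iff_ckAt e.e.open_source).1 (δ.smooth e) _ hz).continuousAt
    (IsDiffManifold.covers Z)).continuousWithinAt

/-- The definition of `IsMeasure` speaks of measures of sets. Writing the restricted measure as the
image of Lebesgue measure with a density allows the transformation of integrals as well. -/
theorem VerticalVolumeDensity.IsMeasure.restrict_eq {δ : VerticalVolumeDensity φ}
    {μ : ∀ y, Measure {z : Z // φ z = y}} (hμ : δ.IsMeasure μ) (e : SubmersionChart φ m n) {y : Y}
    (hy : y ∈ e.d.source) :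
    (μ y).restrict {z | z.1 ∈ e.e.source} =
      ((volume.comap (Subtype.val : {u : EucR m | (u, e.d y) ∈ e.e.target} → EucR m)).withDensity
        fun u => ENNReal.ofReal (δ.comp e (e.e.symm (u.1, e.d y)))).map
        fun u => (e.fibreHomeomorph hy u).1 := by
  have hS0 : MeasurableSet {z : {z : Z // φ z = y} | z.1 ∈ e.e.source} :=
    (e.e.open_source.preimage continuous_subtype_val).measurableSet
  have hT : MeasurableSet {u : EucR m | (u, e.d y) ∈ e.e.target} :=
    (e.e.open_target.preimage (by fun_prop : Continuous fun u : EucR m => (u, e.d y))).measurableSet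
  have hj : Measurable fun u => (e.fibreHomeomorph hy u).1 :=
    (continuous_subtype_val.comp (e.fibreHomeomorph hy).continuous).measurable
  ext S hS
  rw [Measure.restrict_apply hS, Measure.map_apply hj hS, withDensity_apply _ (hj hS),
    setLIntegral_subtype hT _ (fun u => ENNReal.ofReal (δ.comp e (e.e.symm (u, e.d y)))),
    hμ m n e y _ (hS.inter hS0) fun z hz => hz.2]
  congr 2
  ext u
  constructor
  · rintro ⟨z, ⟨hzS, hz⟩, rfl⟩
    refine ⟨(e.fibreHomeomorph hy).symm ⟨z, hz⟩, ?_, rfl⟩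
    simpa using hzS
  · rintro ⟨u, hu, rfl⟩
    refine ⟨_, ⟨hu, (e.fibreHomeomorph hy u).2⟩, ?_⟩
    exact congrArg Subtype.val ((e.fibreHomeomorph hy).symm_apply_apply u)

/-- Integration over a fibre in fibre coordinates. -/
theorem VerticalVolumeDensity.IsMeasure.integral_eq {δ : VerticalVolumeDensity φ}
    {μ : ∀ y, Measure {z : Z // φ z = y}} (hμ : δ.IsMeasure μ) (e : SubmersionChart φ m n) {y : Y}
    (hy : y ∈ e.d.source) {H : Type*} [NormedAddCommGroup H] [NormedSpace ℝ H]
    (w : {z : Z // φ z = y} → H) (hw : ∀ z, z.1 ∉ e.e.source → w z = 0) (w' : EucR m → H)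
    (hw' : ∀ z, z.1 ∈ e.e.source → w z = w' (e.e z.1).1) :
    ∫ z, w z ∂μ y = ∫ u in {u | (u, e.d y) ∈ e.e.target},
      δ.comp e (e.e.symm (u, e.d y)) • w' u := by
  have hT : MeasurableSet {u : EucR m | (u, e.d y) ∈ e.e.target} :=
    (e.e.open_target.preimage (by fun_prop : Continuous fun u : EucR m => (u, e.d y))).measurableSet
  have hS0 : MeasurableSet {z : {z : Z // φ z = y} | z.1 ∈ e.e.source} :=
    (e.e.open_source.preimage continuous_subtype_val).measurableSet
  have hj : MeasurableEmbedding fun u => (e.fibreHomeomorph hy u).1 :=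
    (MeasurableEmbedding.subtype_coe hS0).comp (e.fibreHomeomorph hy).measurableEmbedding
  have hδ : Continuous fun u : {u : EucR m | (u, e.d y) ∈ e.e.target} =>
      δ.comp e (e.e.symm (u.1, e.d y)) := by
    refine (δ.continuousOn_comp e).comp_continuous ?_ fun u => e.e.map_target u.2
    exact e.e.continuousOn_symm.comp_continuous (by fun_prop) fun u => u.2
  have hδ' : Measurable fun u : {u : EucR m | (u, e.d y) ∈ e.e.target} =>
      ENNReal.ofReal (δ.comp e (e.e.symm (u.1, e.d y))) :=
    ENNReal.measurable_ofReal.comp hδ.measurable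
  rw [← setIntegral_eq_integral_of_forall_compl_eq_zero (μ := μ y) (f := w)
    (s := {z : {z : Z // φ z = y} | z.1 ∈ e.e.source}) fun z hz => hw z hz, hμ.restrict_eq e hy, hj.integral_map,
    integral_withDensity_eq_integral_toReal_smul hδ'
      (by simp),
    ← integral_subtype_comap hT]
  refine integral_congr_ae (Filter.Eventually.of_forall fun u => ?_)
  have h1 : w (e.fibreHomeomorph hy u).1 = w' u.1 := by
    rw [hw' _ (e.fibreHomeomorph hy u).2]
    exact congrArg w' (congrArg Subtype.val ((e.fibreHomeomorph hy).symm_apply_apply u))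
  dsimp only
  rw [h1, ENNReal.toReal_ofReal (δ.pos e _ (e.e.map_target u.2)).le]

end FibreIntegration

/-- A compactly supported function of class `C^k` in the domain of a chart, extended by zero in
coordinates. -/
theorem contDiff_indicator_chart {X : Type*} [TopologicalSpace X] [HasAtlas X]
    (hX : HasAtlas.Covers X) {F H : Type*} [NormedAddCommGroup F] [NormedSpace ℝ F]
    [NormedAddCommGroup H] [NormedSpace ℝ H] {k : ℕ∞} {φ : OpenPartialHomeomorph X F}
    (hφ : IsSmoothChart φ) {w : X → H} (hw : ∀ x ∈ φ.source, CkAt k w x) {K : Set X}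
    (hK : IsCompact K) (hKφ : K ⊆ φ.source) (hwK : ∀ x ∈ φ.source, x ∉ K → w x = 0) :
    ContDiff ℝ k (φ.target.indicator fun v => w (φ.symm v)) ∧
      tsupport (φ.target.indicator fun v => w (φ.symm v)) ⊆ φ '' K := by
  have hK' : IsCompact (φ '' K) := hK.image_of_continuousOn (φ.continuousOn.mono hKφ)
  have h0 : ∀ v ∉ φ '' K, φ.target.indicator (fun v => w (φ.symm v)) v = 0 := by
    intro v hv
    by_cases hvt : v ∈ φ.target
    · rw [indicator_of_mem hvt]
      exact hwK _ (φ.map_target hvt) fun h => hv ⟨_, h, φ.right_inv hvt⟩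
    · exact indicator_of_notMem hvt _
  refine ⟨contDiff_iff_contDiffAt.2 fun v => ?_,
    closure_minimal (fun v hv => by by_contra h; exact hv (h0 v h)) hK'.isClosed⟩
  by_cases hvt : v ∈ φ.target
  · have h1 := (hw _ (φ.map_target hvt)).contDiffAt hX hφ (φ.map_target hvt)
    rw [φ.right_inv hvt] at h1
    refine h1.congr_of_eventuallyEq ?_
    filter_upwards [φ.open_target.mem_nhds hvt] with v' hv'
    rw [indicator_of_mem hv']; rfl
  · refine (contDiffAt_const (c := (0 : H))).congr_of_eventuallyEq ?_
    have hv : v ∉ φ '' K := by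
      rintro ⟨x, hx, rfl⟩
      exact hvt (φ.map_source (hKφ hx))
    filter_upwards [hK'.isClosed.isOpen_compl.mem_nhds hv] with v' hv' using h0 v' hv'

/-! ### Fibre integrals in adapted charts -/

section AdaptedIntegration

variable {A B C : Type*} [TopologicalSpace A] [HasAtlas A] [TopologicalSpace B] [HasAtlas B]
variable [TopologicalSpace C] [HasAtlas C] {f : A → C} {g : B → C} {𝕜 : Type*} [RCLike 𝕜]
variable {E : A → Type*} [∀ x, AddCommGroup (E x)] [∀ x, Module 𝕜 (E x)] [HasTrivs 𝕜 E]
variable [IsDiffManifold A] [IsDiffManifold B] [IsDiffManifold C]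
variable {c : StdNormedChart 𝕜 E}

namespace AdaptedData

variable {hf : Continuous f} (D : AdaptedData c f g hf)

/-- The integral over a fibre of a function supported in the domain of an adapted chart. -/
theorem integral_eq [MeasurableSpace B] [BorelSpace B] {δ : VerticalVolumeDensity g}
    {μ : ∀ y, Measure {z : B // g z = y}} (hμ : δ.IsMeasure μ) {H : Type*} [NormedAddCommGroup H]
    [NormedSpace ℝ H] (w : FiberProduct f g → H) (hw : ∀ z, z ∉ D.chart.source → w z = 0) {y : A}
    (hy : y ∈ c.φ.source) :
    ∫ h : {b : B // g b = f y}, w (FiberProduct.mk' y h.1 h.2.symm) ∂μ (f y) =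
      ∫ u, D.chart.target.indicator
        (fun v => δ.comp D.e (D.chart.symm v).1.2 • w (D.chart.symm v)) (c.φ y, u) := by
  by_cases hd : f y ∈ D.e.d.source
  · have hmem : ∀ u, (c.φ y, u) ∈ D.chart.target ↔ (u, D.e.d (f y)) ∈ D.e.e.target := by
      intro u
      rw [FiberProduct.mem_adaptedChart_target]
      simp [c.φ.left_inv hy, c.φ.map_source hy, hd]
    have hT : MeasurableSet {u : EucR D.m | (u, D.e.d (f y)) ∈ D.e.e.target} :=
      (D.e.e.open_target.preimage
        (by fun_prop : Continuous fun u : EucR D.m => (u, D.e.d (f y)))).measurableSet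
    rw [hμ.integral_eq D.e hd (fun h => w (FiberProduct.mk' y h.1 h.2.symm))
      (fun h hh => hw _ fun hs => hh hs.2) (fun u => w (D.chart.symm (c.φ y, u))),
      ← integral_indicator hT]
    · refine integral_congr_ae (Filter.Eventually.of_forall fun u => ?_)
      by_cases hu : (u, D.e.d (f y)) ∈ D.e.e.target
      · have hu' := (hmem u).2 hu
        refine (indicator_of_mem (s := {u | (u, D.e.d (f y)) ∈ D.e.e.target}) hu _).trans ?_
        refine Eq.trans ?_ (indicator_of_mem hu' _).symm
        rw [FiberProduct.adaptedChart_symm_apply hf c.φ D.e D.z₀ hu']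
        simp only [c.φ.left_inv hy]
      · have hu' := fun h => hu ((hmem u).1 h)
        refine (indicator_of_notMem (s := {u | (u, D.e.d (f y)) ∈ D.e.e.target}) hu _).trans ?_
        exact (indicator_of_notMem hu' _).symm
    · intro h hh
      have hz : FiberProduct.mk' y h.1 h.2.symm ∈ D.chart.source := ⟨hy, hh⟩
      exact congrArg w (D.chart.left_inv hz).symm
  -- When `f y` is outside the base chart, the fibre misses the adapted chart and the slice of the
  -- target is empty, so both integrals vanish.
  · have h1 : ∀ h : {b : B // g b = f y}, w (FiberProduct.mk' y h.1 h.2.symm) = 0 := by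
      intro h
      refine hw _ fun hs => hd ?_
      rw [← h.2]
      exact D.e.mem_source _ hs.2
    have h2 : ∀ u, (c.φ y, u) ∉ D.chart.target := by
      intro u hu
      rw [FiberProduct.mem_adaptedChart_target] at hu
      simp [c.φ.left_inv hy, hd] at hu
    simp [h1, h2]

/-- A function on the fibre product, times the density, in the coordinates of an adapted chart. -/
noncomputable def weight (δ : VerticalVolumeDensity g) (χ : FiberProduct f g → ℝ) :
    EucR c.dim × EucR D.m → ℝ :=
  D.chart.target.indicator fun v => δ.comp D.e (D.chart.symm v).1.2 * χ (D.chart.symm v)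

theorem ckAt_density (δ : VerticalVolumeDensity g) {z : FiberProduct f g}
    (hz : z ∈ D.chart.source) : CkAt ⊤ (fun z : FiberProduct f g => δ.comp D.e z.1.2) z :=
  CkAt.comp_smoothMap (q := fun z : FiberProduct f g => z.1.2)
    ((ckOn_iff_ckAt D.e.e.open_source).1 (δ.smooth D.e) _ hz.2) (IsDiffManifold.covers B)
    (FiberProduct.smoothMap_snd (IsDiffManifold.covers A))

theorem contDiff_weight (hfs : SmoothMap f) (hg : SubmersiveMap g) (δ : VerticalVolumeDensity g)
    {χ : FiberProduct f g → ℝ} (hχ : ∀ z, CkAt ⊤ χ z) (hχc : HasCompactSupport χ)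
    (hχs : tsupport χ ⊆ D.chart.source) :
    ContDiff ℝ ∞ (D.weight δ χ) ∧ tsupport (D.weight δ χ) ⊆ D.chart '' tsupport χ :=
  contDiff_indicator_chart (FiberProduct.covers hfs hg)
    (FiberProduct.isSmoothChart_adaptedChart hf D.e D.z₀ (IsDiffManifold.covers A)
      (IsDiffManifold.covers B) (IsDiffManifold.covers C) hfs c.smooth_φ)
    (w := fun z => δ.comp D.e z.1.2 * χ z)
    (fun z hz => (D.ckAt_density δ hz).mul (hχ z)) hχc.isCompact hχs fun z _ hz => by
      rw [image_eq_zero_of_notMem_tsupport hz, mul_zero]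

/-- Off the target of the chart, `θ ∘ chart⁻¹` is arbitrary, but the weight vanishes there; its
support corresponds to a compact subset of the domain. Hence the product is of class `C^k` on the
whole space. -/
theorem contDiff_weight_smul (hfs : SmoothMap f) (hg : SubmersiveMap g)
    (δ : VerticalVolumeDensity g) {χ : FiberProduct f g → ℝ} (hχ : ∀ z, CkAt ⊤ χ z)
    (hχc : HasCompactSupport χ) (hχs : tsupport χ ⊆ D.chart.source) {H : Type*}
    [NormedAddCommGroup H] [NormedSpace ℝ H] {k : ℕ∞} {θ : FiberProduct f g → H}
    (hθ : ∀ z ∈ D.chart.source, CkAt k θ z) :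
    ContDiff ℝ k (fun v => D.weight δ χ v • θ (D.chart.symm v)) ∧
      tsupport (fun v => D.weight δ χ v • θ (D.chart.symm v)) ⊆ D.chart '' tsupport χ := by
  have h := contDiff_indicator_chart (FiberProduct.covers hfs hg)
    (FiberProduct.isSmoothChart_adaptedChart hf D.e D.z₀ (IsDiffManifold.covers A)
      (IsDiffManifold.covers B) (IsDiffManifold.covers C) hfs c.smooth_φ)
    (w := fun z => (δ.comp D.e z.1.2 * χ z) • θ z) (k := k)
    (fun z hz => (((D.ckAt_density δ hz).mul (hχ z)).of_le le_top).smul (hθ z hz))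
    hχc.isCompact hχs fun z _ hz => by
      rw [image_eq_zero_of_notMem_tsupport hz, mul_zero, zero_smul]
  have e : (fun v => D.weight δ χ v • θ (D.chart.symm v)) = D.chart.target.indicator
      fun v => (δ.comp D.e (D.chart.symm v).1.2 * χ (D.chart.symm v)) • θ (D.chart.symm v) := by
    funext v
    by_cases hv : v ∈ D.chart.target
    · simp only [weight, indicator_of_mem hv]
    · simp only [weight, indicator_of_notMem hv, zero_smul]
  rw [e]
  exact h

end AdaptedData

end AdaptedIntegration

/-! ### The integration functional in coordinates -/

/-- Expanding `g` in the basis shows that linear maps commute with the integral. In particular the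
coordinates of the integral in any trivialization are ordinary integrals. -/
theorem vecIntegral_coord {𝕜 : Type*} [RCLike 𝕜] {M : Type*} [AddCommGroup M] [Module 𝕜 M]
    [Module.Finite 𝕜 M] {α : Type*} [MeasurableSpace α] {μ : Measure α} {g : α → M}
    (hg : ∀ l : Module.Dual 𝕜 M, Integrable (fun a => l (g a)) μ) {r : ℕ}
    (T : M →ₗ[𝕜] (Fin r → 𝕜)) : T (vecIntegral 𝕜 μ g) = ∫ a, T (g a) ∂μ := by
  let b := Module.finBasis 𝕜 M
  funext j
  have hj : ∀ j, Integrable (fun a => T (g a) j) μ := fun j => hg ((LinearMap.proj j).comp T)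
  rw [eval_integral hj]
  have h1 : ∀ a, T (g a) j = ∑ i, b.repr (g a) i * T (b i) j := by
    intro a
    conv_lhs => rw [← b.sum_repr (g a)]
    simp only [map_sum, map_smul, Finset.sum_apply, Pi.smul_apply, smul_eq_mul]
  simp only [vecIntegral, map_sum, map_smul, Finset.sum_apply, Pi.smul_apply, smul_eq_mul]
  simp only [h1]
  rw [integral_finsetSum (f := fun i a => b.repr (g a) i * T (b i) j) _
    fun i _ => (hg (b.coord i)).mul_const _]
  exact Finset.sum_congr rfl fun i _ => (integral_mul_const _ _).symm

theorem CkSectionAt.of_le {𝕜 : Type*} [RCLike 𝕜] {X : Type*} [TopologicalSpace X] [HasAtlas X]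
    {E : X → Type*} [∀ x, AddCommGroup (E x)] [∀ x, Module 𝕜 (E x)] [HasTrivs 𝕜 E] {k l : ℕ∞}
    {ξ : ∀ x, E x} {x : X} (h : CkSectionAt 𝕜 k ξ x) (e : l ≤ k) : CkSectionAt 𝕜 l ξ x :=
  fun τ hτ hx => (h τ hτ hx).of_le e

theorem StdNormedChart.localRep_apply {𝕜 : Type*} [RCLike 𝕜] {X : Type*} [TopologicalSpace X]
    [HasAtlas X] {E : X → Type*} [∀ x, AddCommGroup (E x)] [∀ x, Module 𝕜 (E x)] [HasTrivs 𝕜 E]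
    (c : StdNormedChart 𝕜 E) {S : Set X} (ξ : ∀ x : S, E x) {x : X} (hx : x ∈ c.φ.source)
    (hS : x ∈ S) : c.localRep ξ (c.φ x) = c.τ.coord x (ξ ⟨x, hS⟩) := by
  have e := c.φ.left_inv hx
  have key : ∀ z (_ : z = x) (h : z ∈ S), c.τ.coord z (ξ ⟨z, h⟩) = c.τ.coord x (ξ ⟨x, hS⟩) := by
    rintro _ rfl _; rfl
  rw [c.localRep_of_mem ξ (by rw [e]; exact hS)]
  exact key _ e _

/-- Estimates are made with a real bound `t` in place of the extended norm, so finiteness of the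
norm is never an issue. -/
theorem stdNorm_le_iff {𝕜 : Type*} [RCLike 𝕜] {X : Type*} [TopologicalSpace X]
    [HasAtlas X] {E : X → Type*} [∀ x, AddCommGroup (E x)] [∀ x, Module 𝕜 (E x)] [HasTrivs 𝕜 E]
    {Ω : Set X} {A : Finset (StdNormedChart 𝕜 E)} {r : ℕ} {ξ : ∀ x : closure Ω, E x} {t : ℝ}
    (ht : 0 ≤ t) : stdNorm Ω A r ξ ≤ ENNReal.ofReal t ↔ ∀ c ∈ A, ∀ m ≤ r,
      ∀ i : Fin m → Fin c.dim, ∀ u ∈ c.unitBall ∩ Ω,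
        c.p u (c.τ.symm u (partialDeriv i (c.localRep ξ) (c.φ u))) ≤ t := by
  simp only [stdNorm, iSup_le_iff, ENNReal.ofReal_le_ofReal_iff ht]

section Functional

variable {𝕜 : Type*} [RCLike 𝕜] {G X P : Type*}
variable [TopologicalSpace G] [HasAtlas G] [IsDiffManifold G] [SecondCountableTopology G]
variable [MeasurableSpace G] [BorelSpace G]
variable [TopologicalSpace X] [HasAtlas X] [IsDiffManifold X]
variable [TopologicalSpace P] [HasAtlas P] [IsDiffManifold P]
variable {Γ : DiffGroupoid G X} {f : P → X}
variable {E : P → Type*} [∀ y, AddCommGroup (E y)] [∀ y, Module 𝕜 (E y)]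
variable [HasTrivs 𝕜 E] [IsDiffVectorBundle 𝕜 E]

/-! ### Compactness and integrability for normalized Haar systems -/

namespace NormalizedHaarSystem

variable (ν : NormalizedHaarSystem Γ)

theorem continuous_κ_src : Continuous fun h => ν.κ (Γ.src h) := by
  have h1 : Continuous ν.κ := continuous_iff_continuousAt.2 fun x =>
    ((ckOn_iff_ckAt isOpen_univ).1 ν.κ_smooth x (mem_univ x)).continuousAt
      (IsDiffManifold.covers X)
  exact h1.comp Γ.submersive_src.1.1

/-- The support of `κ ∘ s` meets each target fibre in a compact set, by properness over the
one-point set `{x}`, and Radon measures are finite on compact sets. -/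
theorem integrable_κ_smul [T2Space X] [T2Space G] {x : X} {H : Type*}
    [NormedAddCommGroup H] [NormedSpace ℝ H]
    {F : Γ.TFiber x → H} (hF : Continuous F) :
    Integrable (fun h => ν.κ (Γ.src h.1) • F h) (ν.μ x) := by
  have := ν.radon x
  have hcl : IsClosedEmbedding (Subtype.val : Γ.TFiber x → G) :=
    (isClosed_singleton.preimage Γ.submersive_tgt.1.1).isClosedEmbedding_subtypeVal
  have hK := hcl.isCompact_preimage (ν.κ_proper {x} isCompact_singleton)
  refine Continuous.integrable_of_hasCompactSupport
    ((ν.continuous_κ_src.comp continuous_subtype_val).smul hF) ?_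
  refine HasCompactSupport.of_support_subset_isCompact hK fun h hh => ⟨?_, h.2⟩
  exact subset_tsupport _ (left_ne_zero_of_smul hh)

theorem measurable_density (x : X) :
    Measurable fun h : Γ.TFiber x => ENNReal.ofReal (ν.κ (Γ.src h.1)) :=
  ENNReal.measurable_ofReal.comp (ν.continuous_κ_src.comp continuous_subtype_val).measurable

theorem integral_measure {x : X} {H : Type*} [NormedAddCommGroup H] [NormedSpace ℝ H]
    (F : Γ.TFiber x → H) :
    ∫ h, F h ∂ν.measure x = ∫ h, ν.κ (Γ.src h.1) • F h ∂ν.μ x := by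
  rw [NormalizedHaarSystem.measure,
    integral_withDensity_eq_integral_toReal_smul (ν.measurable_density x) (by simp)]
  simp only [ENNReal.toReal_ofReal (ν.κ_nonneg _)]

theorem integrable_measure [T2Space X] [T2Space G] {x : X} {H : Type*} [NormedAddCommGroup H]
    [NormedSpace ℝ H] {F : Γ.TFiber x → H} (hF : Continuous F) : Integrable F (ν.measure x) := by
  rw [NormalizedHaarSystem.measure,
    integrable_withDensity_iff_integrable_smul' (ν.measurable_density x) (by simp)]
  simpa only [ENNReal.toReal_ofReal (ν.κ_nonneg _)] using ν.integrable_κ_smul hF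

/-- The fibre product is closed in `P × Γ`, as `X` is Hausdorff, and the set is its intersection
with a product of compact sets: `K` and the part of the support of `κ ∘ s` over `f(K)`. -/
theorem isCompact_fiberProduct [T2Space X] (hf : Continuous f) {K : Set P} (hK : IsCompact K) :
    IsCompact {z : FiberProduct f Γ.tgt | z.1.1 ∈ K ∧ z.1.2 ∈ tsupport (ν.κ ∘ Γ.src)} := by
  have hcl : IsClosedEmbedding (fun z : FiberProduct f Γ.tgt => z.1) :=
    (isClosed_eq (hf.comp continuous_fst)
      (Γ.submersive_tgt.1.1.comp continuous_snd)).isClosedEmbedding_subtypeVal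
  have h := hcl.isCompact_preimage (hK.prod (ν.κ_proper _ (hK.image hf)))
  convert h using 1
  ext z
  constructor
  · rintro ⟨h1, h2⟩
    exact ⟨h1, h2, z.1.1, h1, z.2⟩
  · rintro ⟨h1, h2⟩
    exact ⟨h1, h2.1⟩

end NormalizedHaarSystem

/-- The coordinates of a section of the pullback bundle. -/
def coordFn (c : StdNormedChart 𝕜 E) (θ : ∀ z : FiberProduct f Γ.tgt, PullFst f Γ.tgt E z)
    (z : FiberProduct f Γ.tgt) : Fin c.τ.rank → 𝕜 :=
  c.τ.coord z.1.1 (θ z)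

theorem ckAt_coordFn (c : StdNormedChart 𝕜 E) {k : ℕ∞}
    {θ : ∀ z : FiberProduct f Γ.tgt, PullFst f Γ.tgt E z} {z : FiberProduct f Γ.tgt}
    (hθ : CkSectionAt 𝕜 k θ z) (hz : z.1.1 ∈ c.φ.source) : CkAt k (coordFn c θ) z :=
  hθ.ckAt_coord (exists_mem_trivs_pullFst z)
    (c.smooth_τ.pullFst (IsDiffManifold.covers P) (IsDiffManifold.covers G))
    (show z.1.1 ∈ c.τ.base by rw [c.base_τ]; exact hz)

theorem continuous_mk' (y : P) :
    Continuous fun h : Γ.TFiber (f y) => FiberProduct.mk' (f := f) (g := Γ.tgt) y h.1 h.2.symm :=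
  FiberProduct.isInducing_val.continuous_iff.2
    (continuous_const.prodMk continuous_subtype_val)

theorem continuous_coord_alongFiber (hf : SmoothMap f) (c : StdNormedChart 𝕜 E) {k : ℕ∞}
    {θ : ∀ z : FiberProduct f Γ.tgt, PullFst f Γ.tgt E z}
    (hθ : ∀ z, CkSectionAt 𝕜 k θ z) {y : P} (hy : y ∈ c.φ.source) :
    Continuous fun h => c.τ.coord y (alongFiber Γ f θ y h) :=
  continuous_iff_continuousAt.2 fun _ =>
    ContinuousAt.comp (f := fun h : Γ.TFiber (f y) => FiberProduct.mk' y h.1 h.2.symm)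
      (g := coordFn c θ)
      ((ckAt_coordFn c (hθ _) hy).continuousAt (FiberProduct.covers hf Γ.submersive_tgt))
      (continuous_mk' y).continuousAt

theorem continuous_dual_alongFiber (hf : SmoothMap f) {k : ℕ∞}
    {θ : ∀ z : FiberProduct f Γ.tgt, PullFst f Γ.tgt E z}
    (hθ : ∀ z, CkSectionAt 𝕜 k θ z) (y : P) (l : Module.Dual 𝕜 (E y)) :
    Continuous fun h => l (alongFiber Γ f θ y h) := by
  obtain ⟨c, hc⟩ := exists_stdNormedChart (𝕜 := 𝕜) (E := E) y
  have h1 := (l.comp (c.τ.symm y)).continuous_of_finiteDimensional.comp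
    (continuous_coord_alongFiber hf c hθ hc.1)
  refine h1.congr fun h => ?_
  simp only [Function.comp_apply, LinearMap.comp_apply]
  rw [c.τ.left_inv y (by rw [c.base_τ]; exact hc.1)]

theorem integrable_alongFiber [T2Space X] [T2Space G] (ν : NormalizedHaarSystem Γ)
    (hf : SmoothMap f) {k : ℕ∞} {θ : ∀ z : FiberProduct f Γ.tgt, PullFst f Γ.tgt E z}
    (hθ : ∀ z, CkSectionAt 𝕜 k θ z) (y : P) (l : Module.Dual 𝕜 (E y)) :
    Integrable (fun h => l (alongFiber Γ f θ y h)) (ν.measure (f y)) :=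
  ν.integrable_measure (continuous_dual_alongFiber hf hθ y l)

/-- A coordinate expression of the integration functional over the unit ball of a chart. -/
structure LocalFormula (ν : NormalizedHaarSystem Γ) (hf : SmoothMap f)
    (c : StdNormedChart 𝕜 E) (δ : VerticalVolumeDensity Γ.tgt) where
  N : ℕ
  D : Fin N → AdaptedData c f Γ.tgt hf.1
  χ : Fin N → FiberProduct f Γ.tgt → ℝ
  smooth_χ : ∀ i z, CkAt ⊤ (χ i) z
  compact_χ : ∀ i, HasCompactSupport (χ i)
  support_χ : ∀ i, tsupport (χ i) ⊆ ((D i).toStd hf).unitBall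
  support_κ : ∀ i, ∀ z ∈ tsupport (χ i), z.1.2 ∈ tsupport (ν.κ ∘ Γ.src)
  formula : ∀ θ : (∀ z : FiberProduct f Γ.tgt, PullFst f Γ.tgt E z),
    (∀ z, CkSectionAt 𝕜 0 θ z) → ∀ y ∈ c.closedUnitBall,
      c.τ.coord y (fiberIntegral 𝕜 ν f θ y) =
        ∑ i, ∫ u, (D i).weight δ (χ i) (c.φ y, u) • coordFn c θ ((D i).chart.symm (c.φ y, u))

/-- Unit balls of adapted charts cover the part of the support of `κ ∘ s` over the closed unit ball
of `c`, which is compact. A partition of unity there splits the integral into integrals computed in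
single charts. -/
theorem exists_localFormula [T2Space X] [T2Space G] [T2Space P] (ν : NormalizedHaarSystem Γ)
    (hf : SmoothMap f) (c : StdNormedChart 𝕜 E) {δ : VerticalVolumeDensity Γ.tgt}
    (hδ : δ.IsMeasure ν.μ) : Nonempty (LocalFormula ν hf c δ) := by
  have hcov : HasAtlas.Covers (FiberProduct f Γ.tgt) := FiberProduct.covers hf Γ.submersive_tgt
  obtain ⟨N, D, χ, h1, h2, h3, h4⟩ := exists_finite_partition
    (ν.isCompact_fiberProduct hf.1 c.isCompact_closedUnitBall)
    (fun D : AdaptedData c f Γ.tgt hf.1 => (D.toStd hf).unitBall) fun z hz => by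
      obtain ⟨D, hD⟩ := AdaptedData.exists_mem_unitBall hf Γ.submersive_tgt c
        (c.closedUnitBall_subset hz.1)
      obtain ⟨χ, a1, a2, a3, a4⟩ := exists_smooth_bump (D.toStd hf).smooth_φ hD.1
        (D.toStd hf).isOpen_unitBall hD
      exact ⟨D, χ, a1, a2, a3.trans inter_subset_left, a4⟩
  have hκ : ∀ z, CkAt ⊤ (fun z : FiberProduct f Γ.tgt => ν.κ (Γ.src z.1.2)) z := by
    intro z
    have a1 : CkAt ⊤ (fun h => ν.κ (Γ.src h)) z.1.2 :=
      CkAt.comp_smoothMap ((ckOn_iff_ckAt isOpen_univ).1 ν.κ_smooth _ (mem_univ _))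
        (IsDiffManifold.covers X) Γ.submersive_src.1
    exact CkAt.comp_smoothMap (q := fun z : FiberProduct f Γ.tgt => z.1.2) a1
      (IsDiffManifold.covers G) (FiberProduct.smoothMap_snd (IsDiffManifold.covers P))
  -- The factor `κ ∘ s` is absorbed into the cut-off functions; this also confines their supports to
  -- the support of `κ ∘ s`.
  let χκ : Fin N → FiberProduct f Γ.tgt → ℝ := fun i z => χ i z * ν.κ (Γ.src z.1.2)
  have hs : ∀ i, tsupport (χκ i) ⊆ tsupport (χ i) := fun i =>
    closure_mono fun z hz => left_ne_zero_of_mul hz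
  have hsD : ∀ i, tsupport (χκ i) ⊆ (D i).chart.source := fun i z hz =>
    (D i).stdChart_source_subset (h3 i (hs i hz)).1
  refine ⟨⟨N, D, χκ, fun i z => (h1 i z).mul (hκ z), fun i => (h2 i).mul_right,
    fun i => (hs i).trans (h3 i), fun i z hz => ?_, fun θ hθ y hy => ?_⟩⟩
  · have hcl : IsClosed {z : FiberProduct f Γ.tgt | z.1.2 ∈ tsupport (ν.κ ∘ Γ.src)} :=
      (isClosed_tsupport _).preimage FiberProduct.continuous_snd
    refine closure_minimal (fun w hw => ?_) hcl hz
    exact subset_tsupport _ (right_ne_zero_of_mul hw)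
  · have hys := c.closedUnitBall_subset hy
    have := IsDiffVectorBundle.finite 𝕜 E y
    have e1 : c.τ.coord y (fiberIntegral 𝕜 ν f θ y) =
        ∫ h, c.τ.coord y (alongFiber Γ f θ y h) ∂ν.measure (f y) :=
      vecIntegral_coord (integrable_alongFiber ν hf hθ y) (c.τ.coord y)
    rw [e1, ν.integral_measure]
    let w : Fin N → FiberProduct f Γ.tgt → (Fin c.τ.rank → 𝕜) := fun i z =>
      χκ i z • coordFn c θ z
    have e2 : ∀ h : Γ.TFiber (f y), ν.κ (Γ.src h.1) • c.τ.coord y (alongFiber Γ f θ y h) =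
        ∑ i, w i (FiberProduct.mk' y h.1 h.2.symm) := by
      intro h
      have e3 : ∑ i, w i (FiberProduct.mk' y h.1 h.2.symm) =
          ((∑ i, χ i (FiberProduct.mk' y h.1 h.2.symm)) * ν.κ (Γ.src h.1)) •
            c.τ.coord y (alongFiber Γ f θ y h) := by
        rw [Finset.sum_mul, Finset.sum_smul]; rfl
      rw [e3]
      -- The partition functions sum to one only over the support of `κ ∘ s`; elsewhere both sides
      -- are zero.
      by_cases hh : h.1 ∈ tsupport (ν.κ ∘ Γ.src)
      · rw [h4 (FiberProduct.mk' y h.1 h.2.symm) ⟨hy, hh⟩, one_mul]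
      · have h0 : ν.κ (Γ.src h.1) = 0 :=
          image_eq_zero_of_notMem_tsupport (f := ν.κ ∘ Γ.src) hh
        simp [h0]
    simp only [e2]
    rw [integral_finsetSum]
    · refine Finset.sum_congr rfl fun i _ => ?_
      rw [(D i).integral_eq hδ (w i) (fun z hz => ?_) hys]
      · refine integral_congr_ae (Filter.Eventually.of_forall fun u => ?_)
        by_cases hu : (c.φ y, u) ∈ (D i).chart.target
        · refine (indicator_of_mem hu _).trans ?_
          simp only [w, AdaptedData.weight, indicator_of_mem hu, smul_smul]
        · refine (indicator_of_notMem hu _).trans ?_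
          simp only [AdaptedData.weight, indicator_of_notMem hu, zero_smul]
      · have h0 : χκ i z = 0 := image_eq_zero_of_notMem_tsupport fun h => hz (hsD i h)
        simp [w, h0]
    · intro i _
      have hc : Continuous fun h : Γ.TFiber (f y) => χ i (FiberProduct.mk' y h.1 h.2.symm) •
          c.τ.coord y (alongFiber Γ f θ y h) := by
        have hχ : Continuous fun h : Γ.TFiber (f y) => χ i (FiberProduct.mk' y h.1 h.2.symm) :=
          (continuous_iff_continuousAt.2 fun z => (h1 i z).continuousAt hcov).comp (continuous_mk' y)
        exact hχ.smul (continuous_coord_alongFiber hf c hθ hys)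
      refine (ν.integrable_κ_smul hc).congr (Filter.Eventually.of_forall fun h => ?_)
      simp only [w, χκ, smul_smul]
      rw [mul_comm]; rfl

namespace LocalFormula

variable {ν : NormalizedHaarSystem Γ} {hf : SmoothMap f} {c : StdNormedChart 𝕜 E}
variable {δ : VerticalVolumeDensity Γ.tgt} (L : LocalFormula ν hf c δ)

theorem support_subset (i : Fin L.N) : tsupport (L.χ i) ⊆ (L.D i).chart.source :=
  fun _ hz => (L.D i).stdChart_source_subset (L.support_χ i hz).1

/-- The integrand of the coordinate expression. -/
noncomputable def integrand (θ : ∀ z : FiberProduct f Γ.tgt, PullFst f Γ.tgt E z) (i : Fin L.N)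
    (v : EucR c.dim × EucR (L.D i).m) : Fin c.τ.rank → 𝕜 :=
  (L.D i).weight δ (L.χ i) v • coordFn c θ ((L.D i).chart.symm v)

theorem contDiff_integrand {k : ℕ∞} {θ : ∀ z : FiberProduct f Γ.tgt, PullFst f Γ.tgt E z}
    (hθ : ∀ z, CkSectionAt 𝕜 k θ z) (i : Fin L.N) : ContDiff ℝ k (L.integrand θ i) :=
  ((L.D i).contDiff_weight_smul hf Γ.submersive_tgt δ (L.smooth_χ i) (L.compact_χ i)
    (L.support_subset i) fun z hz => ckAt_coordFn c (hθ z) hz.1).1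

theorem isCompact_tsupport_weight (i : Fin L.N) :
    IsCompact (tsupport ((L.D i).weight δ (L.χ i))) := by
  refine ((L.compact_χ i).isCompact.image_of_continuousOn
    ((L.D i).chart.continuousOn.mono (L.support_subset i))).of_isClosed_subset
    (isClosed_tsupport _) ?_
  exact ((L.D i).contDiff_weight hf Γ.submersive_tgt δ (L.smooth_χ i) (L.compact_χ i)
    (L.support_subset i)).2

theorem tsupport_integrand (θ : ∀ z : FiberProduct f Γ.tgt, PullFst f Γ.tgt E z) (i : Fin L.N) :
    tsupport (L.integrand θ i) ⊆ tsupport ((L.D i).weight δ (L.χ i)) :=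
  closure_mono fun _ hv => left_ne_zero_of_smul hv

/-- The coordinate expression of the integral. -/
noncomputable def value (θ : ∀ z : FiberProduct f Γ.tgt, PullFst f Γ.tgt E z)
    (v : EucR c.dim) : Fin c.τ.rank → 𝕜 := ∑ i, ∫ u, L.integrand θ i (v, u)

theorem contDiff_value {k : ℕ∞} {θ : ∀ z : FiberProduct f Γ.tgt, PullFst f Γ.tgt E z}
    (hθ : ∀ z, CkSectionAt 𝕜 k θ z) : ContDiff ℝ k (L.value θ) :=
  ContDiff.sum fun i _ => contDiff_integral_slice (L.contDiff_integrand hθ i)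
    ((L.isCompact_tsupport_weight i).of_isClosed_subset (isClosed_tsupport _)
      (L.tsupport_integrand θ i))

theorem coord_fiberIntegral {θ : ∀ z : FiberProduct f Γ.tgt, PullFst f Γ.tgt E z}
    (hθ : ∀ z, CkSectionAt 𝕜 0 θ z) {y : P} (hy : y ∈ c.closedUnitBall) :
    c.τ.coord y (fiberIntegral 𝕜 ν f θ y) = L.value θ (c.φ y) := L.formula θ hθ y hy

end LocalFormula

/-- Near `y` the coordinates of the integral are the function `L.value θ` in the chart, a finite sum
of parametric integrals of compactly supported `C^k` functions. -/
theorem ckSectionAt_fiberIntegral [T2Space X] [T2Space G] [T2Space P] (ν : NormalizedHaarSystem Γ)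
    (hf : SmoothMap f) {k : ℕ∞} {θ : ∀ z : FiberProduct f Γ.tgt, PullFst f Γ.tgt E z}
    (hθ : ∀ z, CkSectionAt 𝕜 k θ z) (y : P) : CkSectionAt 𝕜 k (fiberIntegral 𝕜 ν f θ) y := by
  obtain ⟨c, hc⟩ := exists_stdNormedChart (𝕜 := 𝕜) (E := E) y
  obtain ⟨δ, hδ⟩ := ν.smooth
  obtain ⟨L⟩ := exists_localFormula ν hf c hδ
  refine CkSectionAt.of_triv c.smooth_τ (by rw [c.base_τ]; exact hc.1) ?_
  refine (CkAt.comp_contDiffAt (p := L.value θ) (L.contDiff_value hθ).contDiffAt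
    (c.smooth_φ.ckAt hc.1)).congr ?_
  filter_upwards [c.isOpen_unitBall.mem_nhds hc] with z hz
  exact L.coord_fiberIntegral (fun z => (hθ z).of_le bot_le) (c.unitBall_subset hz)

end Functional

/-! ### Estimates for the integration functional -/

theorem vecIntegral_add {𝕜 : Type*} [RCLike 𝕜] {M : Type*} [AddCommGroup M] [Module 𝕜 M]
    [Module.Finite 𝕜 M] {α : Type*} [MeasurableSpace α] {μ : Measure α} {g g' : α → M}
    (hg : ∀ l : Module.Dual 𝕜 M, Integrable (fun a => l (g a)) μ)
    (hg' : ∀ l : Module.Dual 𝕜 M, Integrable (fun a => l (g' a)) μ) :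
    vecIntegral 𝕜 μ (fun a => g a + g' a) = vecIntegral 𝕜 μ g + vecIntegral 𝕜 μ g' := by
  simp only [vecIntegral]
  rw [← Finset.sum_add_distrib]
  refine Finset.sum_congr rfl fun i _ => ?_
  have h := integral_add (hg ((Module.finBasis 𝕜 M).coord i)) (hg' ((Module.finBasis 𝕜 M).coord i))
  simp only [Module.Basis.coord_apply] at h
  rw [← add_smul, ← h]
  simp only [map_add, Finsupp.add_apply]

theorem vecIntegral_smul {𝕜 : Type*} [RCLike 𝕜] {M : Type*} [AddCommGroup M] [Module 𝕜 M]
    [Module.Finite 𝕜 M] {α : Type*} [MeasurableSpace α] {μ : Measure α} (a : 𝕜) (g : α → M) :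
    vecIntegral 𝕜 μ (fun x => a • g x) = a • vecIntegral 𝕜 μ g := by
  simp only [vecIntegral, Finset.smul_sum, smul_smul, map_smul, Finsupp.smul_apply, smul_eq_mul,
    integral_const_mul]

section Estimates

variable {𝕜 : Type*} [RCLike 𝕜] {G X P : Type*}
variable [TopologicalSpace G] [HasAtlas G] [IsDiffManifold G] [SecondCountableTopology G]
variable [MeasurableSpace G] [BorelSpace G]
variable [TopologicalSpace X] [HasAtlas X] [IsDiffManifold X]
variable [TopologicalSpace P] [HasAtlas P] [IsDiffManifold P]
variable {Γ : DiffGroupoid G X} {f : P → X}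
variable {E : P → Type*} [∀ y, AddCommGroup (E y)] [∀ y, Module 𝕜 (E y)]
variable [HasTrivs 𝕜 E] [IsDiffVectorBundle 𝕜 E]

theorem isOpen_localDomain {V : Set P} (hV : IsOpen V) {U : Set X}
    (hU : IsOpen U) : IsOpen (localDomain Γ f V U) :=
  (hV.preimage FiberProduct.continuous_fst).inter
    (((hU.preimage Γ.submersive_src.1.1).inter (hU.preimage Γ.submersive_tgt.1.1)).preimage
      FiberProduct.continuous_snd)

/-- The arrow `h⁻¹` starts in `U` and ends at the source of `h`, which therefore lies in the
saturation of `U` as well as in the support of `κ`. -/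
theorem NormalizedHaarSystem.src_mem_of_isAdapted (ν : NormalizedHaarSystem Γ) {U : Set X}
    (hUν : Γ.IsAdapted ν.κ U) {h : G} (h1 : Γ.tgt h ∈ U) (h2 : h ∈ tsupport (ν.κ ∘ Γ.src)) :
    Γ.src h ∈ U := by
  refine hUν ⟨?_, ⟨Γ.inv h, ?_, Γ.tgt_inv h⟩⟩
  · exact tsupport_comp_subset_preimage ν.κ Γ.submersive_src.1.1 h2
  · change Γ.src (Γ.inv h) ∈ U
    rw [Γ.src_inv]; exact h1

theorem NormalizedHaarSystem.mem_localDomain (ν : NormalizedHaarSystem Γ) {U : Set X}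
    (hUν : Γ.IsAdapted ν.κ U) {V : Set P} (hfV : f '' V ⊆ U) {z : FiberProduct f Γ.tgt}
    (h1 : z.1.1 ∈ V) (h2 : z.1.2 ∈ tsupport (ν.κ ∘ Γ.src)) : z ∈ localDomain Γ f V U := by
  have h3 : Γ.tgt z.1.2 ∈ U := by rw [← z.2]; exact hfV ⟨_, h1, rfl⟩
  exact ⟨h1, ν.src_mem_of_isAdapted hUν h3 h2, h3⟩

/-- The integral at a point depends only on the section over the local domain. -/
theorem fiberIntegral_eq_zero (ν : NormalizedHaarSystem Γ) {U : Set X}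
    (hUν : Γ.IsAdapted ν.κ U) {V : Set P} (hfV : f '' V ⊆ U)
    {θ : ∀ z : FiberProduct f Γ.tgt, PullFst f Γ.tgt E z}
    (hθ : ∀ z ∈ localDomain Γ f V U, θ z = 0) {y : P} (hy : y ∈ V) :
    fiberIntegral 𝕜 ν f θ y = 0 := by
  have := IsDiffVectorBundle.finite 𝕜 E y
  have h0 : ∀ l : Module.Dual 𝕜 (E y),
      ∫ h, l (alongFiber Γ f θ y h) ∂ν.measure (f y) = 0 := by
    intro l
    rw [ν.integral_measure]
    refine integral_eq_zero_of_ae (Filter.Eventually.of_forall fun h => ?_)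
    by_cases hh : h.1 ∈ tsupport (ν.κ ∘ Γ.src)
    · have h1 : alongFiber Γ f θ y h = 0 :=
        hθ _ (ν.mem_localDomain hUν hfV (z := FiberProduct.mk' y h.1 h.2.symm) hy hh)
      simp [h1]
    · have h1 : ν.κ (Γ.src h.1) = 0 :=
        image_eq_zero_of_notMem_tsupport (f := ν.κ ∘ Γ.src) hh
      simp [h1]
  change vecIntegral 𝕜 (ν.measure (f y)) (alongFiber Γ f θ y) = 0
  refine Finset.sum_eq_zero fun i _ => ?_
  have h1 := h0 ((Module.finBasis 𝕜 (E y)).coord i)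
  simp only [Module.Basis.coord_apply] at h1
  rw [h1, zero_smul]

theorem fiberIntegral_add [T2Space X] [T2Space G] (ν : NormalizedHaarSystem Γ) (hf : SmoothMap f)
    {k : ℕ∞} {θ η : ∀ z : FiberProduct f Γ.tgt, PullFst f Γ.tgt E z}
    (hθ : ∀ z, CkSectionAt 𝕜 k θ z) (hη : ∀ z, CkSectionAt 𝕜 k η z) (y : P) :
    fiberIntegral 𝕜 ν f (fun z => θ z + η z) y =
      fiberIntegral 𝕜 ν f θ y + fiberIntegral 𝕜 ν f η y := by
  have := IsDiffVectorBundle.finite 𝕜 E y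
  exact vecIntegral_add (integrable_alongFiber ν hf hθ y) (integrable_alongFiber ν hf hη y)

theorem fiberIntegral_smul (ν : NormalizedHaarSystem Γ) (a : 𝕜)
    (θ : ∀ z : FiberProduct f Γ.tgt, PullFst f Γ.tgt E z) (y : P) :
    fiberIntegral 𝕜 ν f (fun z => a • θ z) y = a • fiberIntegral 𝕜 ν f θ y := by
  have := IsDiffVectorBundle.finite 𝕜 E y
  exact vecIntegral_smul a (alongFiber Γ f θ y)

namespace LocalFormula

variable {ν : NormalizedHaarSystem Γ} {hf : SmoothMap f} {c : StdNormedChart 𝕜 E}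
variable {δ : VerticalVolumeDensity Γ.tgt} (L : LocalFormula ν hf c δ)

/-- The derivatives of the integrand are bounded by those of the coordinate expression of the
section in the adapted chart. -/
theorem exists_bound_integrand {U : Set X} (hU : IsOpen U) (hUν : Γ.IsAdapted ν.κ U) {V : Set P}
    (hV : IsOpen V) (hfV : f '' V ⊆ U) (r : ℕ) (i : Fin L.N) :
    ∃ C : ℝ, 0 ≤ C ∧ ∀ (k : ℕ∞) (_ : (r : ℕ∞) ≤ k)
      (θ : ∀ z : FiberProduct f Γ.tgt, PullFst f Γ.tgt E z)
      (ξ : Sections 𝕜 (PullFst f Γ.tgt E) k (closure (localDomain Γ f V U)))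
      (_ : ∀ z : closure (localDomain Γ f V U), θ z = ξ.1 z) (t : ℝ) (_ : 0 ≤ t)
      (_ : ∀ j ≤ r, ∀ a : Fin j → Fin ((L.D i).toStd hf).dim,
        ∀ z ∈ ((L.D i).toStd hf).unitBall ∩ localDomain Γ f V U,
        ‖partialDeriv a (((L.D i).toStd hf).localRep ξ.1) (((L.D i).toStd hf).φ z)‖ ≤ t),
      ∀ y ∈ c.φ.source ∩ V, ∀ u, (c.φ y, u) ∈ tsupport ((L.D i).weight δ (L.χ i)) →
        ∀ j ≤ r, ‖iteratedFDeriv ℝ j (L.integrand θ i) (c.φ y, u)‖ ≤ C * t := by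
  let D := L.D i
  let b := D.toStd hf
  have hcov : HasAtlas.Covers (FiberProduct f Γ.tgt) := FiberProduct.covers hf Γ.submersive_tgt
  have hw := D.contDiff_weight hf Γ.submersive_tgt δ (L.smooth_χ i) (L.compact_χ i)
    (L.support_subset i)
  have hO : IsOpen (D.chart '' D.stdChart.source) :=
    D.chart.isOpen_image_of_subset_source D.stdChart.open_source D.stdChart_source_subset
  have hwO : tsupport (D.weight δ (L.χ i)) ⊆ D.chart '' D.stdChart.source :=
    hw.2.trans (image_mono fun z hz => (L.support_χ i hz).1)
  have hΩ := isOpen_localDomain (Γ := Γ) (f := f) hV hU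
  obtain ⟨C, hC, hbound⟩ := exists_bound_smul_comp (Fin c.τ.rank → 𝕜) hw.1
    (L.isCompact_tsupport_weight i) hO hwO D.contDiffOn_change r
  -- There are `dim ^ l` partial derivatives of order `l ≤ r`. Adding one to the dimension makes the
  -- powers increasing in `l` even in dimension zero.
  refine ⟨C * (b.dim + 1) ^ r, by positivity, fun k hk θ ξ hθξ t ht hξ y hy u hu j hj => ?_⟩
  obtain ⟨z, hz, hzu⟩ := hw.2 hu
  have hzb : z ∈ b.unitBall := L.support_χ i hz
  have hzs : z ∈ D.stdChart.source := hzb.1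
  have hzy : z.1.1 = y := by
    refine c.φ.injOn (D.stdChart_source_subset hzs).1 hy.1 ?_
    exact congrArg Prod.fst hzu
  -- Adaptedness is used here: points of the support of the weight over `V` lie in the open local
  -- domain, where the hypothesis controls the derivatives.
  have hzΩ : z ∈ localDomain Γ f V U :=
    ν.mem_localDomain hUν hfV (by rw [hzy]; exact hy.2) (L.support_κ i z hz)
  have hS : closure (localDomain Γ f V U) ∈ 𝓝 z :=
    Filter.mem_of_superset (hΩ.mem_nhds hzΩ) subset_closure
  have hch : D.change (c.φ y, u) = b.φ z := by rw [← hzu]; rfl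
  have hsm : ContDiffAt ℝ r (b.localRep ξ.1) (D.change (c.φ y, u)) := by
    rw [hch]
    exact (b.contDiffAt_localRep hcov (fun z => exists_mem_trivs_pullFst z) ξ hzs hS).of_le
      (by exact_mod_cast hk)
  have hder : ∀ l ≤ r, ‖iteratedFDeriv ℝ l (b.localRep ξ.1) (D.change (c.φ y, u))‖ ≤
      (b.dim + 1) ^ r * t := by
    intro l hl
    rw [hch]
    refine (norm_multilinear_le_of_basis _ fun a => hξ l hl a z ⟨hzb, hzΩ⟩).trans ?_
    refine mul_le_mul_of_nonneg_right ?_ ht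
    rw [Fintype.card_fun, Fintype.card_fin, Fintype.card_fin, Nat.cast_pow]
    calc (b.dim : ℝ) ^ l ≤ (b.dim + 1) ^ l := by gcongr; linarith
      _ ≤ (b.dim + 1) ^ r := pow_le_pow_right₀ (by simp) hl
  -- Near the point, `θ` may be replaced by `ξ` in its standard coordinates, so the derivatives of
  -- the integrand involve only `ξ`.
  have heq : L.integrand θ i =ᶠ[𝓝 (c.φ y, u)]
      fun v => D.weight δ (L.χ i) v • b.localRep ξ.1 (D.change v) := by
    have hO' : IsOpen (D.chart '' (D.stdChart.source ∩ localDomain Γ f V U)) :=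
      D.chart.isOpen_image_of_subset_source (D.stdChart.open_source.inter hΩ)
        (inter_subset_left.trans D.stdChart_source_subset)
    filter_upwards [hO'.mem_nhds ⟨z, ⟨hzs, hzΩ⟩, hzu⟩]
    rintro _ ⟨x, ⟨hxs, hxΩ⟩, rfl⟩
    have h1 : b.localRep ξ.1 (D.change (D.chart x)) = b.τ.coord x (ξ.1 ⟨x, subset_closure hxΩ⟩) :=
      b.localRep_apply ξ.1 (x := x) hxs (subset_closure hxΩ)
    rw [h1, ← hθξ]
    change D.weight δ (L.χ i) (D.chart x) • coordFn c θ (D.chart.symm (D.chart x)) = _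
    rw [D.chart.left_inv (D.stdChart_source_subset hxs)]
    rfl
  rw [(heq.iteratedFDeriv ℝ j).eq_of_nhds]
  refine (hbound (b.localRep ξ.1) _ _ hu hsm hder j hj).trans_eq ?_
  ring

/-- The derivatives of the integral are bounded by those of the section. -/
theorem exists_bound_value {U : Set X} (hU : IsOpen U) (hUν : Γ.IsAdapted ν.κ U) {V : Set P}
    (hV : IsOpen V) (hfV : f '' V ⊆ U) (r : ℕ) :
    ∃ C : ℝ, 0 ≤ C ∧ ∀ (k : ℕ∞) (_ : (r : ℕ∞) ≤ k)
      (θ : ∀ z : FiberProduct f Γ.tgt, PullFst f Γ.tgt E z) (_ : ∀ z, CkSectionAt 𝕜 k θ z)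
      (ξ : Sections 𝕜 (PullFst f Γ.tgt E) k (closure (localDomain Γ f V U)))
      (_ : ∀ z : closure (localDomain Γ f V U), θ z = ξ.1 z)
      (B : Finset (StdNormedChart 𝕜 (PullFst f Γ.tgt E))) (_ : ∀ i, (L.D i).toStd hf ∈ B)
      (t : ℝ) (_ : 0 ≤ t) (_ : stdNorm (localDomain Γ f V U) B r ξ.1 ≤ ENNReal.ofReal t),
      ∀ y ∈ c.φ.source ∩ V, ∀ j ≤ r,
        ‖iteratedFDeriv ℝ j (L.value θ) (c.φ y)‖ ≤ C * t := by
  choose C hC0 hC using L.exists_bound_integrand hU hUν hV hfV r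
  -- Each integral contributes the Lebesgue measure of the projected support of its weight, times
  -- the bound for its integrand.
  let M : Fin L.N → ℝ := fun i =>
    volume.real (Prod.snd '' tsupport ((L.D i).weight δ (L.χ i))) * C i
  refine ⟨∑ i, M i, Finset.sum_nonneg fun i _ => mul_nonneg measureReal_nonneg (hC0 i),
    fun k hk θ hθ ξ hθξ B hB t ht hξ y hy j hj => ?_⟩
  have hjk : (j : WithTop ℕ∞) ≤ k := by
    have : (j : ℕ∞) ≤ k := le_trans (by exact_mod_cast hj) hk
    exact_mod_cast this
  have hg : ∀ i, ContDiff ℝ j (L.integrand θ i) := fun i => (L.contDiff_integrand hθ i).of_le hjk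
  have hG : ∀ i, ContDiff ℝ j fun v => ∫ u, L.integrand θ i (v, u) := fun i =>
    (contDiff_integral_slice_nat j (hg i) ((L.isCompact_tsupport_weight i).of_isClosed_subset
      (isClosed_tsupport _) (L.tsupport_integrand θ i))).1
  have e1 : iteratedFDeriv ℝ j (L.value θ) (c.φ y) =
      ∑ i, iteratedFDeriv ℝ j (fun v => ∫ u, L.integrand θ i (v, u)) (c.φ y) :=
    iteratedFDeriv_fun_sum_apply fun i _ => (hG i).contDiffAt
  rw [e1, Finset.sum_mul]
  refine norm_sum_le_of_le _ fun i _ => ?_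
  simp only [M]
  rw [mul_assoc]
  refine norm_iteratedFDeriv_integral_slice_le (hg i) (L.isCompact_tsupport_weight i)
    (L.tsupport_integrand θ i) (mul_nonneg (hC0 i) ht) fun u hu => ?_
  refine hC i k hk θ ξ hθξ t ht (fun l hl a z hz => ?_) y hy u hu j hj
  have h1 := (stdNorm_le_iff ht).1 hξ _ (hB i) l hl a z hz
  -- The fibre norm of these charts was chosen to be the maximum norm of the coordinates, so the
  -- standard norm bounds coordinate derivatives directly.
  have h2 : ∀ w, ((L.D i).toStd hf).p z (((L.D i).toStd hf).τ.symm z w) = ‖w‖ := by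
    intro w
    have hzb : z ∈ ((L.D i).toStd hf).τ.base := hz.1.1
    exact congrArg norm (((L.D i).toStd hf).τ.right_inv z hzb w)
  rwa [h2] at h1

end LocalFormula

end Estimates

/-! ### Continuity of linear maps for the `C^k`-topologies -/

section Topology

variable {𝕜 : Type*} [RCLike 𝕜]
variable {X : Type*} [TopologicalSpace X] [HasAtlas X]
variable {E : X → Type*} [∀ x, AddCommGroup (E x)] [∀ x, Module 𝕜 (E x)] [HasTrivs 𝕜 E]

theorem StdNormedChart.localRep_add (c : StdNormedChart 𝕜 E) {S : Set X} (ξ η : ∀ x : S, E x) :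
    c.localRep (ξ + η) = c.localRep ξ + c.localRep η := by
  funext v
  by_cases h : c.φ.symm v ∈ S
  · simp [StdNormedChart.localRep, h]
  · simp [StdNormedChart.localRep, h]

theorem StdNormedChart.localRep_zero (c : StdNormedChart 𝕜 E) {S : Set X} :
    c.localRep (0 : ∀ x : S, E x) = 0 := by
  funext v
  by_cases h : c.φ.symm v ∈ S
  · simp [StdNormedChart.localRep, h]
  · simp [StdNormedChart.localRep, h]

theorem stdNorm_zero (Ω : Set X) (A : Finset (StdNormedChart 𝕜 E)) (r : ℕ) :
    stdNorm Ω A r (0 : ∀ x : closure Ω, E x) = 0 := by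
  rw [← nonpos_iff_eq_zero, ← ENNReal.ofReal_zero, stdNorm_le_iff le_rfl]
  intro c _ m _ i u _
  have h : partialDeriv i (c.localRep (0 : ∀ x : closure Ω, E x)) (c.φ u) = 0 := by
    rw [c.localRep_zero, partialDeriv]
    simp
  rw [h, map_zero, map_zero]

/-- Partial derivatives add because points of the open set `Ω` are interior to its closure, where
the coordinate expressions of sections of class `C^k` are differentiable to order `r ≤ k`. -/
theorem stdNorm_add_le (hX : HasAtlas.Covers X)
    (hE : ∀ x, ∃ τ ∈ HasTrivs.trivs (𝕜 := 𝕜) (E := E), x ∈ τ.base) {Ω : Set X} (hΩ : IsOpen Ω)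
    {A : Finset (StdNormedChart 𝕜 E)} {r : ℕ} {k : ℕ∞} (hr : (r : ℕ∞) ≤ k)
    {ξ η : Sections 𝕜 E k (closure Ω)} {s t : ℝ} (hs : 0 ≤ s) (ht : 0 ≤ t)
    (hξ : stdNorm Ω A r ξ.1 ≤ ENNReal.ofReal s) (hη : stdNorm Ω A r η.1 ≤ ENNReal.ofReal t) :
    stdNorm Ω A r (ξ + η).1 ≤ ENNReal.ofReal (s + t) := by
  rw [stdNorm_le_iff hs] at hξ
  rw [stdNorm_le_iff ht] at hη
  rw [stdNorm_le_iff (add_nonneg hs ht)]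
  intro c hc m hm i u hu
  have hmk : (m : WithTop ℕ∞) ≤ k := by
    have : (m : ℕ∞) ≤ k := le_trans (by exact_mod_cast hm) hr
    exact_mod_cast this
  have hn : closure Ω ∈ 𝓝 u := Filter.mem_of_superset (hΩ.mem_nhds hu.2) subset_closure
  have h : partialDeriv i (c.localRep (ξ + η).1) (c.φ u) =
      partialDeriv i (c.localRep ξ.1) (c.φ u) + partialDeriv i (c.localRep η.1) (c.φ u) := by
    have e : c.localRep (ξ + η).1 = c.localRep ξ.1 + c.localRep η.1 := c.localRep_add ξ.1 η.1
    rw [e]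
    simp only [partialDeriv]
    rw [iteratedFDeriv_add_apply ((c.contDiffAt_localRep hX hE ξ hu.1.1 hn).of_le hmk)
      ((c.contDiffAt_localRep hX hE η hu.1.1 hn).of_le hmk)]
    rfl
  rw [h, map_add]
  exact (map_add_le_add _ _ _).trans (add_le_add (hξ c hc m hm i u hu) (hη c hc m hm i u hu))

theorem norm_partialDeriv_le {n m : ℕ} {F : Type*} [NormedAddCommGroup F] [NormedSpace ℝ F]
    (i : Fin m → Fin n) (g : EucR n → F) (v : EucR n) :
    ‖partialDeriv i g v‖ ≤ ‖iteratedFDeriv ℝ m g v‖ := by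
  refine ((iteratedFDeriv ℝ m g v).le_opNorm _).trans_eq ?_
  simp

/-- A linear map which is bounded with respect to the standard norms is continuous. -/
theorem continuous_ckTopology {X' : Type*} [TopologicalSpace X'] [HasAtlas X']
    {E' : X' → Type*} [∀ x, AddCommGroup (E' x)] [∀ x, Module 𝕜 (E' x)] [HasTrivs 𝕜 E']
    (hX' : HasAtlas.Covers X') (hE' : ∀ x, ∃ τ ∈ HasTrivs.trivs (𝕜 := 𝕜) (E := E'), x ∈ τ.base)
    {k : ℕ∞} {Ω : Set X} {Ω' : Set X'} (hΩ' : IsOpen Ω')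
    (L : Sections 𝕜 E k (closure Ω) →ₗ[𝕜] Sections 𝕜 E' k (closure Ω'))
    (hL : ∀ A : Finset (StdNormedChart 𝕜 E'), IsStdNormedAtlas Ω' A → ∀ r : ℕ, (r : ℕ∞) ≤ k →
      ∃ B : Finset (StdNormedChart 𝕜 E), IsStdNormedAtlas Ω B ∧ ∃ C : ℝ, 0 ≤ C ∧
        ∀ ξ t, 0 ≤ t → stdNorm Ω B r ξ.1 ≤ ENNReal.ofReal t →
          stdNorm Ω' A r (L ξ).1 ≤ ENNReal.ofReal (C * t)) :
    Continuous[ckTopology 𝕜 E k Ω, ckTopology 𝕜 E' k Ω'] L := by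
  let _ := ckTopology 𝕜 E k Ω
  rw [continuous_generateFrom_iff]
  rintro _ ⟨A, hA, r, hr, η, ε, hε, rfl⟩
  obtain ⟨B, hB, C, hC, hLC⟩ := hL A hA r hr
  rw [isOpen_iff_forall_mem_open]
  intro ξ hξ
  have hξ' : stdNorm Ω' A r (L ξ - η).1 < ENNReal.ofReal ε := hξ
  -- The generating balls have arbitrary centres, so a ball around `ξ` is fitted by the triangle
  -- inequality into the room `ε - s` left by `L ξ`. Dividing by `2 * (C + 1)` is safe also for `C =
  -- 0`.
  set s : ℝ := (stdNorm Ω' A r (L ξ - η).1).toReal with hs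
  have hne : stdNorm Ω' A r (L ξ - η).1 ≠ ⊤ := hξ'.ne_top
  have hsε : s < ε := by
    rw [← ENNReal.ofReal_toReal hne] at hξ'
    exact (ENNReal.ofReal_lt_ofReal_iff hε).1 hξ'
  have hδ : 0 < (ε - s) / (2 * (C + 1)) := div_pos (by linarith) (by linarith)
  set δ : ℝ := (ε - s) / (2 * (C + 1)) with hδdef
  have hCδ : C * δ < ε - s := by
    have h1 : (C + 1) * δ = (ε - s) / 2 := by rw [hδdef]; field_simp
    nlinarith
  refine ⟨{ζ | stdNorm Ω B r (ζ - ξ).1 < ENNReal.ofReal δ}, fun ζ hζ => ?_,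
    TopologicalSpace.isOpen_generateFrom_of_mem ⟨B, hB, r, hr, ξ, δ, hδ, rfl⟩, ?_⟩
  · have h1 := hLC (ζ - ξ) δ hδ.le (le_of_lt hζ)
    have h2 := stdNorm_add_le hX' hE' hΩ' hr (mul_nonneg hC hδ.le) ENNReal.toReal_nonneg h1
      (ENNReal.ofReal_toReal hne).ge
    have h3 : L (ζ - ξ) + (L ξ - η) = L ζ - η := by rw [map_sub]; abel
    rw [h3] at h2
    exact h2.trans_lt ((ENNReal.ofReal_lt_ofReal_iff hε).2 (by linarith))
  · have h1 : stdNorm Ω B r (ξ - ξ).1 = 0 := by rw [sub_self]; exact stdNorm_zero Ω B r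
    rw [mem_ofPred_eq, h1]
    exact ENNReal.ofReal_pos.2 hδ

/-- The coordinates in a trivialization at `x` are continuous and vanish along `V`, so they vanish
at `x`. -/
theorem eq_zero_of_mem_closure (hX : HasAtlas.Covers X)
    (hE : ∀ x, ∃ τ ∈ HasTrivs.trivs (𝕜 := 𝕜) (E := E), x ∈ τ.base) {k : ℕ∞} {ξ : ∀ x, E x}
    {V : Set X} (hV : ∀ x ∈ V, ξ x = 0) {x : X} (hx : x ∈ closure V)
    (hξ : CkSectionAt 𝕜 k ξ x) : ξ x = 0 := by
  obtain ⟨τ, hτ, hxτ⟩ := hE x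
  have h1 := (hξ τ hτ hxτ).continuousAt hX
  have : (𝓝[V] x).NeBot := mem_closure_iff_nhdsWithin_neBot.1 hx
  have h2 : Filter.Tendsto (fun z => τ.coord z (ξ z)) (𝓝[V] x) (𝓝 0) := by
    refine tendsto_const_nhds.congr' ?_
    filter_upwards [self_mem_nhdsWithin] with z hz
    rw [hV z hz, map_zero]
  have h3 : τ.coord x (ξ x) = 0 := tendsto_nhds_unique (h1.mono_left nhdsWithin_le_nhds) h2
  rw [← τ.left_inv x hxτ (ξ x), h3, map_zero]

end Topology

/-! ### The integration functional -/

section Functional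

variable {𝕜 : Type*} [RCLike 𝕜] {G X P : Type*}
variable [TopologicalSpace G] [HasAtlas G] [IsDiffManifold G] [SecondCountableTopology G]
variable [MeasurableSpace G] [BorelSpace G]
variable [TopologicalSpace X] [HasAtlas X] [IsDiffManifold X]
variable [TopologicalSpace P] [HasAtlas P] [IsDiffManifold P]
variable {Γ : DiffGroupoid G X} {f : P → X}
variable {E : P → Type*} [∀ y, AddCommGroup (E y)] [∀ y, Module 𝕜 (E y)]
variable [HasTrivs 𝕜 E] [IsDiffVectorBundle 𝕜 E]

/-- The set lies in the preimage of a product of two compact sets: the closure of `V`, and the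
preimage of `Ū × Ū` under the proper anchor map. -/
theorem isCompact_closure_localDomain (hΓ : Γ.IsProper) (hf : Continuous f) {V : Set P}
    (hVc : IsCompact (closure V)) {U : Set X} (hUc : IsCompact (closure U)) [T2Space P] :
    IsCompact (closure (localDomain Γ f V U)) := by
  have := hΓ.1
  have := hΓ.2.1
  have hcl : IsClosedEmbedding (fun z : FiberProduct f Γ.tgt => z.1) :=
    (isClosed_eq (hf.comp continuous_fst)
      (Γ.submersive_tgt.1.1.comp continuous_snd)).isClosedEmbedding_subtypeVal
  refine (hcl.isCompact_preimage (hVc.prod (hΓ.2.2 _ (hUc.prod hUc)))).closure_of_subset ?_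
  rintro z ⟨h1, h2, h3⟩
  exact ⟨subset_closure h1, subset_closure h2, subset_closure h3⟩

theorem res_localDomain_surjective [T2Space G] [T2Space P] (hf : SmoothMap f) {V : Set P}
    {U : Set X} (hc : IsCompact (closure (localDomain Γ f V U))) (k : ℕ∞) :
    Function.Surjective (Sections.res 𝕜 (E := PullFst f Γ.tgt E) k
      (subset_univ (closure (localDomain Γ f V U)))) := by
  refine Sections.res_surjective hc fun z _ B hB hzB => ?_
  obtain ⟨c, hcz⟩ := exists_stdNormedChart (𝕜 := 𝕜) (E := E) z.1.1
  obtain ⟨D, hD⟩ := AdaptedData.exists_mem_unitBall hf Γ.submersive_tgt c hcz.1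
  obtain ⟨χ, a1, a2, a3, a4⟩ := exists_smooth_bump (D.toStd hf).smooth_φ hD.1 hB hzB
  exact ⟨χ, a1, a2, a3.trans inter_subset_left, a4⟩

/-- The integration functional as a linear map between spaces of cross-sections. -/
noncomputable def fiberIntegralHom [T2Space X] [T2Space G] [T2Space P]
    (ν : NormalizedHaarSystem Γ) (hf : SmoothMap f) (k : ℕ∞) :
    Sections 𝕜 (PullFst f Γ.tgt E) k univ →ₗ[𝕜] Sections 𝕜 E k univ where
  toFun θ := ⟨fun y => fiberIntegral 𝕜 ν f (fun z => θ.1 ⟨z, mem_univ z⟩) y,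
    mem_sections_univ.2 fun y => ckSectionAt_fiberIntegral ν hf (mem_sections_univ.1 θ.2) y⟩
  map_add' θ η := Subtype.ext <| funext fun y =>
    fiberIntegral_add ν hf (mem_sections_univ.1 θ.2) (mem_sections_univ.1 η.2) y.1
  map_smul' a θ := Subtype.ext <| funext fun y =>
    fiberIntegral_smul ν a (fun z => θ.1 ⟨z, mem_univ z⟩) y.1

/-- This is the well-definedness of the local functional. Adaptedness gives vanishing of the
integral on `V`, and continuity carries it to the closure. -/
theorem ker_res_le [T2Space X] [T2Space G] [T2Space P] (ν : NormalizedHaarSystem Γ)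
    (hf : SmoothMap f) {k : ℕ∞} {U : Set X} (hUν : Γ.IsAdapted ν.κ U) {V : Set P}
    (hfV : f '' V ⊆ U) :
    LinearMap.ker (Sections.res 𝕜 (E := PullFst f Γ.tgt E) k
      (subset_univ (closure (localDomain Γ f V U)))) ≤
    LinearMap.ker (Sections.res 𝕜 k (subset_univ (closure V)) ∘ₗ
      fiberIntegralHom (𝕜 := 𝕜) (E := E) ν hf k) := by
  intro θ hθ
  rw [LinearMap.mem_ker] at hθ ⊢
  refine Subtype.ext <| funext fun y => ?_
  refine eq_zero_of_mem_closure (𝕜 := 𝕜) (k := k)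
    (ξ := fiberIntegral 𝕜 ν f (fun z => θ.1 ⟨z, mem_univ z⟩))
    (IsDiffManifold.covers P) IsDiffVectorBundle.cover (fun x hx => ?_) y.2
    (ckSectionAt_fiberIntegral ν hf (mem_sections_univ.1 θ.2) y)
  refine fiberIntegral_eq_zero ν hUν hfV (fun z hz => ?_) hx
  exact congrFun (congrArg Subtype.val hθ) ⟨z, subset_closure hz⟩

/-- The local version of the integration functional is bounded in one chart. -/
theorem LocalFormula.exists_bound {ν : NormalizedHaarSystem Γ} {hf : SmoothMap f}
    {c : StdNormedChart 𝕜 E} {δ : VerticalVolumeDensity Γ.tgt} (L : LocalFormula ν hf c δ)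
    {U : Set X} (hU : IsOpen U) (hUν : Γ.IsAdapted ν.κ U) {V : Set P} (hV : IsOpen V)
    (hfV : f '' V ⊆ U) {k : ℕ∞} (r : ℕ) (hr : (r : ℕ∞) ≤ k) :
    ∃ C : ℝ, 0 ≤ C ∧ ∀ (θ : ∀ z : FiberProduct f Γ.tgt, PullFst f Γ.tgt E z)
      (_ : ∀ z, CkSectionAt 𝕜 k θ z)
      (ξ : Sections 𝕜 (PullFst f Γ.tgt E) k (closure (localDomain Γ f V U)))
      (_ : ∀ z : closure (localDomain Γ f V U), θ z = ξ.1 z)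
      (B : Finset (StdNormedChart 𝕜 (PullFst f Γ.tgt E))) (_ : ∀ i, (L.D i).toStd hf ∈ B)
      (t : ℝ) (_ : 0 ≤ t) (_ : stdNorm (localDomain Γ f V U) B r ξ.1 ≤ ENNReal.ofReal t),
      ∀ m ≤ r, ∀ i : Fin m → Fin c.dim, ∀ u ∈ c.unitBall ∩ V,
        c.p u (c.τ.symm u (partialDeriv i
          (c.localRep fun y : closure V => fiberIntegral 𝕜 ν f θ y) (c.φ u))) ≤ C * t := by
  obtain ⟨C, hC, hbound⟩ := L.exists_bound_value hU hUν hV hfV r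
  obtain ⟨M, hM, hnorm⟩ := c.exists_norm_bound
  refine ⟨M * C, mul_nonneg hM hC, fun θ hθ ξ hθξ B hB t ht hξ m hm i u hu => ?_⟩
  -- `u` lies in the open set `V`, so the coordinate expression over the closure of `V` agrees near
  -- `φ u` with the globally defined function `L.value θ`.
  have hev : c.localRep (fun y : closure V => fiberIntegral 𝕜 ν f θ y) =ᶠ[𝓝 (c.φ u)]
      L.value θ := by
    have h1 : Filter.Tendsto c.φ.symm (𝓝 (c.φ u)) (𝓝 u) := by
      have := c.φ.continuousAt_symm (c.φ.map_source hu.1.1)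
      rwa [ContinuousAt, c.φ.left_inv hu.1.1] at this
    filter_upwards [h1.eventually ((c.isOpen_unitBall.inter hV).mem_nhds hu)] with v hv
    rw [c.localRep_of_mem _ (subset_closure hv.2),
      L.coord_fiberIntegral (fun z => (hθ z).of_le bot_le) (c.unitBall_subset hv.1),
      c.φ.right_inv (by simp [c.target_φ])]
  have h2 : partialDeriv i (c.localRep fun y : closure V => fiberIntegral 𝕜 ν f θ y) (c.φ u) =
      partialDeriv i (L.value θ) (c.φ u) := by
    simp only [partialDeriv]
    rw [(hev.iteratedFDeriv ℝ m).eq_of_nhds]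
  rw [h2, mul_assoc]
  refine (hnorm u (c.unitBall_subset hu.1) _).trans (mul_le_mul_of_nonneg_left ?_ hM)
  exact (norm_partialDeriv_le i _ _).trans
    (hbound k hr θ hθ ξ hθξ B hB t ht hξ u ⟨hu.1.1, hu.2⟩ m hm)

end Functional

/-! ### Descent of the functional to closures, and its continuity -/

theorem exists_stdNormedAtlas {𝕜 : Type*} [RCLike 𝕜] {X : Type*} [TopologicalSpace X] [HasAtlas X]
    {E : X → Type*} [∀ x, AddCommGroup (E x)] [∀ x, Module 𝕜 (E x)] [HasTrivs 𝕜 E] {Ω : Set X}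
    (hΩ : IsCompact (closure Ω))
    (h : ∀ x ∈ closure Ω, ∃ c : StdNormedChart 𝕜 E, x ∈ c.unitBall) :
    ∃ A : Finset (StdNormedChart 𝕜 E), IsStdNormedAtlas Ω A :=
  hΩ.elim_finite_subcover (fun c : StdNormedChart 𝕜 E => c.unitBall)
    (fun c => c.isOpen_unitBall) fun x hx => mem_iUnion.2 (h x hx)

theorem mainTheorem8 {𝕜 : Type*} [RCLike 𝕜] {G X P : Type*}
    [TopologicalSpace G] [HasAtlas G] [IsDiffManifold G] [SecondCountableTopology G]
    [MeasurableSpace G] [BorelSpace G]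
    [TopologicalSpace X] [HasAtlas X] [IsDiffManifold X] [SecondCountableTopology X]
    [TopologicalSpace P] [HasAtlas P] [IsDiffManifold P] [SecondCountableTopology P] [T2Space P]
    (Γ : DiffGroupoid G X) (hΓ : Γ.IsProper) (ν : NormalizedHaarSystem Γ)
    (f : P → X) (hf : SmoothMap f)
    (E : P → Type*) [∀ y, AddCommGroup (E y)] [∀ y, Module 𝕜 (E y)]
    [HasTrivs 𝕜 E] [IsDiffVectorBundle 𝕜 E] (k : ℕ∞)
    (U : Set X) (hU : IsOpen U) (hUc : IsCompact (closure U)) (hUν : Γ.IsAdapted ν.κ U)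
    (V : Set P) (hV : IsOpen V) (hVc : IsCompact (closure V)) (hfV : f '' V ⊆ U) :
    ∃ I : Sections 𝕜 (PullFst f Γ.tgt E) k univ →ₗ[𝕜] Sections 𝕜 E k univ,
      (∀ θ : Sections 𝕜 (PullFst f Γ.tgt E) k univ, ∀ y : P,
        (∀ l : Module.Dual 𝕜 (E y),
          Integrable (fun h => l (alongFiber Γ f (fun z => θ.1 ⟨z, mem_univ z⟩) y h))
            (ν.measure (f y))) ∧
        (I θ).1 ⟨y, mem_univ y⟩ = fiberIntegral 𝕜 ν f (fun z => θ.1 ⟨z, mem_univ z⟩) y) ∧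
      (∃! L : Sections 𝕜 (PullFst f Γ.tgt E) k (closure (localDomain Γ f V U)) →ₗ[𝕜]
          Sections 𝕜 E k (closure V),
        L ∘ₗ Sections.res 𝕜 k (subset_univ _) = Sections.res 𝕜 k (subset_univ _) ∘ₗ I) ∧
      ∀ L : Sections 𝕜 (PullFst f Γ.tgt E) k (closure (localDomain Γ f V U)) →ₗ[𝕜]
          Sections 𝕜 E k (closure V),
        L ∘ₗ Sections.res 𝕜 k (subset_univ _) = Sections.res 𝕜 k (subset_univ _) ∘ₗ I →
        Continuous[ckTopology 𝕜 (PullFst f Γ.tgt E) k (localDomain Γ f V U),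
          ckTopology 𝕜 E k V] L := by
  have := hΓ.1
  have := hΓ.2.1
  have hc : IsCompact (closure (localDomain Γ f V U)) :=
    isCompact_closure_localDomain hΓ hf.1 hVc hUc
  have hsurj := res_localDomain_surjective (𝕜 := 𝕜) (E := E) hf hc k
  refine ⟨fiberIntegralHom ν hf k, fun θ y =>
    ⟨integrable_alongFiber ν hf (mem_sections_univ.1 θ.2) y, rfl⟩, ?_, fun L hL => ?_⟩
  -- The functional is defined by extending a section through a linear right inverse `g` of the
  -- restriction map and integrating. By `ker_res_le` the result does not depend on the extension.
  · obtain ⟨g, hg⟩ := LinearMap.exists_rightInverse_of_surjective _ (LinearMap.range_eq_top.2 hsurj)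
    refine ⟨(Sections.res 𝕜 k (subset_univ _) ∘ₗ fiberIntegralHom ν hf k) ∘ₗ g, ?_,
      fun L hL => ?_⟩
    · refine LinearMap.ext fun θ => ?_
      have h1 := ker_res_le (𝕜 := 𝕜) (E := E) (k := k) ν hf hUν hfV
        (x := g (Sections.res 𝕜 k (subset_univ _) θ) - θ) (by
          rw [LinearMap.mem_ker, map_sub, sub_eq_zero]
          exact LinearMap.congr_fun hg _)
      rw [LinearMap.mem_ker, map_sub, sub_eq_zero] at h1
      exact h1
    · change L = (Sections.res 𝕜 k (subset_univ _) ∘ₗ fiberIntegralHom ν hf k) ∘ₗ g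
      rw [← hL, LinearMap.comp_assoc, hg, LinearMap.comp_id]
  · refine continuous_ckTopology (IsDiffManifold.covers P) IsDiffVectorBundle.cover hV L
      fun A _ r hr => ?_
    obtain ⟨δ, hδ⟩ := ν.smooth
    let Λ := fun c : StdNormedChart 𝕜 E => (exists_localFormula ν hf c hδ).some
    choose C hC hbound using fun c => (Λ c).exists_bound hU hUν hV hfV r hr
    obtain ⟨B, hB⟩ := exists_stdNormedAtlas (𝕜 := 𝕜) (E := PullFst f Γ.tgt E) hc fun z _ => by
      obtain ⟨c, hcz⟩ := exists_stdNormedChart (𝕜 := 𝕜) (E := E) z.1.1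
      obtain ⟨D, hD⟩ := AdaptedData.exists_mem_unitBall hf Γ.submersive_tgt c hcz.1
      exact ⟨D.toStd hf, hD⟩
    classical
    -- The charts of `B` are there only to cover the closure; the adapted charts of the local
    -- formulas for all `c ∈ A` provide the estimates. The sum of the constants serves all `c` at
    -- once.
    refine ⟨B ∪ A.biUnion fun c => Finset.univ.image fun i => ((Λ c).D i).toStd hf,
      fun z hz => ?_, ∑ c ∈ A, C c, Finset.sum_nonneg fun c _ => hC c, fun ξ t ht hξ => ?_⟩
    · obtain ⟨c, hcB, hzc⟩ := mem_iUnion₂.1 (hB hz)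
      exact mem_iUnion₂.2 ⟨c, Finset.mem_union_left _ hcB, hzc⟩
    -- A global extension makes the integral formulas applicable. Its choice does not affect the
    -- bound, which involves only the standard norm of the restriction.
    · obtain ⟨θ, rfl⟩ := hsurj ξ
      have hLθ : (L (Sections.res 𝕜 k (subset_univ _) θ)).1 = fun y : closure V =>
          fiberIntegral 𝕜 ν f (fun z => θ.1 ⟨z, mem_univ z⟩) y :=
        congrArg Subtype.val (LinearMap.congr_fun hL θ)
      rw [stdNorm_le_iff (mul_nonneg (Finset.sum_nonneg fun c _ => hC c) ht), hLθ]
      intro c hcA m hm i u hu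
      refine (hbound c _ (mem_sections_univ.1 θ.2) _ (fun z => rfl) _ (fun i => ?_) t ht hξ m hm
        i u hu).trans ?_
      · exact Finset.mem_union_right _ (Finset.mem_biUnion.2
          ⟨c, hcA, Finset.mem_image.2 ⟨i, Finset.mem_univ _, rfl⟩⟩)
      · exact mul_le_mul_of_nonneg_right
          (Finset.single_le_sum (f := C) (fun c _ => hC c) hcA) ht
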